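/- **Setting.** Let $Q=(\mathbb R/2\pi\mathbb Z)^3$, $0<T<\infty$, $Q_T=Q\times[0,T)$, $\overline Q_T=Q\times[0,T]$. For $F\in\mathrm{Mat}^{3\times3}$ put $\Phi(F)=(F,\operatorname{cof}F,\det F)\in\mathrm{Mat}^{3\times3}\times\mathrm{Mat}^{3\times3}\times\mathbb R=\mathbb R^{19}$, write $\Xi=(F,Z,w)$ for points of $\mathbb R^{19}$, and sum over repeated indices ($i,\alpha=1,2,3$; $A=1,\dots,19$). Let $p\in(4,\infty)$, $q,r\in[2,\infty)$, and let $G:\mathbb R^{19}\to[0,\infty)$ satisfy: - (H1) $G\in C^3$ is strictly convex and $D^2G\ge\kappa$ for some constant $\kappa>0$; - (H2) $G(F,Z,w)\ge c_1(|F|^p+|Z|^q+|w|^r+1)-c_2$ for some constants $c_1>0$, $c_2\in\mathbb R$; - (H3) $G(F,Z,w)\le c(|F|^p+|Z|^q+|w|^r+1)$ for some constant $c$; - (H4)$'$ $|\partial_FG|+|\partial_ZG|^{\frac p{p-1}}+|\partial_wG|^{\frac p{p-2}}\le o(1)\,(|F|^p+|Z|^q+|w|^r+1)$, where $o(1)\to0$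 as $|\Xi|\to\infty$. Put $\eta(v,\Xi)=\frac12|v|^2+G(\Xi)$ and $g_{i\alpha}(\Xi)=\frac{\partial G}{\partial\Xi^A}(\Xi)\frac{\partial\Phi^A}{\partial F_{i\alpha}}(F)$. **Dissipative measure-valued solutions.** Let $(v^0,F^0)\in L^2(Q)\oplus L^p(Q)$ with $\int_Q\eta(v^0,\Phi(F^0))\,dx<\infty$. A *dissipative measure-valued solution with concentration* with initial data $(v^0,\Xi^0)=(v^0,\Phi(F^0))$ is a triple $(y,\nu,\gamma)$ such that: 1. $y:Q_T\to\mathbb R^3$ is locally integrable on $Q\times(0,T)$ with distributional derivatives $v=\partial_ty\in L^\infty(0,T;L^2(Q))$ and $F=\nabla y\in L^\infty(0,T;L^p(Q))$. 2. $\nu=(\nu_{x,t})$ is a measurable family of probability measures on $\mathbb R^3\times\mathbb R^{19}$, and $\gamma$ is a finite non-negative Borel measure on $\overline Q_T$. There are measurable $f^n=(v^n,\Xi^n):Q_T\to\mathbb R^3\times\mathbb R^{19}$ with $\sup_n\operatorname{ess\,sup}_t\int_Q\eta(f^n)\,dx<\infty$ such that $h(f^n)\rightharpoonup\langle\nu,h\rangle$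 weakly in $L^1(Q_T)$ for every continuous $h$ with $h/\eta\to0$ at infinity, and $\eta(f^n)-\langle\nu,\eta\rangle\to\gamma$ weakly-* as measures on $\overline Q_T$, i.e. tested against all $\psi\in C(\overline Q_T)$. 3. $v=\langle\nu,\lambda_v\rangle$, $F=\langle\nu,\lambda_F\rangle$, and $\Xi:=\langle\nu,\lambda_\Xi\rangle=\Phi(F)$ almost everywhere in $Q_T$. Here $(\lambda_v,\lambda_\Xi)$, $\lambda_\Xi=(\lambda_F,\lambda_Z,\lambda_w)$, are the coordinates on $\mathbb R^3\times\mathbb R^{19}$. 4. For all $\psi\in C^1_c(Q\times[0,T))$, all $i$ and all $A$, $$\int_Q\psi(x,0)v^0_i\,dx+\iint_{Q_T} v_i\,\partial_t\psi\,dxdt=\iint_{Q_T}\langle\nu,g_{i\alpha}(\lambda_\Xi)\rangle\,\partial_\alpha\psi\,dxdt,$$ $$\int_Q\psi(x,0)\Phi^A(F^0)\,dx+\iint_{Q_T}\Phi^A(F)\,\partial_t\psi\,dxdt=\iint_{Q_T}\frac{\partial\Phi^A}{\partial F_{i\alpha}}(F)\,v_i\,\partial_\alpha\psi\,dxdt.$$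 5. For all $\theta\in C^1_c([0,T))$ with $\theta\ge0$, $$\iint_{Q_T}\frac{d\theta}{dt}\bigl(\langle\nu,\eta\rangle\,dxdt+\gamma(dxdt)\bigr)+\int_Q\theta(0)\,\eta(v^0,\Phi(F^0))\,dx\ge0.$$ **Theorem.** Let $(y,\nu,\gamma)$ be a dissipative measure-valued solution with concentration with initial data $(v^0,\Xi^0)$, $\Xi^0=\Phi(F^0)$. Let $(\hat v,\hat F)\in W^{1,\infty}(\overline Q_T)$ be a Lipschitz solution, i.e. almost everywhere in $Q_T$ $$\partial_t\hat v_i=\partial_\alpha\bigl(g_{i\alpha}(\Phi(\hat F))\bigr),\qquad \partial_t\Phi^A(\hat F)=\partial_\alpha\Bigl(\frac{\partial\Phi^A}{\partial F_{i\alpha}}(\hat F)\,\hat v_i\Bigr).$$ If $(v^0,\Xi^0)=(\hat v,\Phi(\hat F))|_{t=0}$ almost everywhere in $Q$, then $\gamma=0$, and, almost everywhere in $Q_T$, $(v,\Xi)=(\hat v,\Phi(\hat F))$ and $\nu_{x,t}=\delta_{(\hat v(x,t),\Phi(\hat F(x,t)))}$. -/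

import Mathlib

open MeasureTheory ProbabilityTheory Filter Topology Set
open scoped NNReal ENNReal

namespace PolyconvexElasticity

noncomputable section

/-! ## Spaces -/

/-- Vectors of `ℝ³` with the Euclidean norm. -/
abbrev Vec3 : Type := EuclideanSpace ℝ (Fin 3)

/-- Real `3 × 3` matrices with the norm `|F|² = ∑ F i α ^ 2`; the entry `F i α` is `F (i, α)`. -/
abbrev Mat3 : Type := EuclideanSpace ℝ (Fin 3 × Fin 3)

/-- The space `Mat × Mat × ℝ = ℝ¹⁹` of the extended variable `Ξ = (F, Z, w)`. -/
abbrev Ext : Type := Mat3 × Mat3 × ℝ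

/-- The state space of the extended system: pairs `(v, Ξ)`. -/
abbrev State : Type := Vec3 × Ext

/-- The length `2π` of the spatial period is positive. -/
instance fact_two_pi_pos : Fact (0 < 2 * Real.pi) := ⟨Real.two_pi_pos⟩

/-- The spatial domain `Q = (ℝ / 2πℤ)³`. -/
abbrev Torus : Type := Fin 3 → AddCircle (2 * Real.pi)

/-- Space-time points are pairs `(t, x)`. This is the set `Q_T = [0, T) × Q`. -/
def QT (T : ℝ) : Set (ℝ × Torus) := Ico 0 T ×ˢ univ

/-- The closed space-time cylinder `[0, T] × Q`. -/
def QTbar (T : ℝ) : Set (ℝ × Torus) := Icc 0 T ×ˢ univ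

/-- Lebesgue measure `dx dt` on `Q_T`. -/
def muT (T : ℝ) : Measure (ℝ × Torus) := volume.restrict (QT T)

/-! ## Null Lagrangians, energy, stress -/

/-- An element of `Mat3` as a matrix. -/
def toMat (F : Mat3) : Matrix (Fin 3) (Fin 3) ℝ := Matrix.of fun i α => F (i, α)

/-- The cofactor matrix, i.e. the transposed adjugate. -/
def cof (F : Mat3) : Mat3 := WithLp.toLp 2 fun k => (toMat F).adjugate k.2 k.1

/-- The null Lagrangians `Φ(F) = (F, cof F, det F)`. -/
def Phi (F : Mat3) : Ext := (F, cof F, (toMat F).det)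

/-- The elementary matrix with a `1` in position `(i, α)`. -/
def elem (i α : Fin 3) : Mat3 := EuclideanSpace.single (i, α) 1

/-- `∂Φ / ∂F_{iα} (F)`, a vector of `ℝ¹⁹`. -/
def dPhi (i α : Fin 3) (F : Mat3) : Ext := fderiv ℝ Phi F (elem i α)

/-- The entropy `η(v, Ξ) = |v|² / 2 + G(Ξ)`. -/
def energy (G : Ext → ℝ) (s : State) : ℝ := ‖s.1‖ ^ 2 / 2 + G s.2

/-- The extended stress `∑_A ∂G/∂Ξ^A (Ξ) ∂Φ^A/∂F_{iα} (F)`, where `F` is the first component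
of `Ξ`. -/
def stress (G : Ext → ℝ) (i α : Fin 3) (X : Ext) : ℝ := fderiv ℝ G X (dPhi i α X.1)

/-- The flux `∑_i ∂Φ/∂F_{iα} (F) v_i` of the transport equations of the null Lagrangians. -/
def nullFlux (α : Fin 3) (F : Mat3) (v : Vec3) : Ext := ∑ i, v i • dPhi i α F

/-! ## Hypotheses on the stored energy -/

/-- `|F|^p + |Z|^q + |w|^r + 1`. -/
def growth (p q r : ℝ) (X : Ext) : ℝ := ‖X.1‖ ^ p + ‖X.2.1‖ ^ q + |X.2.2| ^ r + 1

/-- The structural hypotheses on `G`. -/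
structure StoredEnergy (G : Ext → ℝ) (p q r : ℝ) : Prop where
  exponent_p : 4 < p
  exponent_q : 2 ≤ q
  exponent_r : 2 ≤ r
  smooth : ContDiff ℝ 3 G
  nonneg : ∀ X, 0 ≤ G X
  strictConvex : StrictConvexOn ℝ univ G
  hessian_bound : ∃ κ : ℝ, 0 < κ ∧ ∀ X Y : Ext,
    κ * (‖Y.1‖ ^ 2 + ‖Y.2.1‖ ^ 2 + Y.2.2 ^ 2) ≤ fderiv ℝ (fderiv ℝ G) X Y Y
  lower_bound : ∃ c₁ c₂ : ℝ, 0 < c₁ ∧ ∀ X, c₁ * growth p q r X - c₂ ≤ G X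
  upper_bound : ∃ c : ℝ, ∀ X, G X ≤ c * growth p q r X
  derivative_growth :
    (fun X : Ext =>
      ‖fderiv ℝ (fun F => G (F, X.2.1, X.2.2)) X.1‖
        + ‖fderiv ℝ (fun Z => G (X.1, Z, X.2.2)) X.2.1‖ ^ (p / (p - 1))
        + |deriv (fun w => G (X.1, X.2.1, w)) X.2.2| ^ (p / (p - 2)))
      =o[cocompact Ext] growth p q r

/-! ## Calculus on space-time -/

/-- The time derivative of a function on space-time. -/
def dt {E : Type*} [NormedAddCommGroup E] [NormedSpace ℝ E] (f : ℝ × Torus → E)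
    (z : ℝ × Torus) : E :=
  deriv (fun s : ℝ => f (s, z.2)) z.1

/-- The spatial derivative `∂f/∂x_α` of a function on space-time. -/
def dx {E : Type*} [NormedAddCommGroup E] [NormedSpace ℝ E] (α : Fin 3) (f : ℝ × Torus → E)
    (z : ℝ × Torus) : E :=
  deriv (fun s : ℝ => f (z.1, z.2 + Pi.single α (s : AddCircle (2 * Real.pi)))) 0

/-- The lift of a function on `ℝ × Q` to a function on `ℝ × ℝ³` that is periodic in space. -/
def lift (ψ : ℝ × Torus → ℝ) (z : ℝ × (Fin 3 → ℝ)) : ℝ :=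
  ψ (z.1, fun j => (z.2 j : AddCircle (2 * Real.pi)))

/-- The test functions `ψ ∈ C¹_c([0, T) × Q)`. Only the values at times `t ≥ 0` matter; a `C¹`
function on `[0, T) × Q` extends to negative times. -/
def IsTestFunction (T : ℝ) (ψ : ℝ × Torus → ℝ) : Prop :=
  ContDiff ℝ 1 (lift ψ) ∧ ∃ b < T, ∀ t x, b ≤ t → ψ (t, x) = 0

/-- The test functions `ψ ∈ C¹_c((0, T) × Q)`. -/
def IsInteriorTestFunction (T : ℝ) (ψ : ℝ × Torus → ℝ) : Prop :=
  IsTestFunction T ψ ∧ ∃ a > 0, ∀ t x, t ≤ a → ψ (t, x) = 0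

/-- `f ∈ L^∞(0, T; L^p(Q))`. -/
def MemLinftyLp {E : Type*} [NormedAddCommGroup E] (T : ℝ) (p : ℝ≥0∞) (f : ℝ × Torus → E) :
    Prop :=
  AEStronglyMeasurable f (muT T) ∧
    ∃ C : ℝ≥0, ∀ᵐ t ∂(volume.restrict (Ico 0 T)), eLpNorm (fun x => f (t, x)) p volume ≤ C

/-- `v` and `F` are the distributional time derivative and spatial gradient of the locally
integrable map `y` on `(0, T) × Q`. -/
structure HasDistribDerivs (T : ℝ) (y : ℝ × Torus → Vec3) (v : ℝ × Torus → Vec3)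
    (F : ℝ × Torus → Mat3) : Prop where
  locInt : LocallyIntegrableOn y (Ioo 0 T ×ˢ univ) volume
  time : ∀ ψ, IsInteriorTestFunction T ψ → ∀ i,
    (∫ z, y z i * dt ψ z ∂(muT T)) = -(∫ z, v z i * ψ z ∂(muT T))
  space : ∀ ψ, IsInteriorTestFunction T ψ → ∀ i α,
    (∫ z, y z i * dx α ψ z ∂(muT T)) = -(∫ z, F z (i, α) * ψ z ∂(muT T))

/-! ## Young measures and concentration measures -/

/-- The sequence `f n = (vⁿ, Fⁿ, Zⁿ, wⁿ)` has uniformly bounded energy and generates the Young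
measure `ν`: for each continuous `g` of growth strictly less than the energy, `g ∘ f n` converges
weakly in `L¹(Q_T)` to `⟨ν, g⟩`. -/
structure GeneratesYoungMeasure (G : Ext → ℝ) (T : ℝ) (f : ℕ → ℝ × Torus → State)
    (ν : Kernel (ℝ × Torus) State) : Prop where
  aemeasurable : ∀ n, AEMeasurable (f n) (muT T)
  energy_bound : ∃ C : ℝ≥0, ∀ n, ∀ᵐ t ∂(volume.restrict (Ico 0 T)),
    ∫⁻ x : Torus, ENNReal.ofReal (energy G (f n (t, x))) ≤ C
  weak_limit : ∀ g : State → ℝ, Continuous g → g =o[cocompact State] energy G →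
    ∀ φ : ℝ × Torus → ℝ, Measurable φ → (∃ C, ∀ z, |φ z| ≤ C) →
      Tendsto (fun n => ∫ z, φ z * g (f n z) ∂(muT T)) atTop
        (𝓝 (∫ z, φ z * (∫ s, g s ∂(ν z)) ∂(muT T)))

/-- `γ` is the concentration measure of the energy along `f n`: a finite measure on
`[0, T] × Q` which is the weak-* limit of `η(f n) - ⟨ν, η⟩`. -/
structure GeneratesConcentration (G : Ext → ℝ) (T : ℝ) (f : ℕ → ℝ × Torus → State)
    (ν : Kernel (ℝ × Torus) State) (γ : Measure (ℝ × Torus)) : Prop where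
  finite : IsFiniteMeasure γ
  carrier : γ (QTbar T)ᶜ = 0
  weak_limit : ∀ ψ : ℝ × Torus → ℝ, Continuous ψ →
    Tendsto (fun n => ∫ z, ψ z * (energy G (f n z) - (∫ s, energy G s ∂(ν z))) ∂(muT T)) atTop
      (𝓝 (∫ z, ψ z ∂γ))

/-! ## Solutions -/

/-- `(y, ν)`, with velocity `v`, deformation gradient `F` and `Ξ = ⟨ν, λ_Ξ⟩`, is a measure-valued
solution on `Q_T` with initial data `(v₀, F₀) ∈ L² ⊕ L^p`. -/
structure IsMeasureValuedSolution (G : Ext → ℝ) (p T : ℝ) (v₀ : Torus → Vec3)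
    (F₀ : Torus → Mat3) (y v : ℝ × Torus → Vec3) (F : ℝ × Torus → Mat3) (Ξ : ℝ × Torus → Ext)
    (ν : Kernel (ℝ × Torus) State) : Prop where
  v₀_mem : MemLp v₀ 2 volume
  F₀_mem : MemLp F₀ (ENNReal.ofReal p) volume
  derivs : HasDistribDerivs T y v F
  v_mem : MemLinftyLp T 2 v
  F_mem : MemLinftyLp T (ENNReal.ofReal p) F
  markov : IsMarkovKernel ν
  generated : ∃ f, GeneratesYoungMeasure G T f ν
  mean_v : ∀ᵐ z ∂(muT T), v z = ∫ s, s.1 ∂(ν z)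
  mean_F : ∀ᵐ z ∂(muT T), F z = ∫ s, s.2.1 ∂(ν z)
  mean_Ξ : ∀ᵐ z ∂(muT T), Ξ z = ∫ s, s.2 ∂(ν z)
  momentum : ∀ ψ, IsTestFunction T ψ → ∀ i,
    (∫ x, ψ (0, x) * v₀ x i) + (∫ z, v z i * dt ψ z ∂(muT T))
      = ∫ z, (∑ α, (∫ s, stress G i α s.2 ∂(ν z)) * dx α ψ z) ∂(muT T)
  transport : ∀ ψ, IsTestFunction T ψ →
    (∫ x, ψ (0, x) • Phi (F₀ x)) + (∫ z, dt ψ z • Phi (F z) ∂(muT T))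
      = ∫ z, (∑ α, dx α ψ z • nullFlux α (F z) (v z)) ∂(muT T)
  constraint : ∀ᵐ z ∂(muT T), Ξ z = Phi (F z)

/-- A dissipative measure-valued solution with concentration: the averaged and integrated energy
inequality holds with the concentration measure `γ` of a sequence which generates `ν`. -/
structure IsDissipativeSolution (G : Ext → ℝ) (p T : ℝ) (v₀ : Torus → Vec3)
    (F₀ : Torus → Mat3) (y v : ℝ × Torus → Vec3) (F : ℝ × Torus → Mat3) (Ξ : ℝ × Torus → Ext)
    (ν : Kernel (ℝ × Torus) State) (γ : Measure (ℝ × Torus)) : Prop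
    extends IsMeasureValuedSolution G p T v₀ F₀ y v F Ξ ν where
  concentration : ∃ f, GeneratesYoungMeasure G T f ν ∧ GeneratesConcentration G T f ν γ
  initial_energy : Integrable (fun x => energy G (v₀ x, Phi (F₀ x))) volume
  dissipation : ∀ θ : ℝ → ℝ, ContDiff ℝ 1 θ → (∃ b < T, ∀ t, b ≤ t → θ t = 0) →
    (∀ t ∈ Ico 0 T, 0 ≤ θ t) →
    0 ≤ (∫ z, deriv θ z.1 * (∫ s, energy G s ∂(ν z)) ∂(muT T))
      + (∫ z, deriv θ z.1 ∂(γ.restrict (QT T)))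
      + (∫ x, θ 0 * energy G (v₀ x, Phi (F₀ x)))

/-- `(v, F) ∈ W^{1,∞}([0, T] × Q)` is a Lipschitz solution of the equations of polyconvex
elastodynamics, which hold almost everywhere. (Boundedness is automatic, as `[0, T] × Q` is
compact.) -/
structure IsLipschitzSolution (G : Ext → ℝ) (T : ℝ) (v : ℝ × Torus → Vec3)
    (F : ℝ × Torus → Mat3) : Prop where
  lipschitz_v : ∃ K : ℝ≥0, LipschitzOnWith K v (QTbar T)
  lipschitz_F : ∃ K : ℝ≥0, LipschitzOnWith K F (QTbar T)
  momentum : ∀ᵐ z ∂(muT T), ∀ i,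
    dt (fun z => v z i) z = ∑ α, dx α (fun z => stress G i α (Phi (F z))) z
  transport : ∀ᵐ z ∂(muT T),
    dt (fun z => Phi (F z)) z = ∑ α, dx α (fun z => nullFlux α (F z) (v z)) z

end

end PolyconvexElasticity

/-!
# Weak-strong uniqueness for dissipative measure-valued solutions of polyconvex elastodynamics

The proof is the relative energy method. Let `u = (v', Φ(F'))` be the Lipschitz solution and let
`h(z) = ∫ η(s | u(z)) dν_z(s)` be the averaged relative energy, where
`η(s | u) = η(s) - η(u) - Dη(u)(s - u)`. As `D²G ≥ κ`, `h` controls the variance of `ν_z` around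
`u(z)` (`StoredEnergy.relEnergy_quadratic`), so that `h = 0` forces `ν_z = δ_{u(z)}`
(`StoredEnergy.eq_dirac`). It suffices to prove that `h` and `γ` satisfy
`d/dt (∫ h dx + γ) ≤ C ∫ h dx` in the weak sense (`relative_energy_inequality`) and to conclude by
Gronwall's argument (`eq_zero_before`).

The inequality is the dissipation inequality of the measure-valued solution, minus the conservation
of energy of the Lipschitz solution (`IsGlobalSolution.energy_conservation`), minus the evolution of
the term `Dη(u)((v, Φ(F)) - u)` (`exists_remainder`). For the last one the weak equations
for the differences are tested with `θ v'_i` and `θ DG(Φ(F'))`. The terms of first order cancel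
(`StoredEnergy.remainder_identity`) thanks to the null Lagrangian structure, in three forms:

* `∂Φ/∂F_{iα} (F)` is affine in `Φ(F)`, with linear part `dPhiLin i α`, which annihilates the
  component `det F` and only sees the components `F` and `cof F`; hence it maps the Taylor remainder
  of `Φ` to a quadratic term (`norm_dPhiLin_remainder_le`).
* Piola's identity `∑_α ∂_α (∂Φ/∂F_{iα}) = 0` holds weakly for the difference of the two
  solutions (`piola_difference`). It is propagated from the initial data by the transport
  equations, because `dPhiLin i α (dPhi k β F)` is antisymmetric in `α, β`
  (`divergence_free_of_transport`).
* Nothing says that `F'` is a gradient. Its curl is the curl of `F`, which vanishes, by the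
  same propagation (`curl_free_lipschitz`), whence Piola's identity for `F'`.

The remaining quadratic terms are bounded by `C h`: the averaged Taylor remainder of the stress by
the growth hypotheses (`StoredEnergy.stress_mean_le`), the products of mean differences by Jensen's
inequality (`StoredEnergy.norm_mean_sub_sq_le_relEnergy`).

Two technical points. The natural test functions are only Lipschitz, so the weak equations are
first extended from `C¹` test functions by mollification on the universal cover
(`weak_identity_of_smooth`). The dissipation inequality says nothing about `γ` at the final time
`T`; there `γ` vanishes because the energy is bounded uniformly in time
(`StoredEnergy.concentration_final`).
-/

namespace PolyconvexElasticity

noncomputable section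

/-! ### Algebra of the null Lagrangians -/

theorem cof_apply (F : Mat3) (i α : Fin 3) :
    cof F (i, α) = F (i + 1, α + 1) * F (i + 2, α + 2) - F (i + 1, α + 2) * F (i + 2, α + 1) := by
  fin_cases i <;> fin_cases α <;>
    simp [cof, toMat, Matrix.adjugate_fin_three, Matrix.of_apply] <;> ring

/-- The symmetric bilinear map whose associated quadratic map is twice `cof`. -/
def cofPolar : Mat3 →ₗ[ℝ] Mat3 →ₗ[ℝ] Mat3 :=
  LinearMap.mk₂ ℝ
    (fun A B => WithLp.toLp 2 fun k =>
      A (k.1 + 1, k.2 + 1) * B (k.1 + 2, k.2 + 2) + B (k.1 + 1, k.2 + 1) * A (k.1 + 2, k.2 + 2)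
        - A (k.1 + 1, k.2 + 2) * B (k.1 + 2, k.2 + 1)
        - B (k.1 + 1, k.2 + 2) * A (k.1 + 2, k.2 + 1))
    (fun _ _ _ => by ext k; simp; ring) (fun _ _ _ => by ext k; simp; ring)
    (fun _ _ _ => by ext k; simp; ring) (fun _ _ _ => by ext k; simp; ring)

theorem cofPolar_apply (A B : Mat3) (i α : Fin 3) :
    cofPolar A B (i, α) =
      A (i + 1, α + 1) * B (i + 2, α + 2) + B (i + 1, α + 1) * A (i + 2, α + 2)
        - A (i + 1, α + 2) * B (i + 2, α + 1) - B (i + 1, α + 2) * A (i + 2, α + 1) := rfl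

theorem cofPolar_comm (A B : Mat3) : cofPolar A B = cofPolar B A := by
  ext ⟨i, α⟩
  simp only [cofPolar_apply]
  ring

theorem cof_add (A B : Mat3) : cof (A + B) = cof A + cofPolar A B + cof B := by
  ext ⟨i, α⟩
  simp only [cof_apply, cofPolar_apply, PiLp.add_apply]
  ring

theorem cof_smul (s : ℝ) (A : Mat3) : cof (s • A) = s ^ 2 • cof A := by
  ext ⟨i, α⟩
  simp only [cof_apply, PiLp.smul_apply, smul_eq_mul]
  ring

theorem elem_apply (i α j β : Fin 3) : elem i α (j, β) = if j = i ∧ β = α then 1 else 0 := by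
  simp [elem, Prod.ext_iff]

theorem elem_eq_mul (i α j β : Fin 3) :
    elem i α (j, β) = (if j = i then 1 else 0) * (if β = α then 1 else 0) := by
  rw [elem_apply, ite_and]
  split_ifs <;> simp

theorem cof_elem (i α : Fin 3) : cof (elem i α) = 0 := by
  ext ⟨j, β⟩
  rw [cof_apply]
  simp only [elem_eq_mul, PiLp.zero_apply]
  ring

theorem det_add_smul_elem (F : Mat3) (s : ℝ) (i α : Fin 3) :
    (toMat (F + s • elem i α)).det = (toMat F).det + s * cof F (i, α) := by
  rw [cof_apply, Matrix.det_fin_three, Matrix.det_fin_three]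
  fin_cases i <;> fin_cases α <;>
    simp [toMat, elem_apply] <;> ring

/-- The linear part of the affine dependence of `∂Φ/∂F_{iα} (F)` on `Φ(F)`. -/
def dPhiLin (i α : Fin 3) : Ext →L[ℝ] Ext :=
  LinearMap.toContinuousLinearMap
    { toFun := fun X => (0, cofPolar (elem i α) X.1, X.2.1 (i, α))
      map_add' := fun X Y => by simp
      map_smul' := fun c X => by simp }

theorem dPhiLin_apply (i α : Fin 3) (X : Ext) :
    dPhiLin i α X = (0, cofPolar (elem i α) X.1, X.2.1 (i, α)) := rfl

/-- `Φ` is affine along the rank-one directions `e_i ⊗ e_α`. -/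
theorem Phi_add_smul_elem (F : Mat3) (s : ℝ) (i α : Fin 3) :
    Phi (F + s • elem i α) = Phi F + s • ((elem i α, 0, 0) + dPhiLin i α (Phi F)) := by
  simp only [Phi, dPhiLin_apply]
  refine Prod.ext ?_ (Prod.ext ?_ ?_)
  · simp
  · simp [cof_add, cof_smul, cof_elem, cofPolar_comm (elem i α) F]
  · simp [det_add_smul_elem]

theorem contDiff_Phi : ContDiff ℝ ⊤ Phi := by
  have hc : ∀ k : Fin 3 × Fin 3, ContDiff ℝ ⊤ fun F : Mat3 => F k := fun k => by fun_prop
  refine contDiff_id.prodMk (ContDiff.prodMk ?_ ?_)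
  · rw [contDiff_euclidean]
    rintro ⟨i, α⟩
    simp only [cof_apply]
    exact ((hc _).mul (hc _)).sub ((hc _).mul (hc _))
  · simp only [Matrix.det_fin_three, toMat, Matrix.of_apply]
    fun_prop

theorem differentiable_Phi : Differentiable ℝ Phi := contDiff_Phi.differentiable (by simp)

theorem dPhi_eq (i α : Fin 3) (F : Mat3) :
    dPhi i α F = (elem i α, 0, 0) + dPhiLin i α (Phi F) := by
  have h1 : HasDerivAt (fun s : ℝ => Phi (F + s • elem i α)) (dPhi i α F) 0 :=
    (differentiable_Phi F).hasFDerivAt.hasLineDerivAt (elem i α)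
  have h2 : HasDerivAt (fun s : ℝ => Phi (F + s • elem i α))
      ((elem i α, 0, 0) + dPhiLin i α (Phi F)) 0 := by
    simp only [Phi_add_smul_elem]
    generalize (elem i α, 0, 0) + dPhiLin i α (Phi F) = Y
    simpa using ((hasDerivAt_id (0 : ℝ)).smul_const Y).const_add (Phi F)
  exact h1.unique h2

theorem dPhi_apply (i α : Fin 3) (F : Mat3) :
    dPhi i α F = (elem i α, cofPolar (elem i α) F, cof F (i, α)) := by
  simp [dPhi_eq, dPhiLin_apply, Phi]

theorem contDiff_dPhi (i α : Fin 3) : ContDiff ℝ ⊤ (dPhi i α) := by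
  have : dPhi i α = fun F => (elem i α, 0, 0) + dPhiLin i α (Phi F) := funext (dPhi_eq i α)
  rw [this]
  exact contDiff_const.add ((dPhiLin i α).contDiff.comp contDiff_Phi)

theorem hasFDerivAt_dPhi (i α : Fin 3) (F : Mat3) :
    HasFDerivAt (dPhi i α) ((dPhiLin i α).comp (fderiv ℝ Phi F)) F := by
  have : dPhi i α = fun F => (elem i α, 0, 0) + dPhiLin i α (Phi F) := funext (dPhi_eq i α)
  rw [this]
  exact ((dPhiLin i α).hasFDerivAt.comp F (differentiable_Phi F).hasFDerivAt).const_add _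

theorem eq_sum_elem (H : Mat3) : H = ∑ k, ∑ β, H (k, β) • elem k β := by
  ext ⟨j, γ⟩
  simp [elem_apply, Fin.sum_univ_three]
  fin_cases j <;> fin_cases γ <;> simp

theorem fderiv_Phi_apply (F H : Mat3) :
    fderiv ℝ Phi F H = ∑ k, ∑ β, H (k, β) • dPhi k β F := by
  conv_lhs => rw [eq_sum_elem H]
  simp [map_sum, dPhi]

/-- The second derivatives of `Φ` in the directions `e_i ⊗ e_α` and `e_k ⊗ e_β` are antisymmetric
in `α` and `β`. -/
theorem dPhiLin_dPhi_antisymm (i k α β : Fin 3) (F : Mat3) :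
    dPhiLin i α (dPhi k β F) = -dPhiLin i β (dPhi k α F) := by
  simp only [dPhiLin_apply, dPhi_apply]
  refine Prod.ext ?_ (Prod.ext ?_ ?_)
  · simp
  · ext ⟨j, γ⟩
    simp only [Prod.snd_neg, Prod.fst_neg, PiLp.neg_apply, cofPolar_apply, elem_eq_mul]
    ring
  · simp only [Prod.snd_neg, cofPolar_apply, elem_eq_mul]
    fin_cases α <;> fin_cases β <;> simp

/-- The algebraic core of the Piola identity: the divergence of `∂Φ/∂F_{iα}` along a field with
symmetric derivatives vanishes. -/
theorem piola_algebra (i : Fin 3) (F : Mat3) (H : Fin 3 → Mat3)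
    (hH : ∀ k α β, H α (k, β) = H β (k, α)) :
    ∑ α, dPhiLin i α (fderiv ℝ Phi F (H α)) = 0 := by
  have h1 : ∑ α, dPhiLin i α (fderiv ℝ Phi F (H α))
      = ∑ k, ∑ α, ∑ β, H α (k, β) • dPhiLin i α (dPhi k β F) := by
    simp only [fderiv_Phi_apply, map_sum, map_smul]
    rw [Finset.sum_comm]
  rw [h1]
  refine Finset.sum_eq_zero fun k _ => ?_
  have h2 : ∑ α, ∑ β, H α (k, β) • dPhiLin i α (dPhi k β F)
      = -∑ α, ∑ β, H α (k, β) • dPhiLin i α (dPhi k β F) := by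
    conv_lhs => rw [Finset.sum_comm]
    simp only [← Finset.sum_neg_distrib]
    refine Finset.sum_congr rfl fun α _ => Finset.sum_congr rfl fun β _ => ?_
    rw [dPhiLin_dPhi_antisymm, hH, smul_neg]
  have h3 : (2 : ℝ) • ∑ α, ∑ β, H α (k, β) • dPhiLin i α (dPhi k β F) = 0 := by
    rw [two_smul]
    exact add_eq_zero_iff_eq_neg.mpr h2
  exact (smul_eq_zero.mp h3).resolve_left two_ne_zero

theorem norm_elem (i α : Fin 3) : ‖elem i α‖ = 1 := by simp [elem]

theorem abs_apply_le_norm (F : Mat3) (k : Fin 3 × Fin 3) : |F k| ≤ ‖F‖ := by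
  simpa using PiLp.norm_apply_le F k

theorem abs_cof_apply_le (F : Mat3) (k : Fin 3 × Fin 3) : |cof F k| ≤ 2 * ‖F‖ ^ 2 := by
  obtain ⟨i, α⟩ := k
  rw [cof_apply]
  have h : ∀ k l, |F k * F l| ≤ ‖F‖ ^ 2 := fun k l => by
    rw [abs_mul, sq]
    exact mul_le_mul (abs_apply_le_norm F k) (abs_apply_le_norm F l) (abs_nonneg _) (norm_nonneg _)
  calc _ ≤ |F (i + 1, α + 1) * F (i + 2, α + 2)| + |F (i + 1, α + 2) * F (i + 2, α + 1)| :=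
        abs_sub _ _
    _ ≤ _ := by linarith [h (i + 1, α + 1) (i + 2, α + 2), h (i + 1, α + 2) (i + 2, α + 1)]

theorem hasFDerivAt_cof (F : Mat3) :
    HasFDerivAt cof (LinearMap.toContinuousLinearMap (cofPolar F)) F := by
  have hd : DifferentiableAt ℝ cof F := by
    exact (differentiable_Phi F).snd.fst
  convert hd.hasFDerivAt using 1
  ext1 H
  have h1 := hd.hasFDerivAt.hasLineDerivAt H
  have h2 : HasDerivAt (fun s : ℝ => cof (F + s • H)) (cofPolar F H) 0 := by
    simp only [cof_add, cof_smul, map_smul]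
    have := (((hasDerivAt_id (0 : ℝ)).smul_const (cofPolar F H)).const_add (cof F)).add
      (((hasDerivAt_id (0 : ℝ)).pow 2).smul_const (cof H))
    refine (this.congr_deriv (by simp)).congr_of_eventuallyEq (Eventually.of_forall fun s => ?_)
    simp
  exact h2.unique h1

theorem fderiv_Phi_cof (F H : Mat3) : (fderiv ℝ Phi F H).2.1 = cofPolar F H := by
  have h := (hasFDerivAt_cof F)
  have h' : HasFDerivAt cof (((ContinuousLinearMap.fst ℝ Mat3 ℝ).comp
      (ContinuousLinearMap.snd ℝ Mat3 (Mat3 × ℝ))).comp (fderiv ℝ Phi F)) F :=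
    (((ContinuousLinearMap.fst ℝ Mat3 ℝ).comp
      (ContinuousLinearMap.snd ℝ Mat3 (Mat3 × ℝ))).hasFDerivAt).comp F
      (differentiable_Phi F).hasFDerivAt
  have := congrArg (fun L : Mat3 →L[ℝ] Mat3 => L H) (h.unique h')
  simpa using this.symm

theorem fderiv_Phi_fst (F H : Mat3) : (fderiv ℝ Phi F H).1 = H := by
  have h' : HasFDerivAt (fun F : Mat3 => F)
      ((ContinuousLinearMap.fst ℝ Mat3 (Mat3 × ℝ)).comp (fderiv ℝ Phi F)) F :=
    ((ContinuousLinearMap.fst ℝ Mat3 (Mat3 × ℝ)).hasFDerivAt).comp F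
      (differentiable_Phi F).hasFDerivAt
  have := congrArg (fun L : Mat3 →L[ℝ] Mat3 => L H) ((hasFDerivAt_id F).unique h')
  simpa using this.symm

/-- Only the cofactors enter the linear part of `∂Φ/∂F_{iα}`, so that its Taylor remainder is
quadratic, although `det` is cubic. -/
theorem norm_dPhiLin_remainder_le (i α : Fin 3) (F F' : Mat3) :
    ‖dPhiLin i α (Phi F' - Phi F - fderiv ℝ Phi F (F' - F))‖ ≤ 2 * ‖F' - F‖ ^ 2 := by
  set H := F' - F
  have hF' : F' = F + H := by simp [H]
  have : dPhiLin i α (Phi F' - Phi F - fderiv ℝ Phi F H) = (0, 0, cof H (i, α)) := by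
    rw [dPhiLin_apply, hF']
    simp [Phi, fderiv_Phi_fst, fderiv_Phi_cof, cof_add]
    ring
  rw [this]
  simpa [Prod.norm_def, abs_nonneg] using abs_cof_apply_le H (i, α)

/-! ### Growth of the stored energy and its relative version -/

theorem one_le_growth (p q r : ℝ) (X : Ext) : 1 ≤ growth p q r X := by
  have h1 : 0 ≤ ‖X.1‖ ^ p := by positivity
  have h2 : 0 ≤ ‖X.2.1‖ ^ q := by positivity
  have h3 : 0 ≤ |X.2.2| ^ r := by positivity
  unfold growth
  linarith

theorem sq_le_rpow_add_one {x s : ℝ} (hx : 0 ≤ x) (hs : 2 ≤ s) : x ^ 2 ≤ x ^ s + 1 := by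
  rcases le_total x 1 with h | h
  · have : x ^ 2 ≤ 1 := pow_le_one₀ hx h
    have : 0 ≤ x ^ s := by positivity
    linarith
  · have : x ^ (2 : ℝ) ≤ x ^ s := Real.rpow_le_rpow_of_exponent_le h hs
    rw [Real.rpow_two] at this
    linarith

theorem norm_sq_ext_le (X : Ext) : ‖X‖ ^ 2 ≤ ‖X.1‖ ^ 2 + ‖X.2.1‖ ^ 2 + X.2.2 ^ 2 := by
  have h1 := sq_nonneg ‖X.1‖
  have h2 := sq_nonneg ‖X.2.1‖
  have h3 := sq_nonneg X.2.2
  rw [Prod.norm_def, Prod.norm_def, Real.norm_eq_abs]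
  rcases max_choice ‖X.1‖ (max ‖X.2.1‖ |X.2.2|) with h | h <;> rw [h]
  · linarith
  · rcases max_choice ‖X.2.1‖ |X.2.2| with h | h <;> rw [h]
    · linarith
    · rw [sq_abs]; linarith

/-- The part `G(Y) - G(X) - DG(X)(Y - X)` of the relative entropy. -/
def relG (G : Ext → ℝ) (X Y : Ext) : ℝ := G Y - G X - fderiv ℝ G X (Y - X)

/-- The relative entropy of the states `s` and `u`. -/
def relEnergy (G : Ext → ℝ) (u s : State) : ℝ :=
  energy G s - energy G u - inner ℝ u.1 (s.1 - u.1) - fderiv ℝ G u.2 (s.2 - u.2)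

theorem relEnergy_eq (G : Ext → ℝ) (u s : State) :
    relEnergy G u s = ‖s.1 - u.1‖ ^ 2 / 2 + relG G u.2 s.2 := by
  have h := norm_add_sq_real u.1 (s.1 - u.1)
  rw [add_sub_cancel] at h
  simp only [relEnergy, energy, relG]
  rw [h]
  ring

/-- A lower bound for the second derivative gives a lower bound for the Taylor remainder of second
order on `[0, 1]`. -/
theorem taylor_lower_bound {f f' f'' : ℝ → ℝ} {m : ℝ} (h1 : ∀ s, HasDerivAt f (f' s) s)
    (h2 : ∀ s, HasDerivAt f' (f'' s) s) (hm : ∀ s, m ≤ f'' s) : m / 2 ≤ f 1 - f 0 - f' 0 := by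
  have h3 : MonotoneOn (fun s => f' s - m * s) (Icc 0 1) := by
    refine monotoneOn_of_deriv_nonneg (convex_Icc 0 1) ?_ ?_ ?_
    · exact HasDerivAt.continuousOn fun s _ => (h2 s).sub ((hasDerivAt_id s).const_mul m)
    · exact fun s _ =>
        ((h2 s).sub ((hasDerivAt_id s).const_mul m)).differentiableAt.differentiableWithinAt
    · intro s _
      have hd : HasDerivAt (fun s => f' s - m * s) (f'' s - m * 1) s :=
        (h2 s).sub ((hasDerivAt_id' s).const_mul m)
      rw [hd.deriv]
      linarith [hm s]
  have hd : ∀ s, HasDerivAt (fun s => f s - f' 0 * s - m / 2 * s ^ 2)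
      (f' s - f' 0 * 1 - m / 2 * ((2 : ℕ) * s ^ (2 - 1))) s := fun s =>
    ((h1 s).sub ((hasDerivAt_id' s).const_mul _)).sub ((hasDerivAt_pow 2 s).const_mul _)
  have h4 : MonotoneOn (fun s => f s - f' 0 * s - m / 2 * s ^ 2) (Icc 0 1) := by
    refine monotoneOn_of_deriv_nonneg (convex_Icc 0 1) ?_ ?_ ?_
    · exact HasDerivAt.continuousOn fun s _ => hd s
    · exact fun s _ => (hd s).differentiableAt.differentiableWithinAt
    · intro s hs
      have hs' := interior_subset hs
      rw [(hd s).deriv]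
      have := h3 (left_mem_Icc.2 zero_le_one) hs' hs'.1
      simp at this
      norm_num
      linarith
  have := h4 (left_mem_Icc.2 zero_le_one) (right_mem_Icc.2 zero_le_one) zero_le_one
  norm_num at this
  linarith

section

variable {G : Ext → ℝ} {p q r : ℝ} (hG : StoredEnergy G p q r)
include hG

theorem StoredEnergy.differentiable : Differentiable ℝ G := hG.smooth.differentiable (by norm_num)

theorem StoredEnergy.contDiff_fderiv : ContDiff ℝ 2 (fderiv ℝ G) :=
  hG.smooth.fderiv_right (by norm_num)

theorem StoredEnergy.norm_sq_le_growth (X : Ext) : ‖X‖ ^ 2 ≤ 3 * growth p q r X := by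
  have h1 := sq_le_rpow_add_one (norm_nonneg X.1) (by linarith [hG.exponent_p] : 2 ≤ p)
  have h2 := sq_le_rpow_add_one (norm_nonneg X.2.1) hG.exponent_q
  have h3 := sq_le_rpow_add_one (abs_nonneg X.2.2) hG.exponent_r
  have h4 := norm_sq_ext_le X
  have h5 := one_le_growth p q r X
  rw [sq_abs] at h3
  unfold growth at h5 ⊢
  nlinarith

theorem StoredEnergy.growth_le : ∃ C, 0 ≤ C ∧ ∀ X, growth p q r X ≤ C * (G X + 1) := by
  obtain ⟨c₁, c₂, hc₁, h⟩ := hG.lower_bound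
  refine ⟨(1 + |c₂|) / c₁, by positivity, fun X => ?_⟩
  rw [div_mul_eq_mul_div, le_div_iff₀ hc₁]
  have h0 := hG.nonneg X
  have h1 := h X
  have h2 := le_abs_self c₂
  have h3 := mul_nonneg (abs_nonneg c₂) h0
  linarith

theorem StoredEnergy.relG_quadratic :
    ∃ κ, 0 < κ ∧ ∀ X Y, κ * ‖Y - X‖ ^ 2 ≤ relG G X Y := by
  obtain ⟨κ, hκ, h⟩ := hG.hessian_bound
  refine ⟨κ / 2, by positivity, fun X Y => ?_⟩
  set H := Y - X
  have hl : ∀ s : ℝ, HasDerivAt (fun s : ℝ => X + s • H) H s := fun s => by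
    simpa using ((hasDerivAt_id s).smul_const H).const_add X
  have h1 : ∀ s : ℝ, HasDerivAt (fun s : ℝ => G (X + s • H)) (fderiv ℝ G (X + s • H) H) s :=
    fun s => (hG.differentiable _).hasFDerivAt.comp_hasDerivAt s (hl s)
  have h2 : ∀ s : ℝ, HasDerivAt (fun s : ℝ => fderiv ℝ G (X + s • H) H)
      (fderiv ℝ (fderiv ℝ G) (X + s • H) H H) s := fun s => by
    have := ((hG.contDiff_fderiv.differentiable (by norm_num)) (X + s • H)).hasFDerivAt
      |>.comp_hasDerivAt s (hl s)
    simpa using this.clm_apply (hasDerivAt_const s H)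
  have h3 := taylor_lower_bound (m := κ * ‖H‖ ^ 2) h1 h2 fun s =>
    (mul_le_mul_of_nonneg_left (norm_sq_ext_le H) hκ.le).trans (h _ H)
  simp only [one_smul, zero_smul, add_zero] at h3
  have hY : X + H = Y := by simp [H]
  rw [hY] at h3
  unfold relG
  linarith

theorem StoredEnergy.relG_nonneg (X Y : Ext) : 0 ≤ relG G X Y := by
  obtain ⟨κ, hκ, h⟩ := hG.relG_quadratic
  exact le_trans (by positivity) (h X Y)

/-- The superlinear growth of `G` dominates the affine part of the relative entropy. -/
theorem StoredEnergy.relG_growth (M : ℝ) :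
    ∃ C, ∀ X Y, ‖X‖ ≤ M → growth p q r Y ≤ C * (relG G X Y + 1) := by
  obtain ⟨c₁, c₂, hc₁, h⟩ := hG.lower_bound
  obtain ⟨A, hA⟩ := (isCompact_closedBall (0 : Ext) M).exists_bound_of_continuousOn
    hG.smooth.continuous.continuousOn
  obtain ⟨K, hK⟩ := (isCompact_closedBall (0 : Ext) M).exists_bound_of_continuousOn
    hG.contDiff_fderiv.continuous.continuousOn
  have key : ∀ X Y, ‖X‖ ≤ M →
      c₁ / 2 * growth p q r Y - (|c₂| + |A| + |K| * |M| + 3 / 2 * K ^ 2 / c₁) ≤ relG G X Y := by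
    intro X Y hX
    have hX' : X ∈ Metric.closedBall (0 : Ext) M := by simpa using hX
    have h1 := (le_abs_self _).trans (hA X hX')
    have h2 := hK X hX'
    have hK0 : 0 ≤ K := (norm_nonneg _).trans h2
    have h3 : fderiv ℝ G X (Y - X) ≤ K * (‖Y‖ + M) := by
      refine (Real.le_norm_self _).trans ((ContinuousLinearMap.le_opNorm _ _).trans ?_)
      exact mul_le_mul h2 ((norm_sub_le _ _).trans (by linarith)) (norm_nonneg _) hK0
    -- The linear term is absorbed by the growth of `G`; `c₁ / 6` fits `‖Y‖² ≤ 3 growth Y`.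
    have h4 : K * ‖Y‖ ≤ c₁ / 6 * ‖Y‖ ^ 2 + 3 / 2 * K ^ 2 / c₁ := by
      have : 0 ≤ (c₁ * ‖Y‖ - 3 * K) ^ 2 / (6 * c₁) := by positivity
      have e : (c₁ * ‖Y‖ - 3 * K) ^ 2 / (6 * c₁)
          = c₁ / 6 * ‖Y‖ ^ 2 + 3 / 2 * K ^ 2 / c₁ - K * ‖Y‖ := by
        field_simp
        ring
      linarith
    have h5 := mul_le_mul_of_nonneg_left (hG.norm_sq_le_growth Y) (by positivity : 0 ≤ c₁ / 6)
    have h6 := h Y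
    have h7 : K * M ≤ |K| * |M| := by rw [← abs_mul]; exact le_abs_self _
    have h8 := le_abs_self c₂
    have h9 := le_abs_self A
    unfold relG
    linarith
  set D := |c₂| + |A| + |K| * |M| + 3 / 2 * K ^ 2 / c₁
  have hD : 0 ≤ D := by positivity
  refine ⟨2 / c₁ * (1 + D), fun X Y hX => ?_⟩
  have h1 := key X Y hX
  have h2 := mul_nonneg hD (hG.relG_nonneg X Y)
  rw [mul_assoc, div_mul_eq_mul_div, le_div_iff₀ hc₁]
  nlinarith [hG.relG_nonneg X Y]

/-- The second order Taylor remainder of a `C²` function which is dominated by the energy is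
controlled by the relative entropy: quadratically near the base point, by the growth of the
energy far from it. -/
theorem StoredEnergy.taylor_le_relG {g : Ext → ℝ} (hg : ContDiff ℝ 2 g) {A : ℝ}
    (hA : ∀ X, |g X| ≤ A * growth p q r X) (M : ℝ) :
    ∃ C, ∀ X Y, ‖X‖ ≤ M → |g Y - g X - fderiv ℝ g X (Y - X)| ≤ C * relG G X Y := by
  obtain ⟨κ, hκ, hq⟩ := hG.relG_quadratic
  obtain ⟨B, hB⟩ := hG.relG_growth M
  have hg1 : ContDiff ℝ 1 (fderiv ℝ g) := hg.fderiv_right (by norm_num)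
  obtain ⟨L, hL⟩ := hg1.contDiffOn.exists_lipschitzOnWith (s := Metric.closedBall (0 : Ext) (M + 1))
    (by norm_num) (convex_closedBall _ _) (isCompact_closedBall _ _)
  obtain ⟨K₀, hK₀⟩ := (isCompact_closedBall (0 : Ext) M).exists_bound_of_continuousOn
    hg.continuous.continuousOn
  obtain ⟨K₁, hK₁⟩ := (isCompact_closedBall (0 : Ext) M).exists_bound_of_continuousOn
    hg1.continuous.continuousOn
  refine ⟨L / κ + |A| * |B| * (1 + 1 / κ) + |K₀| / κ + |K₁| / κ, fun X Y hX => ?_⟩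
  have hX' : X ∈ Metric.closedBall (0 : Ext) M := by simpa using hX
  have hR := hG.relG_nonneg X Y
  have hn := norm_nonneg (Y - X)
  have hsq : ‖Y - X‖ ^ 2 ≤ relG G X Y / κ := by
    rw [le_div_iff₀ hκ, mul_comm]
    exact hq X Y
  -- For `‖Y - X‖ ≤ 1` the remainder is quadratic by the local Lipschitz bound for `Dg`, otherwise
  -- `relG G X Y ≥ κ` dominates each term separately.
  rcases le_total ‖Y - X‖ 1 with h | h
  · have h1 : ‖g Y - g X - fderiv ℝ g X (Y - X)‖ ≤ (L * ‖Y - X‖) * ‖Y - X‖ := by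
      refine (convex_segment X Y).norm_image_sub_le_of_norm_hasFDerivWithin_le'
        (f' := fderiv ℝ g) (fun Z _ =>
          ((hg.differentiable (by norm_num)) Z).hasFDerivAt.hasFDerivWithinAt) ?_
        (left_mem_segment ℝ X Y) (right_mem_segment ℝ X Y)
      intro Z hZ
      have hZX : ‖Z - X‖ ≤ ‖Y - X‖ := by
        have := norm_sub_le_of_mem_segment hZ
        exact this
      have hZ' : Z ∈ Metric.closedBall (0 : Ext) (M + 1) := by
        rw [mem_closedBall_zero_iff]
        calc ‖Z‖ = ‖X + (Z - X)‖ := by simp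
          _ ≤ ‖X‖ + ‖Z - X‖ := norm_add_le _ _
          _ ≤ M + 1 := by linarith
      refine (hL.norm_sub_le hZ' (Metric.closedBall_subset_closedBall (by linarith) hX')).trans ?_
      gcongr
    rw [← Real.norm_eq_abs]
    refine h1.trans ?_
    have h2 : (L : ℝ) * ‖Y - X‖ * ‖Y - X‖ ≤ L / κ * relG G X Y := by
      rw [mul_assoc, ← sq, div_mul_eq_mul_div, mul_div_assoc]
      gcongr
    refine h2.trans (mul_le_mul_of_nonneg_right ?_ hR)
    have : 0 ≤ |A| * |B| * (1 + 1 / κ) + |K₀| / κ + |K₁| / κ := by positivity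
    linarith
  · have h1 : (1 : ℝ) ≤ ‖Y - X‖ ^ 2 := one_le_pow₀ h
    have h2 : 1 ≤ relG G X Y / κ := h1.trans hsq
    have h3 : ‖Y - X‖ ≤ relG G X Y / κ := by nlinarith
    have h4 : |g Y| ≤ |A| * (|B| * (relG G X Y * (1 + 1 / κ))) := by
      have e0 : 0 ≤ growth p q r Y := zero_le_one.trans (one_le_growth p q r Y)
      refine (hA Y).trans ?_
      refine mul_le_mul (le_abs_self A) ?_ e0 (abs_nonneg A)
      refine (hB X Y hX).trans ?_
      refine mul_le_mul (le_abs_self B) ?_ (by linarith) (abs_nonneg B)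
      have : relG G X Y * (1 + 1 / κ) = relG G X Y + relG G X Y / κ := by ring
      linarith
    have h5 : |g X| ≤ |K₀| * (relG G X Y / κ) := by
      have := hK₀ X hX'
      rw [Real.norm_eq_abs] at this
      have h6 := le_abs_self K₀
      nlinarith [abs_nonneg K₀]
    have h6 : |fderiv ℝ g X (Y - X)| ≤ |K₁| * (relG G X Y / κ) :=
      (ContinuousLinearMap.le_opNorm _ _).trans
        (mul_le_mul ((hK₁ X hX').trans (le_abs_self _)) h3 hn (abs_nonneg _))
    have h7 : 0 ≤ L / κ * relG G X Y := by positivity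
    calc |g Y - g X - fderiv ℝ g X (Y - X)| ≤ |g Y - g X| + |fderiv ℝ g X (Y - X)| := abs_sub _ _
      _ ≤ |g Y| + |g X| + |fderiv ℝ g X (Y - X)| := by linarith [abs_sub (g Y) (g X)]
      _ ≤ _ := by
        have e : (L / κ + |A| * |B| * (1 + 1 / κ) + |K₀| / κ + |K₁| / κ) * relG G X Y
          = L / κ * relG G X Y + |A| * (|B| * (relG G X Y * (1 + 1 / κ)))
            + |K₀| * (relG G X Y / κ) + |K₁| * (relG G X Y / κ) := by ring
        rw [e]
        linarith

theorem StoredEnergy.contDiff_stress (i α : Fin 3) : ContDiff ℝ 2 (stress G i α) := by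
  unfold stress
  exact hG.contDiff_fderiv.clm_apply ((contDiff_dPhi i α).of_le le_top |>.comp contDiff_fst)

theorem StoredEnergy.fderiv_stress (i α : Fin 3) (F : Mat3) (H : Ext) :
    fderiv ℝ (stress G i α) (Phi F) H
      = fderiv ℝ (fderiv ℝ G) (Phi F) H (dPhi i α F)
        + fderiv ℝ G (Phi F) (dPhiLin i α (fderiv ℝ Phi F H.1)) := by
  have h1 := (hG.contDiff_fderiv.differentiable (by norm_num) (Phi F)).hasFDerivAt
  have h2 : HasFDerivAt (fun X : Ext => dPhi i α X.1)
      (((dPhiLin i α).comp (fderiv ℝ Phi F)).comp (ContinuousLinearMap.fst ℝ Mat3 (Mat3 × ℝ)))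
      (Phi F) :=
    HasFDerivAt.comp (f := Prod.fst) (Phi F) (hasFDerivAt_dPhi i α F) hasFDerivAt_fst
  have h3 := h1.clm_apply h2
  have : stress G i α = fun X => fderiv ℝ G X (dPhi i α X.1) := rfl
  rw [this, h3.fderiv]
  simp [Phi, add_comm]

theorem StoredEnergy.fderiv_symm (X Y Z : Ext) :
    fderiv ℝ (fderiv ℝ G) X Y Z = fderiv ℝ (fderiv ℝ G) X Z Y :=
  (hG.smooth.contDiffAt.isSymmSndFDerivAt (by simp; norm_num)).eq Y Z

theorem StoredEnergy.fderiv_split (X : Ext) (A B : Mat3) (c : ℝ) :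
    fderiv ℝ G X (A, B, c)
      = fderiv ℝ (fun F => G (F, X.2.1, X.2.2)) X.1 A
        + fderiv ℝ (fun Z => G (X.1, Z, X.2.2)) X.2.1 B
        + deriv (fun w => G (X.1, X.2.1, w)) X.2.2 * c := by
  have hd : HasFDerivAt G (fderiv ℝ G X) (X.1, X.2.1, X.2.2) := (hG.differentiable X).hasFDerivAt
  have h1 : HasFDerivAt (fun F => G (F, X.2.1, X.2.2)) _ X.1 :=
    HasFDerivAt.comp (f := fun F => (F, X.2.1, X.2.2)) X.1 hd
      ((hasFDerivAt_id X.1).prodMk (hasFDerivAt_const X.2 X.1))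
  have h2 : HasFDerivAt (fun Z => G (X.1, Z, X.2.2)) _ X.2.1 :=
    HasFDerivAt.comp (f := fun Z => (X.1, Z, X.2.2)) X.2.1 hd
      ((hasFDerivAt_const X.1 X.2.1).prodMk
      ((hasFDerivAt_id X.2.1).prodMk (hasFDerivAt_const X.2.2 X.2.1)))
  have h3 : HasDerivAt (fun w => G (X.1, X.2.1, w)) _ X.2.2 :=
    HasFDerivAt.comp_hasDerivAt (f := fun w => (X.1, X.2.1, w)) X.2.2 hd
      ((hasDerivAt_const X.2.2 X.1).prodMk
      ((hasDerivAt_const X.2.2 X.2.1).prodMk (hasDerivAt_id X.2.2)))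
  rw [h1.fderiv, h2.fderiv, h3.deriv]
  have e : (A, B, c)
      = (A, (0 : Mat3), (0 : ℝ)) + (0, B, 0) + c • ((0 : Mat3), (0 : Mat3), (1 : ℝ)) := by
    simp
  rw [e, map_add, map_add, map_smul]
  simp
  rw [mul_comm]
  rfl

/-- The derivative bounds hold, with a constant, also on compact sets. -/
theorem StoredEnergy.derivative_le : ∃ C, 0 ≤ C ∧ ∀ X : Ext,
    ‖fderiv ℝ (fun F => G (F, X.2.1, X.2.2)) X.1‖
        + ‖fderiv ℝ (fun Z => G (X.1, Z, X.2.2)) X.2.1‖ ^ (p / (p - 1))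
        + |deriv (fun w => G (X.1, X.2.1, w)) X.2.2| ^ (p / (p - 2)) ≤ C * growth p q r X := by
  have hp := hG.exponent_p
  have h := hG.derivative_growth.bound one_pos
  obtain ⟨K, hK, hKs⟩ := Filter.mem_cocompact.mp h
  obtain ⟨R, hR⟩ := hK.exists_bound_of_continuousOn hG.contDiff_fderiv.continuous.continuousOn
  have e1 : 0 ≤ p / (p - 1) := div_nonneg (by linarith) (by linarith)
  have e2 : 0 ≤ p / (p - 2) := div_nonneg (by linarith) (by linarith)
  refine ⟨1 + (|R| + |R| ^ (p / (p - 1)) + |R| ^ (p / (p - 2))), by positivity, fun X => ?_⟩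
  have hg := one_le_growth p q r X
  by_cases hX : X ∈ K
  · have hR' := (hR X hX).trans (le_abs_self R)
    have h1 : ‖fderiv ℝ (fun F => G (F, X.2.1, X.2.2)) X.1‖ ≤ |R| := by
      refine ContinuousLinearMap.opNorm_le_bound _ (abs_nonneg R) fun A => ?_
      have := hG.fderiv_split X A 0 0
      simp only [map_zero, mul_zero, add_zero] at this
      rw [← this]
      refine ((fderiv ℝ G X).le_opNorm _).trans ?_
      refine mul_le_mul hR' (by simp [Prod.norm_def]) (norm_nonneg _) (abs_nonneg _)
    have h2 : ‖fderiv ℝ (fun Z => G (X.1, Z, X.2.2)) X.2.1‖ ≤ |R| := by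
      refine ContinuousLinearMap.opNorm_le_bound _ (abs_nonneg R) fun A => ?_
      have := hG.fderiv_split X 0 A 0
      simp only [map_zero, mul_zero, add_zero, zero_add] at this
      rw [← this]
      refine ((fderiv ℝ G X).le_opNorm _).trans ?_
      refine mul_le_mul hR' (by simp [Prod.norm_def]) (norm_nonneg _) (abs_nonneg _)
    have h3 : |deriv (fun w => G (X.1, X.2.1, w)) X.2.2| ≤ |R| := by
      have := hG.fderiv_split X 0 0 1
      simp only [map_zero, mul_one, add_zero, zero_add] at this
      rw [← this]
      refine ((fderiv ℝ G X).le_opNorm _).trans ?_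
      refine (mul_le_mul hR' (?_ : _ ≤ (1 : ℝ)) (norm_nonneg _) (abs_nonneg _)).trans (by simp)
      simp [Prod.norm_def]
    have h4 := Real.rpow_le_rpow (norm_nonneg _) h2 e1
    have h5 := Real.rpow_le_rpow (abs_nonneg _) h3 e2
    have h6 : 0 ≤ |R| + |R| ^ (p / (p - 1)) + |R| ^ (p / (p - 2)) := by positivity
    nlinarith
  · have h1 := hKs hX
    simp only [mem_ofPred_eq, one_mul] at h1
    rw [Real.norm_of_nonneg (by positivity), Real.norm_of_nonneg (by linarith)] at h1
    have h6 : 0 ≤ |R| + |R| ^ (p / (p - 1)) + |R| ^ (p / (p - 2)) := by positivity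
    nlinarith

/-- By Young's inequality the derivative bounds make the extended stress energy-integrable. -/
theorem StoredEnergy.stress_le (i α : Fin 3) :
    ∃ C, 0 ≤ C ∧ ∀ X, |stress G i α X| ≤ C * growth p q r X := by
  have hp := hG.exponent_p
  obtain ⟨C, hC, h⟩ := hG.derivative_le
  set N := ‖LinearMap.toContinuousLinearMap (cofPolar (elem i α))‖
  refine ⟨C + (1 + C) * N + 2 * (1 + C), by positivity, fun X => ?_⟩
  set a := ‖fderiv ℝ (fun F => G (F, X.2.1, X.2.2)) X.1‖ with ha
  set b := ‖fderiv ℝ (fun Z => G (X.1, Z, X.2.2)) X.2.1‖ with hb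
  set d := |deriv (fun w => G (X.1, X.2.1, w)) X.2.2| with hd
  have ha0 : 0 ≤ a := norm_nonneg _
  have hb0 : 0 ≤ b := norm_nonneg _
  have hd0 : 0 ≤ d := abs_nonneg _
  have hX := h X
  have hgF : ‖X.1‖ ^ p ≤ growth p q r X := by
    have h2 : 0 ≤ ‖X.2.1‖ ^ q := by positivity
    have h3 : 0 ≤ |X.2.2| ^ r := by positivity
    unfold growth
    linarith
  have hb1 : 0 ≤ b ^ (p / (p - 1)) := by positivity
  have hd1 : 0 ≤ d ^ (p / (p - 2)) := by positivity
  have young : ∀ {x y s t : ℝ}, 0 ≤ x → 0 ≤ y → s.HolderConjugate t →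
      x * y ≤ x ^ s + y ^ t := by
    intro x y s t hx hy hst
    refine (Real.young_inequality_of_nonneg hx hy hst).trans ?_
    exact add_le_add (div_le_self (by positivity) hst.lt.le)
      (div_le_self (by positivity) hst.symm.lt.le)
  -- In the stress, `∂_Z G` is multiplied by a linear and `∂_w G` by a quadratic function of `F`;
  -- their exponents `p / (p - 1)` and `p / (p - 2)` are conjugate to `p` and `p / 2`.
  have y1 : b * ‖X.1‖ ≤ (1 + C) * growth p q r X := by
    have := young hb0 (norm_nonneg X.1) (s := p / (p - 1)) (t := p)
      ((Real.holderConjugate_iff).2 ⟨by rw [lt_div_iff₀] <;> linarith, by field_simp; ring⟩)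
    linarith
  have y2 : d * ‖X.1‖ ^ 2 ≤ (1 + C) * growth p q r X := by
    have := young hd0 (sq_nonneg ‖X.1‖) (s := p / (p - 2)) (t := p / 2)
      ((Real.holderConjugate_iff).2 ⟨by rw [lt_div_iff₀] <;> linarith, by field_simp; ring⟩)
    rw [← Real.rpow_natCast ‖X.1‖ 2, ← Real.rpow_mul (norm_nonneg _)] at this
    have e : ((2 : ℕ) : ℝ) * (p / 2) = p := by push_cast; ring
    rw [e, Real.rpow_natCast] at this
    linarith
  have s1 : |fderiv ℝ (fun F => G (F, X.2.1, X.2.2)) X.1 (elem i α)| ≤ a := by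
    have := (fderiv ℝ (fun F => G (F, X.2.1, X.2.2)) X.1).le_opNorm (elem i α)
    rwa [norm_elem, mul_one] at this
  have s2 : |fderiv ℝ (fun Z => G (X.1, Z, X.2.2)) X.2.1 (cofPolar (elem i α) X.1)|
      ≤ N * (b * ‖X.1‖) := by
    refine ((fderiv ℝ (fun Z => G (X.1, Z, X.2.2)) X.2.1).le_opNorm _).trans ?_
    have := (LinearMap.toContinuousLinearMap (cofPolar (elem i α))).le_opNorm X.1
    calc b * ‖cofPolar (elem i α) X.1‖ ≤ b * (N * ‖X.1‖) := by gcongr; exact this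
      _ = _ := by ring
  have s3 : |deriv (fun w => G (X.1, X.2.1, w)) X.2.2 * cof X.1 (i, α)|
      ≤ 2 * (d * ‖X.1‖ ^ 2) := by
    rw [abs_mul]
    calc d * |cof X.1 (i, α)| ≤ d * (2 * ‖X.1‖ ^ 2) := by gcongr; exact abs_cof_apply_le _ _
      _ = _ := by ring
  have hN : 0 ≤ N := norm_nonneg _
  have s4 := mul_le_mul_of_nonneg_left y1 hN
  unfold stress
  rw [dPhi_apply, hG.fderiv_split]
  refine (abs_add_three _ _ _).trans ?_
  linarith

/-! ### Energy bounds on the state space -/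

theorem StoredEnergy.energy_nonneg (s : State) : 0 ≤ energy G s :=
  add_nonneg (by positivity) (hG.nonneg _)

theorem StoredEnergy.continuous_energy : Continuous (energy G) := by
  have := hG.smooth.continuous
  unfold energy
  fun_prop

theorem StoredEnergy.growth_le_energy :
    ∃ C, 0 ≤ C ∧ ∀ s : State, growth p q r s.2 ≤ C * (energy G s + 1) := by
  obtain ⟨C, hC, h⟩ := hG.growth_le
  refine ⟨C, hC, fun s => (h s.2).trans ?_⟩
  have : 0 ≤ ‖s.1‖ ^ 2 / 2 := by positivity
  unfold energy
  gcongr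
  linarith

theorem StoredEnergy.norm_sq_le_energy :
    ∃ C, 0 ≤ C ∧ ∀ s : State, ‖s‖ ^ 2 ≤ C * (energy G s + 1) := by
  obtain ⟨C, hC, h⟩ := hG.growth_le_energy
  refine ⟨2 + 3 * C, by positivity, fun s => ?_⟩
  have h1 := hG.norm_sq_le_growth s.2
  have h2 := h s
  have h3 : ‖s.1‖ ^ 2 ≤ 2 * (energy G s + 1) := by
    have := hG.nonneg s.2
    unfold energy
    linarith
  have h4 := hG.energy_nonneg s
  rw [Prod.norm_def]
  rcases max_choice ‖s.1‖ ‖s.2‖ with h | h <;> rw [h] <;> nlinarith [mul_nonneg hC h4]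

theorem StoredEnergy.tendsto_energy : Tendsto (energy G) (cocompact State) atTop := by
  obtain ⟨C, hC, h⟩ := hG.norm_sq_le_energy
  have h1 : Tendsto (fun s : State => ‖s‖ ^ 2) (cocompact State) atTop :=
    (tendsto_pow_atTop two_ne_zero).comp (tendsto_norm_cocompact_atTop)
  have h2 : Tendsto (fun s => C * (energy G s + 1)) (cocompact State) atTop :=
    tendsto_atTop_mono h h1
  have hC' : 0 < C := by
    rcases hC.lt_or_eq with h0 | h0
    · exact h0
    · have := h ((EuclideanSpace.single 0 1), 0)
      rw [← h0] at this
      simp [Prod.norm_def] at this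
      norm_num at this
  have h3 := (tendsto_const_mul_atTop_of_pos hC').mp h2
  simpa using tendsto_atTop_add_const_right _ (-1) h3

theorem StoredEnergy.relEnergy_quadratic :
    ∃ κ, 0 < κ ∧ ∀ u s, κ * ‖s - u‖ ^ 2 ≤ relEnergy G u s := by
  obtain ⟨κ, hκ, h⟩ := hG.relG_quadratic
  refine ⟨min κ (1 / 2), by positivity, fun u s => ?_⟩
  have h1 := h u.2 s.2
  have h2 := hG.relG_nonneg u.2 s.2
  have h3 : 0 ≤ ‖s.1 - u.1‖ ^ 2 / 2 := by positivity
  have h4 : min κ (1 / 2) ≤ κ := min_le_left _ _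
  have h5 : min κ (1 / 2) ≤ 1 / 2 := min_le_right _ _
  rw [relEnergy_eq, Prod.norm_def, Prod.fst_sub, Prod.snd_sub]
  rcases max_choice ‖s.1 - u.1‖ ‖s.2 - u.2‖ with h | h <;> rw [h]
  · nlinarith [sq_nonneg ‖s.1 - u.1‖]
  · nlinarith [sq_nonneg ‖s.2 - u.2‖]

end

/-! ### Directional derivatives on space-time -/

/-- The universal cover `ℝ × ℝ³` of space-time. -/
abbrev Cover : Type := ℝ × (Fin 3 → ℝ)

/-- The covering map from `ℝ × ℝ³` to `ℝ × Q`. -/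
def proj (w : Cover) : ℝ × Torus := (w.1, fun j => (w.2 j : AddCircle (2 * Real.pi)))

theorem proj_add (w w' : Cover) : proj (w + w') = proj w + proj w' := by
  ext <;> simp [proj]

theorem proj_sub (w w' : Cover) : proj (w - w') = proj w - proj w' := by
  ext <;> simp [proj]

theorem proj_zero : proj 0 = 0 := by
  ext <;> simp [proj]

theorem continuous_proj : Continuous proj := by
  unfold proj
  refine continuous_fst.prodMk (continuous_pi fun j => ?_)
  exact (AddCircle.continuous_mk' _).comp ((continuous_apply j).comp continuous_snd)

theorem norm_proj_le (w : Cover) : ‖proj w‖ ≤ ‖w‖ := by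
  simp only [proj, Prod.norm_def]
  refine max_le_max le_rfl ?_
  refine (pi_norm_le_iff_of_nonneg (norm_nonneg _)).2 fun j => ?_
  refine le_trans ?_ (norm_le_pi_norm w.2 j)
  exact QuotientAddGroup.norm_mk_le_norm (S := AddSubgroup.zmultiples (2 * Real.pi)) (m := w.2 j)

theorem lipschitzWith_proj : LipschitzWith 1 proj :=
  LipschitzWith.of_dist_le_mul fun x y => by
    rw [NNReal.coe_one, one_mul, dist_eq_norm, dist_eq_norm, ← proj_sub]
    exact norm_proj_le _

/-- Every point of space-time has a lift of the same norm. -/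
theorem exists_proj_eq (z : ℝ × Torus) : ∃ w, proj w = z ∧ ‖w‖ ≤ ‖z‖ := by
  have h : ∀ x : AddCircle (2 * Real.pi),
      ∃ s : ℝ, (s : AddCircle (2 * Real.pi)) = x ∧ ‖s‖ ≤ ‖x‖ := by
    intro x
    induction x using QuotientAddGroup.induction_on with
    | H s =>
      refine ⟨s - round ((2 * Real.pi)⁻¹ * s) * (2 * Real.pi), ?_, ?_⟩
      · rw [AddCircle.coe_sub, sub_eq_self, ← zsmul_eq_mul, AddCircle.coe_zsmul,
          AddCircle.coe_period, smul_zero]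
      · exact (AddCircle.norm_eq (p := 2 * Real.pi) (x := s)).ge
  choose g hg hg' using h
  refine ⟨(z.1, fun j => g (z.2 j)), Prod.ext rfl (funext fun j => hg _), ?_⟩
  simp only [Prod.norm_def]
  refine max_le_max le_rfl ?_
  refine (pi_norm_le_iff_of_nonneg (norm_nonneg _)).2 fun j => ?_
  exact (hg' _).trans (norm_le_pi_norm z.2 j)

/-- Almost everywhere statements descend from the cover to space-time. -/
theorem ae_of_ae_proj {P : ℝ × Torus → Prop} (h : ∀ᵐ w : Cover, P (proj w)) :
    ∀ᵐ z : ℝ × Torus, P z := by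
  -- The fundamental domain `(0, 2π]³` identifies the measure of the torus with Lebesgue measure.
  let g : AddCircle (2 * Real.pi) → ℝ := fun x => (AddCircle.equivIoc (2 * Real.pi) 0 x : ℝ)
  have h1 : MeasurePreserving g volume (volume.restrict (Ioc 0 (0 + 2 * Real.pi))) :=
    (measurePreserving_subtype_coe measurableSet_Ioc).comp (AddCircle.measurePreserving_equivIoc _)
  have h2 := measurePreserving_pi (fun _ : Fin 3 => (volume : Measure (AddCircle (2 * Real.pi))))
    (fun _ : Fin 3 => (volume : Measure ℝ).restrict (Ioc 0 (0 + 2 * Real.pi))) (fun _ => h1)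
  have h3 := (MeasurePreserving.id (volume : Measure ℝ)).prod h2
  have h4 : (volume : Measure ℝ).prod (Measure.pi fun _ : Fin 3 =>
      (volume : Measure ℝ).restrict (Ioc 0 (0 + 2 * Real.pi))) ≪ (volume : Measure Cover) := by
    refine Measure.AbsolutelyContinuous.prod .rfl ?_
    rw [← Measure.restrict_pi_pi]
    exact Measure.absolutelyContinuous_of_le Measure.restrict_le_self
  have h5 := (h3.quasiMeasurePreserving.mono_right h4).ae h
  refine h5.mono fun z hz => ?_
  convert hz using 1
  refine Prod.ext rfl (funext fun j => ?_)
  exact ((AddCircle.equivIoc (2 * Real.pi) 0).symm_apply_apply (z.2 j)).symm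

variable {E E' : Type*} [NormedAddCommGroup E] [NormedSpace ℝ E] [NormedAddCommGroup E']
  [NormedSpace ℝ E']

/-- `f` has the derivative `f'` at `z` in the direction `e`. -/
def HasDirDeriv (e : Cover) (f : ℝ × Torus → E) (f' : E) (z : ℝ × Torus) : Prop :=
  HasDerivAt (fun s : ℝ => f (z + proj (s • e))) f' 0

/-- The derivative of a function on space-time in the direction `e`. -/
def dirDeriv (e : Cover) (f : ℝ × Torus → E) (z : ℝ × Torus) : E :=
  deriv (fun s : ℝ => f (z + proj (s • e))) 0

/-- The direction of time. -/
def timeDir : Cover := (1, 0)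

/-- The direction of the spatial coordinate `x_α`. -/
def spaceDir (α : Fin 3) : Cover := (0, Pi.single α 1)

theorem proj_smul_timeDir (s : ℝ) : proj (s • timeDir) = (s, 0) := by
  refine Prod.ext ?_ (funext fun j => ?_) <;> simp [proj, timeDir]

theorem proj_smul_spaceDir (s : ℝ) (α : Fin 3) :
    proj (s • spaceDir α) = (0, Pi.single α (s : AddCircle (2 * Real.pi))) := by
  refine Prod.ext ?_ (funext fun j => ?_)
  · simp [proj, spaceDir]
  · by_cases h : j = α
    · subst h
      simp [proj, spaceDir]
    · simp [proj, spaceDir, h]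

theorem dt_eq_dirDeriv (f : ℝ × Torus → E) : dt f = dirDeriv timeDir f := by
  funext z
  have h := deriv_comp_const_add (fun s : ℝ => f (s, z.2)) z.1 0
  rw [add_zero] at h
  simp only [dirDeriv, dt, proj_smul_timeDir, ← h]
  congr 1
  funext s
  congr 1
  exact Prod.ext rfl (add_zero _).symm

theorem dx_eq_dirDeriv (α : Fin 3) (f : ℝ × Torus → E) : dx α f = dirDeriv (spaceDir α) f := by
  funext z
  simp only [dirDeriv, dx, proj_smul_spaceDir]
  congr 1
  funext s
  congr 1
  exact Prod.ext (add_zero _).symm rfl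

section

variable {e : Cover} {f : ℝ × Torus → E} {f' : E} {z : ℝ × Torus}

theorem HasDirDeriv.dirDeriv_eq (h : HasDirDeriv e f f' z) : dirDeriv e f z = f' :=
  HasDerivAt.deriv h

theorem HasDirDeriv.clm_comp (L : E →L[ℝ] E') (h : HasDirDeriv e f f' z) :
    HasDirDeriv e (fun z => L (f z)) (L f') z :=
  L.hasFDerivAt.comp_hasDerivAt (f := fun s : ℝ => f (z + proj (s • e))) 0 h

theorem HasDirDeriv.comp {g : E → E'} {g' : E →L[ℝ] E'} (hg : HasFDerivAt g g' (f z))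
    (h : HasDirDeriv e f f' z) : HasDirDeriv e (fun z => g (f z)) (g' f') z := by
  have h0 : f (z + proj ((0 : ℝ) • e)) = f z := by rw [zero_smul, proj_zero, add_zero]
  rw [← h0] at hg
  exact hg.comp_hasDerivAt (f := fun s : ℝ => f (z + proj (s • e))) 0 h

theorem HasDirDeriv.smul {c : ℝ × Torus → ℝ} {c' : ℝ} (hc : HasDirDeriv e c c' z)
    (hf : HasDirDeriv e f f' z) :
    HasDirDeriv e (fun z => c z • f z) (c z • f' + c' • f z) z := by
  have := HasDerivAt.smul hc hf
  simp only [zero_smul, proj_zero, add_zero] at this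
  exact this

theorem HasDirDeriv.mul {b c : ℝ × Torus → ℝ} {b' c' : ℝ} (hb : HasDirDeriv e b b' z)
    (hc : HasDirDeriv e c c' z) :
    HasDirDeriv e (fun z => b z * c z) (b z * c' + b' * c z) z := by
  simpa using HasDirDeriv.smul hb hc

end

theorem norm_dirDeriv_le {K : ℝ≥0} {f : ℝ × Torus → E} (hf : LipschitzWith K f) (e : Cover)
    (z : ℝ × Torus) : ‖dirDeriv e f z‖ ≤ K * ‖e‖ := by
  have hl : LipschitzWith (K * ‖e‖₊) (fun s : ℝ => f (z + proj (s • e))) := by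
    refine LipschitzWith.of_dist_le_mul fun s t => (hf.dist_le_mul _ _).trans ?_
    rw [NNReal.coe_mul, coe_nnnorm, mul_assoc]
    refine mul_le_mul_of_nonneg_left ?_ K.2
    rw [dist_add_left, dist_eq_norm, ← proj_sub, ← sub_smul]
    refine (norm_proj_le _).trans_eq ?_
    rw [norm_smul, mul_comm, Real.dist_eq, Real.norm_eq_abs]
  exact norm_deriv_le_of_lipschitz hl

theorem measurable_dirDeriv [MeasurableSpace E] [BorelSpace E] [CompleteSpace E]
    {f : ℝ × Torus → E}
    (hf : Continuous f) (e : Cover) : Measurable (dirDeriv e f) := by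
  have h : Continuous (Function.uncurry fun (z : ℝ × Torus) (s : ℝ) => f (z + proj (s • e))) := by
    have := continuous_proj
    unfold Function.uncurry
    fun_prop
  exact (measurable_deriv_with_param h).comp (measurable_id.prodMk measurable_const)

instance : (volume : Measure Cover).IsAddHaarMeasure :=
  Measure.prod.instIsAddHaarMeasure _ _

/-- Rademacher's theorem on the cover. -/
theorem ae_cover_hasDirDeriv [FiniteDimensional ℝ E] {K : ℝ≥0} {f : ℝ × Torus → E}
    (hf : LipschitzWith K f) (e : Cover) :
    ∀ᵐ w : Cover, HasDirDeriv e f (dirDeriv e f (proj w)) (proj w) := by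
  have h1 : LipschitzWith (K * 1) (f ∘ proj) := hf.comp lipschitzWith_proj
  filter_upwards [h1.ae_differentiableAt] with w hw
  have h2 := hw.hasFDerivAt.hasLineDerivAt e
  have h3 : HasDirDeriv e f (fderiv ℝ (f ∘ proj) w e) (proj w) := by
    refine HasDerivAt.congr_of_eventuallyEq h2 (Eventually.of_forall fun s => ?_)
    simp [proj_add]
  rwa [h3.dirDeriv_eq]

theorem ae_hasDirDeriv [FiniteDimensional ℝ E] {K : ℝ≥0} {f : ℝ × Torus → E}
    (hf : LipschitzWith K f) (e : Cover) : ∀ᵐ z, HasDirDeriv e f (dirDeriv e f z) z :=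
  ae_of_ae_proj (ae_cover_hasDirDeriv hf e)

/-! ### Integration by parts -/

instance (T : ℝ) : IsFiniteMeasure (muT T) := by
  refine ⟨?_⟩
  rw [muT, Measure.restrict_apply_univ, QT, Measure.volume_eq_prod, Measure.prod_prod]
  exact ENNReal.mul_lt_top (by simp) (measure_lt_top _ _)

theorem muT_eq_prod (T : ℝ) :
    muT T = ((volume : Measure ℝ).restrict (Ico 0 T)).prod (volume : Measure Torus) := by
  rw [muT, QT, Measure.volume_eq_prod, ← Measure.prod_restrict, Measure.restrict_univ]

theorem ae_muT {T : ℝ} {P : ℝ × Torus → Prop} (h : ∀ᵐ z : ℝ × Torus, P z) :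
    ∀ᵐ z ∂(muT T), P z := ae_restrict_of_ae h

/-- The initial time is negligible. -/
theorem ae_muT_mem_Ioo (T : ℝ) : ∀ᵐ z ∂(muT T), z.1 ∈ Ioo 0 T := by
  rw [muT_eq_prod]
  have : ∀ᵐ t ∂((volume : Measure ℝ).restrict (Ico 0 T)), t ∈ Ioo 0 T := by
    rw [restrict_Ico_eq_restrict_Ioc, ← restrict_Ioo_eq_restrict_Ioc]
    exact ae_restrict_mem measurableSet_Ioo
  exact Measure.quasiMeasurePreserving_fst.ae this

omit [NormedSpace ℝ E] in
theorem integrable_of_bounded {T C : ℝ} {f : ℝ × Torus → E} (hf : AEStronglyMeasurable f (muT T))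
    (hC : ∀ z, ‖f z‖ ≤ C) : Integrable f (muT T) :=
  Integrable.of_bound hf C (Eventually.of_forall hC)

section

variable [FiniteDimensional ℝ E]

theorem integrable_dirDeriv {K : ℝ≥0} {f : ℝ × Torus → E} (hf : LipschitzWith K f) (e : Cover)
    (T : ℝ) : Integrable (dirDeriv e f) (muT T) := by
  borelize E
  have := FiniteDimensional.complete ℝ E
  exact integrable_of_bounded (measurable_dirDeriv hf.continuous e).aestronglyMeasurable
    (norm_dirDeriv_le hf e)

theorem integral_dirDeriv_space {K : ℝ≥0} {f : ℝ × Torus → E} (hf : LipschitzWith K f)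
    {C : ℝ} (hC : ∀ z, ‖f z‖ ≤ C) (α : Fin 3) (T : ℝ) :
    ∫ z, dirDeriv (spaceDir α) f z ∂(muT T) = 0 := by
  have := FiniteDimensional.complete ℝ E
  set s : ℕ → ℝ := fun n => 1 / ((n : ℝ) + 1)
  have hs : ∀ n, 0 < s n := fun n => Nat.one_div_pos_of_nat
  have hs0 : Tendsto s atTop (𝓝 0) := tendsto_one_div_add_atTop_nhds_zero_nat
  have hint : ∀ a, Integrable (fun z => f (z + a)) (muT T) := fun a =>
    integrable_of_bounded (hf.continuous.comp (continuous_id.add continuous_const)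
      ).aestronglyMeasurable fun z => hC _
  have hinv : ∀ y : Torus, ∫ z, f (z + (0, y)) ∂(muT T) = ∫ z, f z ∂(muT T) := by
    intro y
    have h1 : MeasurePreserving (fun z : ℝ × Torus => z + (0, y)) (muT T) (muT T) := by
      rw [muT_eq_prod]
      have := (MeasurePreserving.id ((volume : Measure ℝ).restrict (Ico 0 T))).prod
        (measurePreserving_add_right (volume : Measure Torus) y)
      convert this using 1
      funext z
      exact Prod.ext (add_zero _) rfl
    exact h1.integral_comp (Homeomorph.addRight ((0, y) : ℝ × Torus)).measurableEmbedding f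
  -- The integrals of the difference quotients vanish by translation invariance.
  have hlim : Tendsto (fun n => ∫ z, (s n)⁻¹ • (f (z + proj (s n • spaceDir α)) - f z) ∂(muT T))
      atTop (𝓝 (∫ z, dirDeriv (spaceDir α) f z ∂(muT T))) := by
    refine tendsto_integral_of_dominated_convergence (fun _ => K * ‖spaceDir α‖) ?_
      (integrable_const _) ?_ ?_
    · intro n
      exact (((hint _).sub (by simpa using hint 0)).smul _).aestronglyMeasurable
    · intro n
      refine Eventually.of_forall fun z => ?_
      rw [norm_smul, norm_inv, Real.norm_of_nonneg (hs n).le, inv_mul_le_iff₀ (hs n)]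
      refine (hf.norm_sub_le _ _).trans ?_
      rw [add_sub_cancel_left, mul_left_comm]
      refine mul_le_mul_of_nonneg_left ((norm_proj_le _).trans_eq ?_) K.2
      rw [norm_smul, Real.norm_of_nonneg (hs n).le]
    · filter_upwards [ae_muT (ae_hasDirDeriv hf (spaceDir α))] with z hz
      have h2 := (hasDerivAt_iff_tendsto_slope_zero.mp hz).comp
        (tendsto_nhdsWithin_iff.2 ⟨hs0, Eventually.of_forall fun n => (hs n).ne'⟩)
      simpa [Function.comp_def, proj_zero] using h2
  refine tendsto_nhds_unique hlim (tendsto_const_nhds.congr fun n => ?_)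
  rw [integral_smul, integral_sub (hint _) (by simpa using hint 0), proj_smul_spaceDir, hinv,
    sub_self, smul_zero]

theorem integral_dirDeriv_time_real {K : ℝ≥0} {f : ℝ × Torus → ℝ} (hf : LipschitzWith K f)
    {T b : ℝ} (hT : 0 < T) (hb : b < T) (h0 : ∀ t x, b ≤ t → f (t, x) = 0) :
    ∫ z, dirDeriv timeDir f z ∂(muT T) = -∫ x, f (0, x) := by
  have hi := integrable_dirDeriv hf timeDir T
  rw [muT_eq_prod] at hi ⊢
  rw [integral_prod_symm _ hi, ← integral_neg]
  refine integral_congr_ae (Eventually.of_forall fun x => ?_)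
  have hl : LipschitzWith (K * 1) (fun t : ℝ => f (t, x)) :=
    hf.comp (LipschitzWith.prodMk_right x)
  have h1 :=
    (hl.lipschitzOnWith (s := uIcc 0 T)).absolutelyContinuousOnInterval.integral_deriv_eq_sub
  rw [h0 T x hb.le, zero_sub, intervalIntegral.integral_of_le hT.le,
    ← integral_Ico_eq_integral_Ioc] at h1
  simp only [← h1, ← dt_eq_dirDeriv, dt]

theorem integral_dirDeriv_time {K : ℝ≥0} {f : ℝ × Torus → E} (hf : LipschitzWith K f)
    {C : ℝ} (hC : ∀ z, ‖f z‖ ≤ C)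
    {T b : ℝ} (hT : 0 < T) (hb : b < T) (h0 : ∀ t x, b ≤ t → f (t, x) = 0) :
    ∫ z, dirDeriv timeDir f z ∂(muT T) = -∫ x, f (0, x) := by
  have := FiniteDimensional.complete ℝ E
  refine (SeparatingDual.eq_iff_forall_dual_eq (R := ℝ)).2 fun L => ?_
  have hL : LipschitzWith (‖L‖₊ * K) (fun z => L (f z)) := L.lipschitz.comp hf
  have h1 := integral_dirDeriv_time_real hL hT hb fun t x ht => by rw [h0 t x ht, map_zero]
  have hx : Integrable (fun x : Torus => f (0, x)) := Integrable.of_bound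
    (hf.continuous.comp (Continuous.prodMk_right 0)).aestronglyMeasurable C
    (Eventually.of_forall fun x => hC _)
  rw [← ContinuousLinearMap.integral_comp_comm L (integrable_dirDeriv hf timeDir T), map_neg,
    ← ContinuousLinearMap.integral_comp_comm L hx, ← h1]
  refine integral_congr_ae ?_
  filter_upwards [ae_muT (ae_hasDirDeriv hf timeDir)] with z hz
  exact (hz.clm_comp L).dirDeriv_eq.symm

end

/-! ### Mollification on space-time -/

/-- The mollification of a function on space-time by a bump function on the cover. -/
def moll (φ : ContDiffBump (0 : Cover)) (f : ℝ × Torus → ℝ) (z : ℝ × Torus) : ℝ :=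
  ∫ w : Cover, φ.normed volume w * f (z - proj w)

/-- A sequence of bump functions on the cover, with supports in the `ε`-ball shrinking to `0`. -/
def bumpSeq {ε : ℝ} (hε : 0 < ε) (n : ℕ) : ContDiffBump (0 : Cover) where
  rIn := ε / (2 * (n + 1))
  rOut := ε / (n + 1)
  rIn_pos := by positivity
  rIn_lt_rOut := div_lt_div_of_pos_left hε (by positivity) (by linarith [n.cast_nonneg (α := ℝ)])

theorem bumpSeq_rOut_le {ε : ℝ} (hε : 0 < ε) (n : ℕ) : (bumpSeq hε n).rOut ≤ ε :=
  div_le_self hε.le (by linarith [n.cast_nonneg (α := ℝ)])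

theorem tendsto_bumpSeq_rOut {ε : ℝ} (hε : 0 < ε) :
    Tendsto (fun n => (bumpSeq hε n).rOut) atTop (𝓝 0) := by
  have := (tendsto_one_div_add_atTop_nhds_zero_nat (𝕜 := ℝ)).const_mul ε
  rw [mul_zero] at this
  refine this.congr fun n => ?_
  simp [bumpSeq, div_eq_mul_inv]

section

variable {f : ℝ × Torus → ℝ} {C : ℝ} (φ : ContDiffBump (0 : Cover))

theorem moll_proj (f : ℝ × Torus → ℝ) (w : Cover) : moll φ f (proj w)
    = convolution (φ.normed volume) (f ∘ proj) (ContinuousLinearMap.lsmul ℝ ℝ) volume w := by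
  simp [moll, convolution, proj_sub]

theorem locallyIntegrable_lift (hf : Measurable f) (hC : ∀ z, ‖f z‖ ≤ C) :
    LocallyIntegrable (f ∘ proj) (volume : Measure Cover) :=
  (locallyIntegrable_const C).mono (hf.comp continuous_proj.measurable).aestronglyMeasurable
    (Eventually.of_forall fun _ => (hC _).trans (le_abs_self C))

theorem contDiff_moll (hf : Measurable f) (hC : ∀ z, ‖f z‖ ≤ C) (n : ℕ∞) :
    ContDiff ℝ n (moll φ f ∘ proj) := by
  have := φ.hasCompactSupport_normed.contDiff_convolution_left (n := n) (μ := volume)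
    (ContinuousLinearMap.lsmul ℝ ℝ) (φ.contDiff_normed (μ := volume)) (locallyIntegrable_lift hf hC)
  exact (funext fun w => moll_proj φ f w : moll φ f ∘ proj = _) ▸ this

theorem measurable_mul_shift (hf : Measurable f) (z : ℝ × Torus) :
    Measurable fun w : Cover => φ.normed volume w * f (z - proj w) :=
  φ.continuous_normed.measurable.mul (hf.comp (measurable_const.sub continuous_proj.measurable))

theorem integrable_mul_shift (hf : Measurable f) (hC : ∀ z, ‖f z‖ ≤ C) (z : ℝ × Torus) :
    Integrable (fun w : Cover => φ.normed volume w * f (z - proj w)) := by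
  refine (φ.integrable_normed.mul_const C).mono' (measurable_mul_shift φ hf z).aestronglyMeasurable
    (Eventually.of_forall fun w => ?_)
  rw [norm_mul, Real.norm_of_nonneg (φ.nonneg_normed w)]
  exact mul_le_mul_of_nonneg_left (hC _) (φ.nonneg_normed w)

theorem norm_moll_le (hC : ∀ z, ‖f z‖ ≤ C) (z : ℝ × Torus) : ‖moll φ f z‖ ≤ C := by
  have h : ‖moll φ f z‖ ≤ ∫ w : Cover, φ.normed volume w * C := by
    refine norm_integral_le_of_norm_le (φ.integrable_normed.mul_const C)
      (Eventually.of_forall fun w => ?_)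
    rw [norm_mul, Real.norm_of_nonneg (φ.nonneg_normed w)]
    exact mul_le_mul_of_nonneg_left (hC _) (φ.nonneg_normed w)
  rwa [integral_mul_const, φ.integral_normed, one_mul] at h

/-- The mollification of a bounded function is Lipschitz. -/
theorem exists_lipschitzWith_moll (hf : Measurable f) (hC : ∀ z, ‖f z‖ ≤ C) :
    ∃ K, LipschitzWith K (moll φ f) := by
  obtain ⟨L, hL⟩ := (φ.contDiff_normed (n := 1) (μ := volume)).lipschitzWith_of_hasCompactSupport
    φ.hasCompactSupport_normed (by norm_num)
  have hC0 : 0 ≤ C := (norm_nonneg _).trans (hC 0)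
  set B : Set Cover := Metric.closedBall 0 φ.rOut
  set m : ℝ := (volume : Measure Cover).real B
  have hBf : (volume : Measure Cover) B ≠ ⊤ := measure_closedBall_lt_top.ne
  have hBi : Integrable (B.indicator fun _ => (1 : ℝ)) (volume : Measure Cover) :=
    (integrable_indicator_iff measurableSet_closedBall).2 (integrableOn_const hBf)
  have hBint : ∫ w : Cover, B.indicator (fun _ => (1 : ℝ)) w = m := by
    rw [integral_indicator measurableSet_closedBall]
    simp [m, B]
  have hρ0 : ∀ w, w ∉ B → φ.normed volume w = 0 := fun w hw => by
    by_contra h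
    have : w ∈ Function.support (φ.normed volume) := h
    rw [φ.support_normed_eq] at this
    exact hw (Metric.ball_subset_closedBall this)
  refine ⟨Real.toNNReal (L * (m + m) * C), LipschitzWith.of_dist_le_mul fun z' z => ?_⟩
  rw [Real.coe_toNNReal _ (by positivity)]
  -- The shift from `z` to `z'` is moved onto the bump function.
  obtain ⟨h, hh, hn⟩ := exists_proj_eq (z' - z)
  have hz' : moll φ f z' = ∫ w : Cover, φ.normed volume (w + h) * f (z - proj w) := by
    rw [moll, ← integral_add_right_eq_self _ h]
    refine integral_congr_ae (Eventually.of_forall fun w => ?_)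
    simp only [proj_add, hh]
    congr 2
    abel
  have hi : Integrable (fun w : Cover => φ.normed volume (w + h) * f (z - proj w)) := by
    have := (integrable_mul_shift φ hf hC z').comp_add_right h
    refine this.congr (Eventually.of_forall fun w => ?_)
    simp only [proj_add, hh]
    congr 2
    abel
  have hbound : ∀ w : Cover,
      ‖φ.normed volume (w + h) * f (z - proj w) - φ.normed volume w * f (z - proj w)‖
        ≤ L * ‖h‖ * (B.indicator (fun _ => (1 : ℝ)) (w + h) + B.indicator (fun _ => (1 : ℝ)) w)
          * C := by
    intro w
    rw [← sub_mul, norm_mul]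
    refine mul_le_mul ?_ (hC _) (norm_nonneg _) ?_
    · by_cases h1 : w + h ∈ B ∨ w ∈ B
      · have h2 : (1 : ℝ) ≤ B.indicator (fun _ => (1 : ℝ)) (w + h)
            + B.indicator (fun _ => (1 : ℝ)) w := by
          have e1 : (0 : ℝ) ≤ B.indicator (fun _ => (1 : ℝ)) (w + h) :=
            indicator_nonneg (fun _ _ => zero_le_one) _
          have e2 : (0 : ℝ) ≤ B.indicator (fun _ => (1 : ℝ)) w :=
            indicator_nonneg (fun _ _ => zero_le_one) _
          rcases h1 with h1 | h1
          · rw [indicator_of_mem h1]; linarith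
          · rw [indicator_of_mem h1 (f := fun _ => (1 : ℝ))]; linarith
        have h3 : ‖φ.normed volume (w + h) - φ.normed volume w‖ ≤ L * ‖h‖ := by
          simpa using hL.norm_sub_le (w + h) w
        exact h3.trans (le_mul_of_one_le_right (by positivity) h2)
      · push Not at h1
        rw [hρ0 _ h1.1, hρ0 _ h1.2, sub_zero, norm_zero]
        exact mul_nonneg (by positivity) (add_nonneg (indicator_nonneg (fun _ _ => zero_le_one) _)
          (indicator_nonneg (fun _ _ => zero_le_one) _))
    · exact mul_nonneg (by positivity) (add_nonneg (indicator_nonneg (fun _ _ => zero_le_one) _)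
          (indicator_nonneg (fun _ _ => zero_le_one) _))
  rw [dist_eq_norm, dist_eq_norm, hz', moll, ← integral_sub hi (integrable_mul_shift φ hf hC z)]
  have hBi' := hBi.comp_add_right h
  refine (norm_integral_le_of_norm_le (((hBi'.add hBi).const_mul (L * ‖h‖)).mul_const C)
    (Eventually.of_forall hbound)).trans ?_
  simp only [Pi.add_apply]
  rw [integral_mul_const, integral_const_mul, integral_add hBi' hBi,
    integral_add_right_eq_self (B.indicator fun _ => (1 : ℝ)) h, hBint]
  have : L * ‖h‖ * (m + m) * C = L * (m + m) * C * ‖h‖ := by ring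
  rw [this]
  gcongr

theorem hasDirDeriv_moll {K : ℝ≥0} (hf : LipschitzWith K f) (hC : ∀ z, ‖f z‖ ≤ C) (e : Cover)
    (z : ℝ × Torus) : HasDirDeriv e (moll φ f) (moll φ (dirDeriv e f) z) z := by
  have hm := hf.continuous.measurable
  refine (hasDerivAt_integral_of_dominated_loc_of_lip (𝕜 := ℝ) (μ := (volume : Measure Cover))
    (s := univ) (bound := fun w => φ.normed volume w * (K * ‖e‖))
    (F := fun s w => φ.normed volume w * f (z + proj (s • e) - proj w))
    (F' := fun w => φ.normed volume w * dirDeriv e f (z - proj w)) univ_mem ?_ ?_ ?_ ?_ ?_ ?_).2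
  · exact Eventually.of_forall fun s => (measurable_mul_shift φ hm _).aestronglyMeasurable
  · exact integrable_mul_shift φ hm hC _
  · exact (measurable_mul_shift φ (measurable_dirDeriv hf.continuous e) z).aestronglyMeasurable
  · refine Eventually.of_forall fun w => LipschitzOnWith.of_dist_le_mul fun s _ t _ => ?_
    have hb : 0 ≤ φ.normed volume w * (K * ‖e‖) := mul_nonneg (φ.nonneg_normed w) (by positivity)
    rw [Real.coe_nnabs, abs_of_nonneg hb, dist_eq_norm, ← mul_sub, norm_mul,
      Real.norm_of_nonneg (φ.nonneg_normed w), mul_assoc]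
    refine mul_le_mul_of_nonneg_left ?_ (φ.nonneg_normed w)
    refine (hf.norm_sub_le _ _).trans ?_
    rw [mul_assoc]
    refine mul_le_mul_of_nonneg_left ?_ K.2
    rw [sub_sub_sub_cancel_right, add_sub_add_left_eq_sub, ← proj_sub, ← sub_smul]
    refine (norm_proj_le _).trans_eq ?_
    rw [norm_smul, mul_comm, Real.dist_eq, Real.norm_eq_abs]
  · exact φ.integrable_normed.mul_const _
  · obtain ⟨w₀, hw₀, -⟩ := exists_proj_eq z
    have h1 : ∀ᵐ w : Cover, HasDirDeriv e f (dirDeriv e f (proj (w₀ - w))) (proj (w₀ - w)) :=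
      (Measure.measurePreserving_sub_left volume w₀).quasiMeasurePreserving.ae
        (ae_cover_hasDirDeriv hf e)
    filter_upwards [h1] with w hw
    rw [proj_sub, hw₀] at hw
    refine (HasDerivAt.const_mul (φ.normed volume w) hw).congr_of_eventuallyEq
      (Eventually.of_forall fun s => ?_)
    simp only [add_sub_right_comm]

theorem dirDeriv_moll {K : ℝ≥0} (hf : LipschitzWith K f) (hC : ∀ z, ‖f z‖ ≤ C) (e : Cover) :
    dirDeriv e (moll φ f) = moll φ (dirDeriv e f) :=
  funext fun z => (hasDirDeriv_moll φ hf hC e z).dirDeriv_eq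

theorem abs_fst_lt_of_normed_ne_zero {w : Cover} (hw : φ.normed volume w ≠ 0) :
    |w.1| < φ.rOut := by
  have : w ∈ Function.support (φ.normed volume) := hw
  rw [φ.support_normed_eq, mem_ball_zero_iff] at this
  exact (norm_fst_le w).trans_lt this

theorem moll_eq_zero {S : Set ℝ} (hf : ∀ t ∈ S, ∀ x, f (t, x) = 0) {t : ℝ}
    (ht : ∀ s, |s| < φ.rOut → t - s ∈ S) (x : Torus) : moll φ f (t, x) = 0 := by
  refine integral_eq_zero_of_ae (Eventually.of_forall fun w => ?_)
  by_cases hw : φ.normed volume w = 0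
  · simp [hw]
  · have := hf _ (ht _ (abs_fst_lt_of_normed_ne_zero φ hw)) ((t, x) - proj w).2
    exact mul_eq_zero_of_right _ this

theorem moll_eq_zero_of_ge {b ε : ℝ} (hf : ∀ t x, b ≤ t → f (t, x) = 0) (hε : φ.rOut ≤ ε) (t : ℝ)
    (x : Torus) (ht : b + ε ≤ t) : moll φ f (t, x) = 0 :=
  moll_eq_zero φ (S := Ici b) (fun t ht x => hf t x ht)
    (fun s hs => by simp only [mem_Ici]; linarith [le_abs_self s]) x

theorem moll_eq_zero_of_le {a ε : ℝ} (hf : ∀ t x, t ≤ a → f (t, x) = 0) (hε : φ.rOut ≤ ε) (t : ℝ)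
    (x : Torus) (ht : t ≤ a - ε) : moll φ f (t, x) = 0 :=
  moll_eq_zero φ (S := Iic a) (fun t ht x => hf t x ht)
    (fun s hs => by simp only [mem_Iic]; linarith [neg_abs_le s]) x

theorem ae_tendsto_moll {ε : ℝ} (hε : 0 < ε) (hf : Measurable f) (hC : ∀ z, ‖f z‖ ≤ C) :
    ∀ᵐ z, Tendsto (fun n => moll (bumpSeq hε n) f z) atTop (𝓝 (f z)) := by
  refine ae_of_ae_proj ?_
  have := ContDiffBump.ae_convolution_tendsto_right_of_locallyIntegrable (K := 2)
    (μ := (volume : Measure Cover)) (tendsto_bumpSeq_rOut hε)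
    (Eventually.of_forall fun n => ?_) (locallyIntegrable_lift hf hC)
  · filter_upwards [this] with w hw
    simpa only [moll_proj, Function.comp_apply] using hw
  · simp only [bumpSeq]
    rw [← mul_div_assoc, mul_div_mul_left _ _ two_ne_zero]

end

theorem dirDeriv_proj {f : ℝ × Torus → ℝ} (hf : Differentiable ℝ (f ∘ proj)) (e w : Cover) :
    dirDeriv e f (proj w) = fderiv ℝ (f ∘ proj) w e := by
  refine HasDirDeriv.dirDeriv_eq ?_
  refine HasDerivAt.congr_of_eventuallyEq ((hf w).hasFDerivAt.hasLineDerivAt e)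
    (Eventually.of_forall fun s => ?_)
  simp [proj_add]

/-- Symmetry of second derivatives. -/
theorem dirDeriv_comm {f : ℝ × Torus → ℝ} (hf : ContDiff ℝ 2 (f ∘ proj)) (e e' : Cover) :
    dirDeriv e (dirDeriv e' f) = dirDeriv e' (dirDeriv e f) := by
  have hd : ContDiff ℝ 1 (fderiv ℝ (f ∘ proj)) := hf.fderiv_right (by norm_num)
  have h1 : ∀ e, dirDeriv e f ∘ proj = fun w => fderiv ℝ (f ∘ proj) w e := fun e =>
    funext fun w => dirDeriv_proj (hf.differentiable (by norm_num)) e w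
  have h2 : ∀ e e' w, dirDeriv e (dirDeriv e' f) (proj w)
      = fderiv ℝ (fderiv ℝ (f ∘ proj)) w e e' := by
    intro e e' w
    have hdw := (hd.differentiable (by norm_num))
    rw [dirDeriv_proj (by rw [h1]; exact hdw.clm_apply (differentiable_const e')), h1,
      ((hdw w).hasFDerivAt.clm_apply (hasFDerivAt_const e' w)).fderiv]
    simp
  funext z
  obtain ⟨w, rfl, -⟩ := exists_proj_eq z
  rw [h2, h2]
  exact (hf.contDiffAt.isSymmSndFDerivAt (by simp)).eq e e'

/-! ### Lipschitz test functions -/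

/-- Bounded Lipschitz functions on space-time which vanish near and after the time `T`. -/
structure IsLipschitzTest (T : ℝ) (ψ : ℝ × Torus → ℝ) : Prop where
  lipschitz : ∃ K, LipschitzWith K ψ
  bounded : ∃ C, ∀ z, ‖ψ z‖ ≤ C
  late : ∃ b < T, ∀ t x, b ≤ t → ψ (t, x) = 0

theorem isTestFunction_moll (φ : ContDiffBump (0 : Cover)) {f : ℝ × Torus → ℝ} {C b T : ℝ}
    (hf : Measurable f) (hC : ∀ z, ‖f z‖ ≤ C) (hb : ∀ t x, b ≤ t → f (t, x) = 0)
    (hT : b + φ.rOut < T) : IsTestFunction T (moll φ f) ∧ IsLipschitzTest T (moll φ f) :=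
  ⟨⟨contDiff_moll φ hf hC 1, _, hT, moll_eq_zero_of_ge φ hb le_rfl⟩,
    ⟨exists_lipschitzWith_moll φ hf hC, ⟨C, norm_moll_le φ hC⟩, _, hT,
      moll_eq_zero_of_ge φ hb le_rfl⟩⟩

variable {E : Type*} [NormedAddCommGroup E] [NormedSpace ℝ E]

/-- Mollification approximates the derivatives of a Lipschitz function weakly. -/
theorem tendsto_integral_dirDeriv_moll {T : ℝ} {ψ : ℝ × Torus → ℝ} {K : ℝ≥0} {C ε : ℝ}
    (hψ : LipschitzWith K ψ) (hC : ∀ z, ‖ψ z‖ ≤ C) (hε : 0 < ε) (e : Cover)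
    {b : ℝ × Torus → E} (hb : Integrable b (muT T)) :
    Tendsto (fun n => ∫ z, dirDeriv e (moll (bumpSeq hε n) ψ) z • b z ∂(muT T)) atTop
      (𝓝 (∫ z, dirDeriv e ψ z • b z ∂(muT T))) := by
  have hm := measurable_dirDeriv hψ.continuous e
  have hbd := norm_dirDeriv_le hψ e
  simp only [dirDeriv_moll _ hψ hC]
  refine tendsto_integral_of_dominated_convergence (fun z => K * ‖e‖ * ‖b z‖) ?_
    (hb.norm.const_mul _) ?_ ?_
  · intro n
    obtain ⟨L, hL⟩ := exists_lipschitzWith_moll (bumpSeq hε n) hm hbd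
    exact hL.continuous.aestronglyMeasurable.smul hb.aestronglyMeasurable
  · intro n
    refine Eventually.of_forall fun z => ?_
    rw [norm_smul]
    exact mul_le_mul_of_nonneg_right (norm_moll_le _ hbd z) (norm_nonneg _)
  · filter_upwards [ae_muT (ae_tendsto_moll hε hm hbd)] with z hz
    exact hz.smul_const _

/-- A weak identity which holds for smooth test functions holds for Lipschitz ones. -/
theorem weak_identity_of_smooth {ι : Type*} [Fintype ι] {T : ℝ} (e : ι → Cover)
    {b : ι → ℝ × Torus → E} (hb : ∀ j, Integrable (b j) (muT T))
    (h : ∀ ψ, IsTestFunction T ψ → IsLipschitzTest T ψ →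
      ∑ j, ∫ z, dirDeriv (e j) ψ z • b j z ∂(muT T) = 0)
    {ψ : ℝ × Torus → ℝ} (hψ : IsLipschitzTest T ψ) :
    ∑ j, ∫ z, dirDeriv (e j) ψ z • b j z ∂(muT T) = 0 := by
  obtain ⟨⟨K, hK⟩, ⟨C, hC⟩, b', hb', hlate⟩ := hψ
  have hε : 0 < (T - b') / 2 := by linarith
  refine tendsto_nhds_unique (tendsto_finsetSum Finset.univ fun j _ =>
    tendsto_integral_dirDeriv_moll hK hC hε (e j) (hb j)) (tendsto_const_nhds.congr fun n => ?_)
  have h1 := isTestFunction_moll (bumpSeq hε n) hK.continuous.measurable hC hlate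
    (T := T) (by linarith [bumpSeq_rOut_le hε n])
  exact (h _ h1.1 h1.2).symm

theorem integrable_dirDeriv_smul {T : ℝ} {ψ : ℝ × Torus → ℝ} {K : ℝ≥0}
    (hψ : LipschitzWith K ψ) (e : Cover) {b : ℝ × Torus → E} (hb : Integrable b (muT T)) :
    Integrable (fun z => dirDeriv e ψ z • b z) (muT T) := by
  refine (hb.norm.const_mul (K * ‖e‖)).mono'
    ((measurable_dirDeriv hψ.continuous e).aestronglyMeasurable.smul hb.aestronglyMeasurable)
    (Eventually.of_forall fun z => ?_)
  rw [norm_smul]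
  exact mul_le_mul_of_nonneg_right (norm_dirDeriv_le hψ e z) (norm_nonneg _)

/-! ### Divergence-free fields from transport equations -/

theorem norm_intervalIntegral_le_of_support {g : ℝ → ℝ} {a b D : ℝ} (hab : a ≤ b)
    (hg : Continuous g) (hD : ∀ s, ‖g s‖ ≤ D) (hs : ∀ s, s ∉ Icc a b → g s = 0) (t t' : ℝ) :
    ‖∫ s in t..t', g s‖ ≤ D * (b - a) := by
  have hD0 : 0 ≤ D := (norm_nonneg _).trans (hD 0)
  have hi : Integrable ((Icc a b).indicator fun _ => D) :=
    (integrable_indicator_iff measurableSet_Icc).2 (integrableOn_const measure_Icc_lt_top.ne)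
  have h1 : ∀ s, ‖g s‖ ≤ (Icc a b).indicator (fun _ => D) s := fun s => by
    by_cases h : s ∈ Icc a b
    · rw [indicator_of_mem h]; exact hD s
    · rw [indicator_of_notMem h, hs s h, norm_zero]
  calc ‖∫ s in t..t', g s‖ ≤ ∫ s in uIoc t t', ‖g s‖ :=
        intervalIntegral.norm_integral_le_integral_norm_uIoc
    _ ≤ ∫ s in uIoc t t', (Icc a b).indicator (fun _ => D) s :=
        integral_mono ((hg.norm.intervalIntegrable t t').def') hi.integrableOn h1
    _ ≤ ∫ s, (Icc a b).indicator (fun _ => D) s :=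
        setIntegral_le_integral hi (Eventually.of_forall
          (indicator_nonneg fun _ _ => hD0))
    _ = D * (b - a) := by
        rw [integral_indicator measurableSet_Icc]
        simp [hab, mul_comm]

/-- The antiderivative in time of a Lipschitz test function, vanishing at late times. -/
def timePrimitive (T : ℝ) (χ : ℝ × Torus → ℝ) (z : ℝ × Torus) : ℝ := ∫ s in T..z.1, χ (s, z.2)

theorem dirDeriv_timePrimitive {T : ℝ} {χ : ℝ × Torus → ℝ} (hχ : Continuous χ) :
    dirDeriv timeDir (timePrimitive T χ) = χ := by
  funext z
  rw [← dt_eq_dirDeriv]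
  have hc : Continuous fun s : ℝ => χ (s, z.2) := hχ.comp (Continuous.prodMk_left z.2)
  exact (hc.integral_hasStrictDerivAt T z.1).hasDerivAt.deriv

theorem timePrimitive_eq_zero {T b : ℝ} {χ : ℝ × Torus → ℝ} (hb : b ≤ T)
    (hlate : ∀ t x, b ≤ t → χ (t, x) = 0) (t : ℝ) (x : Torus) (ht : b ≤ t) :
    timePrimitive T χ (t, x) = 0 := by
  refine intervalIntegral.integral_zero_ae (Eventually.of_forall fun s hs => hlate s x ?_)
  rcases le_total T t with h | h
  · rw [uIoc_of_le h] at hs; exact hb.trans hs.1.le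
  · rw [uIoc_of_ge h] at hs; exact ht.trans hs.1.le

theorem exists_lipschitzWith_timePrimitive {T a b C : ℝ} {χ : ℝ × Torus → ℝ} {K : ℝ≥0}
    (hK : LipschitzWith K χ) (hC : ∀ z, ‖χ z‖ ≤ C)
    (hearly : ∀ t x, t ≤ a → χ (t, x) = 0) (hlate : ∀ t x, b ≤ t → χ (t, x) = 0) :
    (∃ L, LipschitzWith L (timePrimitive T χ)) ∧ ∃ D, ∀ z, ‖timePrimitive T χ z‖ ≤ D := by
  have hC0 : 0 ≤ C := (norm_nonneg _).trans (hC 0)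
  set a' := min a b
  have hab : a' ≤ b := min_le_right _ _
  have hsupp : ∀ x s, s ∉ Icc a' b → χ (s, x) = 0 := fun x s hs => by
    rcases le_total s a' with h | h
    · exact hearly s x (h.trans (min_le_left _ _))
    · rcases le_total b s with h' | h'
      · exact hlate s x h'
      · exact absurd ⟨h, h'⟩ hs
  have hc : ∀ x, Continuous fun s : ℝ => χ (s, x) := fun x =>
    hK.continuous.comp (Continuous.prodMk_left x)
  refine ⟨⟨Real.toNNReal (C + K * (b - a')), LipschitzWith.of_dist_le_mul fun z z' => ?_⟩,
    C * (b - a'), fun z => ?_⟩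
  · have hba : 0 ≤ b - a' := sub_nonneg.2 hab
    rw [Real.coe_toNNReal _ (by positivity), dist_eq_norm, dist_eq_norm]
    have e1 : timePrimitive T χ z - timePrimitive T χ z'
        = (∫ s in z'.1..z.1, χ (s, z.2)) + ∫ s in T..z'.1, (χ (s, z.2) - χ (s, z'.2)) := by
      rw [intervalIntegral.integral_sub ((hc _).intervalIntegrable _ _)
        ((hc _).intervalIntegrable _ _)]
      have := intervalIntegral.integral_add_adjacent_intervals (a := T) (b := z'.1) (c := z.1)
        ((hc z.2).intervalIntegrable (μ := volume) _ _) ((hc z.2).intervalIntegrable _ _)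
      simp only [timePrimitive, ← this]
      ring
    have e2 : ‖∫ s in z'.1..z.1, χ (s, z.2)‖ ≤ C * ‖z - z'‖ := by
      refine (intervalIntegral.norm_integral_le_of_norm_le_const fun s _ => hC _).trans ?_
      exact mul_le_mul_of_nonneg_left (norm_fst_le (z - z')) hC0
    have e3 : ‖∫ s in T..z'.1, (χ (s, z.2) - χ (s, z'.2))‖ ≤ K * ‖z - z'‖ * (b - a') := by
      refine norm_intervalIntegral_le_of_support hab ((hc _).sub (hc _)) (fun s => ?_)
        (fun s hs => by simp [hsupp _ s hs]) _ _
      refine (hK.norm_sub_le _ _).trans (mul_le_mul_of_nonneg_left ?_ K.2)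
      rw [Prod.mk_sub_mk, sub_self, Prod.norm_def]
      simpa using norm_snd_le (z - z')
    rw [e1]
    refine (norm_add_le _ _).trans ((add_le_add e2 e3).trans_eq ?_)
    ring
  · exact norm_intervalIntegral_le_of_support hab (hc _) (fun s => hC _) (hsupp z.2) _ _

/-- If `∂_t W = ∑_β ∂_β N_β` weakly, with vanishing initial values, and the second order
operator `∑_{α,β} A_α ∂_α ∂_β N_β` vanishes by antisymmetry, then `∑_α ∂_α (A_α W) = 0` weakly. -/
theorem divergence_free_of_transport [CompleteSpace E] {E' : Type*} [NormedAddCommGroup E']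
    [NormedSpace ℝ E'] [CompleteSpace E'] {T : ℝ} {W : ℝ × Torus → E}
    {N : Fin 3 → ℝ × Torus → E} (hW : Integrable W (muT T)) (hN : ∀ β, Integrable (N β) (muT T))
    (h : ∀ ψ, IsTestFunction T ψ → IsLipschitzTest T ψ →
      ∫ z, dirDeriv timeDir ψ z • W z ∂(muT T)
        = ∑ β, ∫ z, dirDeriv (spaceDir β) ψ z • N β z ∂(muT T))
    (A : Fin 3 → E →L[ℝ] E') (hA : ∀ᵐ z ∂(muT T), ∀ α β, A α (N β z) = -A β (N α z))
    {χ : ℝ × Torus → ℝ} (hχ : IsLipschitzTest T χ) {a : ℝ}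
    (hearly : ∀ t x, t ≤ a → χ (t, x) = 0) :
    ∑ α, ∫ z, dirDeriv (spaceDir α) χ z • A α (W z) ∂(muT T) = 0 := by
  obtain ⟨⟨K, hK⟩, ⟨C, hC⟩, b, hb, hlate⟩ := hχ
  obtain ⟨⟨L, hL⟩, D, hD⟩ := exists_lipschitzWith_timePrimitive (T := T) hK hC hearly hlate
  -- The transport equation is tested with `∂_α X`, where `∂_t X = χ`; mollification makes the
  -- second derivatives available.
  set X := timePrimitive T χ
  have hX0 : ∀ t x, b ≤ t → X (t, x) = 0 := timePrimitive_eq_zero hb.le hlate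
  have hXt : dirDeriv timeDir X = χ := dirDeriv_timePrimitive hK.continuous
  have hXα : ∀ α t x, b ≤ t → dirDeriv (spaceDir α) X (t, x) = 0 := fun α t x ht => by
    have : (fun s : ℝ => X ((t, x) + proj (s • spaceDir α))) = fun _ => 0 := funext fun s => by
      rw [proj_smul_spaceDir, Prod.mk_add_mk]
      exact hX0 _ _ (by simpa using ht)
    rw [dirDeriv, this, deriv_const]
  have hε : 0 < (T - b) / 2 := by linarith
  refine tendsto_nhds_unique (tendsto_finsetSum Finset.univ fun α _ =>
    tendsto_integral_dirDeriv_moll hK hC hε (spaceDir α) ((A α).integrable_comp hW))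
    (tendsto_const_nhds.congr fun n => ?_)
  set φ := bumpSeq hε n
  have hφ : b + φ.rOut < T := by linarith [bumpSeq_rOut_le hε n]
  have hψ : ∀ α, IsTestFunction T (dirDeriv (spaceDir α) (moll φ X))
      ∧ IsLipschitzTest T (dirDeriv (spaceDir α) (moll φ X)) := fun α => by
    rw [dirDeriv_moll φ hL hD]
    exact isTestFunction_moll φ (measurable_dirDeriv hL.continuous _) (norm_dirDeriv_le hL _)
      (hXα α) hφ
  have hcomm := fun e e' => dirDeriv_comm (contDiff_moll φ hL.continuous.measurable hD 2) e e'
  have hi : ∀ α β, Integrable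
      (fun z => dirDeriv (spaceDir β) (dirDeriv (spaceDir α) (moll φ X)) z • N β z) (muT T) := by
    intro α β
    obtain ⟨K', hK'⟩ := (hψ α).2.lipschitz
    exact integrable_dirDeriv_smul hK' _ (hN β)
  have key : ∀ α, ∫ z, dirDeriv (spaceDir α) (moll φ χ) z • A α (W z) ∂(muT T)
      = ∑ β, ∫ z, dirDeriv (spaceDir β) (dirDeriv (spaceDir α) (moll φ X)) z • A α (N β z)
          ∂(muT T) := by
    intro α
    have h1 := h _ (hψ α).1 (hψ α).2
    obtain ⟨K', hK'⟩ := (hψ α).2.lipschitz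
    have hi' := integrable_dirDeriv_smul hK' timeDir hW
    rw [hcomm timeDir, dirDeriv_moll φ hL hD timeDir, hXt] at h1 hi'
    have h2 := congrArg (A α) h1
    rw [map_sum, ← ContinuousLinearMap.integral_comp_comm _ hi'] at h2
    simp only [map_smul] at h2
    rw [h2]
    refine Finset.sum_congr rfl fun β _ => ?_
    rw [← ContinuousLinearMap.integral_comp_comm _ (hi α β)]
    simp only [map_smul]
  simp only [key]
  set S := ∑ α, ∑ β,
    ∫ z, dirDeriv (spaceDir β) (dirDeriv (spaceDir α) (moll φ X)) z • A α (N β z) ∂(muT T) with hS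
  -- The second derivatives are symmetric and `A α (N β)` is antisymmetric in `α, β`.
  have hneg : S = -S := by
    conv_lhs => rw [hS, Finset.sum_comm]
    rw [hS]
    simp only [← Finset.sum_neg_distrib]
    refine Finset.sum_congr rfl fun α _ => Finset.sum_congr rfl fun β _ => ?_
    rw [← integral_neg]
    refine integral_congr_ae ?_
    filter_upwards [hA] with z hz
    rw [hcomm, hz β α, smul_neg]
  have h3 : (2 : ℝ) • S = 0 := by
    rw [two_smul]
    exact add_eq_zero_iff_eq_neg.mpr hneg
  exact ((smul_eq_zero.mp h3).resolve_left two_ne_zero).symm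

/-! ### Averages against the Young measure -/

section

variable {G : Ext → ℝ} {p q r : ℝ} (hG : StoredEnergy G p q r)
include hG

section

variable {E : Type*} [NormedAddCommGroup E] {m : Measure State} [IsProbabilityMeasure m]
  (hm : Integrable (energy G) m)
include hm

omit hG in
theorem integrable_of_le_energy {h : State → E} (hc : Continuous h) {C : ℝ}
    (hC : ∀ s, ‖h s‖ ≤ C * (energy G s + 1)) : Integrable h m :=
  ((hm.add (integrable_const 1)).const_mul C).mono' hc.aestronglyMeasurable
    (Eventually.of_forall hC)

theorem StoredEnergy.integrable_id : Integrable (fun s : State => s) m := by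
  obtain ⟨C, hC, h⟩ := hG.norm_sq_le_energy
  refine integrable_of_le_energy hm continuous_id (C := C + 1) fun s => ?_
  have h1 := h s
  have h2 := hG.energy_nonneg s
  have h3 : ‖s‖ ≤ ‖s‖ ^ 2 + 1 := by nlinarith [sq_nonneg (‖s‖ - 1)]
  nlinarith

theorem StoredEnergy.integrable_stress (i α : Fin 3) :
    Integrable (fun s : State => stress G i α s.2) m := by
  obtain ⟨C, hC, h⟩ := hG.stress_le i α
  obtain ⟨C', hC', h'⟩ := hG.growth_le_energy
  refine integrable_of_le_energy hm ((hG.contDiff_stress i α).continuous.comp continuous_snd)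
    (C := C * C') fun s => (h s.2).trans ?_
  rw [mul_assoc]
  exact mul_le_mul_of_nonneg_left (h' s) hC

theorem StoredEnergy.integrable_relEnergy (u : State) : Integrable (relEnergy G u) m := by
  have h1 := (hG.integrable_id hm).fst.sub (integrable_const u.1)
  have h2 := (hG.integrable_id hm).snd.sub (integrable_const u.2)
  exact ((hm.sub (integrable_const _)).sub ((innerSL ℝ u.1).integrable_comp h1)).sub
    ((fderiv ℝ G u.2).integrable_comp h2)

theorem StoredEnergy.integral_relEnergy (u : State) :
    ∫ s, relEnergy G u s ∂m = ∫ s, energy G s ∂m - energy G u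
      - inner ℝ u.1 (∫ s, s.1 ∂m - u.1) - fderiv ℝ G u.2 (∫ s, s.2 ∂m - u.2) := by
  have i1 := (hG.integrable_id hm).fst
  have i2 := (hG.integrable_id hm).snd
  have h1 := i1.sub (integrable_const u.1)
  have h2 := i2.sub (integrable_const u.2)
  have e1 : ∫ s : State, inner ℝ u.1 (s.1 - u.1) ∂m = inner ℝ u.1 (∫ s, s.1 ∂m - u.1) := by
    have := (innerSL ℝ u.1).integral_comp_comm h1
    simp only [Pi.sub_apply, innerSL_apply_apply] at this
    rw [this, integral_sub i1 (integrable_const _)]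
    simp
  have e2 : ∫ s : State, fderiv ℝ G u.2 (s.2 - u.2) ∂m
      = fderiv ℝ G u.2 (∫ s, s.2 ∂m - u.2) := by
    have := (fderiv ℝ G u.2).integral_comp_comm h2
    simp only [Pi.sub_apply] at this
    rw [this, integral_sub i2 (integrable_const _)]
    simp
  have j1 : Integrable (fun s : State => inner ℝ u.1 (s.1 - u.1)) m :=
    (innerSL ℝ u.1).integrable_comp h1
  have j2 : Integrable (fun s : State => fderiv ℝ G u.2 (s.2 - u.2)) m :=
    (fderiv ℝ G u.2).integrable_comp h2
  have j3 : Integrable (fun s => energy G s - energy G u) m := hm.sub (integrable_const _)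
  have j4 : Integrable (fun s : State => energy G s - energy G u - inner ℝ u.1 (s.1 - u.1)) m :=
    j3.sub j1
  simp only [relEnergy]
  rw [integral_sub j4 j2, integral_sub j3 j1, integral_sub hm (integrable_const _), e1, e2]
  simp

theorem StoredEnergy.integrable_norm_sub_sq (u : State) :
    Integrable (fun s : State => ‖s - u‖ ^ 2) m := by
  obtain ⟨κ, hκ, h⟩ := hG.relEnergy_quadratic
  refine ((hG.integrable_relEnergy hm u).const_mul κ⁻¹).mono'
    (by fun_prop) (Eventually.of_forall fun s => ?_)
  rw [Real.norm_of_nonneg (by positivity), ← div_eq_inv_mul, le_div_iff₀ hκ, mul_comm]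
  exact h u s

/-- Jensen's inequality for the squared distance. -/
theorem StoredEnergy.norm_mean_sub_sq_le (u : State) :
    ‖∫ s, s ∂m - u‖ ^ 2 ≤ ∫ s, ‖s - u‖ ^ 2 ∂m := by
  have h1 := (hG.integrable_id hm).sub (integrable_const u)
  have h2 := hG.integrable_norm_sub_sq hm u
  have h3 : ‖∫ s, s ∂m - u‖ ≤ ∫ s, ‖s - u‖ ∂m := by
    have := norm_integral_le_integral_norm (μ := m) (fun s : State => s - u)
    rw [integral_sub (hG.integrable_id hm) (integrable_const u)] at this
    simpa using this
  set a := ∫ s, ‖s - u‖ ∂m with ha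
  have h1' : Integrable (fun s : State => ‖s - u‖) m := h1.norm
  have h4 : 0 ≤ ∫ s, (‖s - u‖ - a) ^ 2 ∂m := integral_nonneg fun s => sq_nonneg _
  have h5 : ∫ s, (‖s - u‖ - a) ^ 2 ∂m = ∫ s, ‖s - u‖ ^ 2 ∂m - a ^ 2 := by
    have : ∀ s : State, (‖s - u‖ - a) ^ 2 = ‖s - u‖ ^ 2 - 2 * a * ‖s - u‖ + a ^ 2 :=
      fun s => by ring
    simp only [this]
    have h6 : Integrable (fun s : State => ‖s - u‖ ^ 2 - 2 * a * ‖s - u‖) m :=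
      h2.sub (h1'.const_mul _)
    rw [integral_add h6 (integrable_const _),
      integral_sub h2 (h1'.const_mul _), integral_const_mul, ← ha]
    simp
    ring
  have h6 : ‖∫ s, s ∂m - u‖ ^ 2 ≤ a ^ 2 := pow_le_pow_left₀ (norm_nonneg _) h3 2
  linarith

end

theorem StoredEnergy.norm_mean_sub_sq_le_relEnergy :
    ∃ C, 0 ≤ C ∧ ∀ (m : Measure State) [IsProbabilityMeasure m], Integrable (energy G) m →
      ∀ u, ‖∫ s, s ∂m - u‖ ^ 2 ≤ C * ∫ s, relEnergy G u s ∂m := by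
  obtain ⟨κ, hκ, h⟩ := hG.relEnergy_quadratic
  refine ⟨κ⁻¹, by positivity, fun m _ hm u => (hG.norm_mean_sub_sq_le hm u).trans ?_⟩
  rw [← integral_const_mul]
  refine integral_mono (hG.integrable_norm_sub_sq hm u)
    ((hG.integrable_relEnergy hm u).const_mul _) fun s => ?_
  simp only
  rw [← div_eq_inv_mul, le_div_iff₀ hκ, mul_comm]
  exact h u s

/-- The mean of the stress deviates from its linearization at `u` by at most a multiple of the
mean relative energy. -/
theorem StoredEnergy.stress_mean_le (i α : Fin 3) (M : ℝ) :
    ∃ C, ∀ (m : Measure State) [IsProbabilityMeasure m], Integrable (energy G) m →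
      ∀ u : State, ‖u.2‖ ≤ M →
        |∫ s, stress G i α s.2 ∂m - stress G i α u.2
          - fderiv ℝ (stress G i α) u.2 (∫ s, s.2 ∂m - u.2)| ≤ C * ∫ s, relEnergy G u s ∂m := by
  obtain ⟨A, -, hA⟩ := hG.stress_le i α
  obtain ⟨C, hC⟩ := hG.taylor_le_relG (hG.contDiff_stress i α) hA M
  refine ⟨|C|, fun m _ hm u hu => ?_⟩
  have i2 := (hG.integrable_id hm).snd
  have h2 := i2.sub (integrable_const u.2)
  have hs := hG.integrable_stress hm i α
  have e2 : ∫ s : State, fderiv ℝ (stress G i α) u.2 (s.2 - u.2) ∂m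
      = fderiv ℝ (stress G i α) u.2 (∫ s, s.2 ∂m - u.2) := by
    have := (fderiv ℝ (stress G i α) u.2).integral_comp_comm h2
    simp only [Pi.sub_apply] at this
    rw [this, integral_sub i2 (integrable_const _)]
    simp
  have j2 : Integrable (fun s : State => fderiv ℝ (stress G i α) u.2 (s.2 - u.2)) m :=
    (fderiv ℝ (stress G i α) u.2).integrable_comp h2
  have e : ∫ s, stress G i α s.2 ∂m - stress G i α u.2
      - fderiv ℝ (stress G i α) u.2 (∫ s, s.2 ∂m - u.2)
      = ∫ s, (stress G i α s.2 - stress G i α u.2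
          - fderiv ℝ (stress G i α) u.2 (s.2 - u.2)) ∂m := by
    have j3 : Integrable (fun s : State => stress G i α s.2 - stress G i α u.2) m :=
      hs.sub (integrable_const _)
    rw [integral_sub j3 j2, integral_sub hs (integrable_const _), e2]
    simp
  rw [e, ← integral_const_mul, ← Real.norm_eq_abs]
  refine norm_integral_le_of_norm_le ((hG.integrable_relEnergy hm u).const_mul _)
    (Eventually.of_forall fun s => (hC u.2 s.2 hu).trans ?_)
  have h3 := hG.relG_nonneg u.2 s.2
  have h4 : relG G u.2 s.2 ≤ relEnergy G u s := by
    rw [relEnergy_eq]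
    linarith [sq_nonneg ‖s.1 - u.1‖]
  exact mul_le_mul (le_abs_self C) h4 h3 (abs_nonneg C)

/-- A probability measure whose mean relative energy vanishes is a Dirac mass. -/
theorem StoredEnergy.eq_dirac {m : Measure State} [IsProbabilityMeasure m]
    (hm : Integrable (energy G) m) {u : State} (h : ∫ s, relEnergy G u s ∂m = 0) :
    m = Measure.dirac u := by
  obtain ⟨κ, hκ, hq⟩ := hG.relEnergy_quadratic
  have h0 : ∀ s, 0 ≤ relEnergy G u s := fun s => le_trans (by positivity) (hq u s)
  have h1 := (integral_eq_zero_iff_of_nonneg h0 (hG.integrable_relEnergy hm u)).1 h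
  have h2 : ∀ᵐ s ∂m, s = u := by
    filter_upwards [h1] with s hs
    have h3 := hq u s
    rw [hs, Pi.zero_apply] at h3
    have h4 : ‖s - u‖ ^ 2 ≤ 0 := by
      by_contra hc
      push Not at hc
      nlinarith
    exact sub_eq_zero.1 (norm_eq_zero.1 (pow_eq_zero_iff two_ne_zero |>.1
      (le_antisymm h4 (sq_nonneg _))))
  ext S hS
  rw [Measure.dirac_apply' _ hS]
  by_cases hu : u ∈ S
  · rw [indicator_of_mem hu, Pi.one_apply]
    refine (prob_compl_eq_zero_iff hS).1 (measure_mono_null ?_ h2)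
    intro s hs hsu
    exact hs (hsu ▸ hu)
  · rw [indicator_of_notMem hu]
    refine measure_mono_null ?_ h2
    intro s hs hsu
    exact hu (hsu ▸ hs)

/-! ### Integrability of the energy of the Young measure -/

variable {T : ℝ} {f : ℕ → ℝ × Torus → State} {ν : Kernel (ℝ × Torus) State}

theorem StoredEnergy.lintegral_energy_le (hf : GeneratesYoungMeasure G T f ν) :
    ∃ C : ℝ≥0, ∀ n, ∀ S : Set ℝ, MeasurableSet S →
      ∫⁻ z in S ×ˢ univ, ENNReal.ofReal (energy G (f n z)) ∂(muT T) ≤ C * volume S := by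
  obtain ⟨C, hC⟩ := hf.energy_bound
  refine ⟨C, fun n S hS => ?_⟩
  have hm : AEMeasurable (fun z => ENNReal.ofReal (energy G (f n z))) (muT T) :=
    (hG.continuous_energy.measurable.comp_aemeasurable (hf.aemeasurable n)).ennreal_ofReal
  have hm' := hm.restrict (s := S ×ˢ univ)
  rw [muT_eq_prod, ← Measure.prod_restrict, Measure.restrict_univ] at hm' ⊢
  rw [lintegral_prod _ hm']
  calc _ ≤ ∫⁻ t, C ∂((volume.restrict (Ico 0 T)).restrict S) := lintegral_mono_ae
        (ae_restrict_of_ae (hC n))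
    _ ≤ C * volume S := by
        rw [lintegral_const, Measure.restrict_apply_univ]
        exact mul_le_mul_right (Measure.restrict_le_self S) _

theorem StoredEnergy.integrable_energy_compProd [IsMarkovKernel ν]
    (hf : GeneratesYoungMeasure G T f ν) :
    Integrable (fun z : (ℝ × Torus) × State => energy G z.2) (muT T ⊗ₘ ν) := by
  obtain ⟨C, hC⟩ := hG.lintegral_energy_le hf
  set B : ℝ≥0∞ := C * volume (Ico 0 T)
  have hB : B ≠ ⊤ := ENNReal.mul_ne_top ENNReal.coe_ne_top (by simp)
  have hcE := hG.continuous_energy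
  have hCn : ∀ n, ∫⁻ z, ENNReal.ofReal (energy G (f n z)) ∂(muT T) ≤ B := by
    intro n
    have := hC n (Ico 0 T) measurableSet_Ico
    rwa [muT, Measure.restrict_restrict (measurableSet_Ico.prod MeasurableSet.univ), QT,
      inter_self] at this
  -- The energy itself is not an admissible test function for the Young measure, but its
  -- truncations are.
  let g : ℕ → State → ℝ := fun k s => min (energy G s) k
  have hgc : ∀ k, Continuous (g k) := fun k => hcE.min continuous_const
  have hg0 : ∀ k s, 0 ≤ g k s := fun k s => le_min (hG.energy_nonneg s) k.cast_nonneg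
  have hgk : ∀ k s, ‖g k s‖ ≤ k := fun k s => by
    rw [Real.norm_of_nonneg (hg0 k s)]
    exact min_le_right _ _
  have hgo : ∀ k, g k =o[cocompact State] energy G := fun k => by
    refine Asymptotics.IsBigO.trans_isLittleO (g := fun _ => (1 : ℝ)) ?_ ?_
    · exact Asymptotics.IsBigO.of_bound (k : ℝ) (Eventually.of_forall fun s => by
        simpa using hgk k s)
    · rw [Asymptotics.isLittleO_const_left]
      exact Or.inr (tendsto_norm_atTop_atTop.comp hG.tendsto_energy)
  have hgi : ∀ k, Integrable (fun z : (ℝ × Torus) × State => g k z.2) (muT T ⊗ₘ ν) := fun k =>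
    Integrable.of_bound ((hgc k).comp continuous_snd).aestronglyMeasurable k
      (Eventually.of_forall fun z => hgk k z.2)
  have hlim : ∀ k, ∫ z, g k z.2 ∂(muT T ⊗ₘ ν) ≤ B.toReal := by
    intro k
    have h1 := hf.weak_limit (g k) (hgc k) (hgo k) (fun _ => 1) measurable_const
      ⟨1, fun _ => by simp⟩
    simp only [one_mul] at h1
    rw [Measure.integral_compProd (hgi k)]
    refine le_of_tendsto h1 (Eventually.of_forall fun n => ?_)
    have hm := (hgc k).measurable.comp_aemeasurable (hf.aemeasurable n)
    rw [integral_eq_lintegral_of_nonneg_ae (Eventually.of_forall fun z => hg0 k _)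
      hm.aestronglyMeasurable]
    refine ENNReal.toReal_mono hB ((lintegral_mono fun z => ?_).trans (hCn n))
    exact ENNReal.ofReal_le_ofReal (min_le_left _ _)
  have hmon : ∫⁻ z, ENNReal.ofReal (energy G z.2) ∂(muT T ⊗ₘ ν) ≤ B := by
    have h1 : ∀ z : (ℝ × Torus) × State,
        ENNReal.ofReal (energy G z.2) = ⨆ k : ℕ, ENNReal.ofReal (g k z.2) := by
      intro z
      refine le_antisymm ?_ (iSup_le fun k => ENNReal.ofReal_le_ofReal (min_le_left _ _))
      obtain ⟨k, hk⟩ := exists_nat_ge (energy G z.2)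
      refine le_iSup_of_le k ?_
      simp [g, min_eq_left hk]
    simp only [h1]
    have hmeas : ∀ k, Measurable fun z : (ℝ × Torus) × State => ENNReal.ofReal (g k z.2) :=
      fun k => ((hgc k).comp continuous_snd).measurable.ennreal_ofReal
    rw [lintegral_iSup hmeas]
    · refine iSup_le fun k => ?_
      rw [← ofReal_integral_eq_lintegral_ofReal (hgi k) (Eventually.of_forall fun z => hg0 k _)]
      exact (ENNReal.ofReal_le_ofReal (hlim k)).trans ENNReal.ofReal_toReal_le
    · intro k l hkl z
      exact ENNReal.ofReal_le_ofReal (min_le_min le_rfl (by exact_mod_cast hkl))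
  refine ⟨(hcE.comp continuous_snd).aestronglyMeasurable, ?_⟩
  rw [hasFiniteIntegral_iff_ofReal (Eventually.of_forall fun z => hG.energy_nonneg _)]
  exact hmon.trans_lt hB.lt_top

theorem StoredEnergy.ae_integrable_energy [IsMarkovKernel ν] (hf : GeneratesYoungMeasure G T f ν) :
    ∀ᵐ z ∂(muT T), Integrable (energy G) (ν z) :=
  ((Measure.integrable_compProd_iff
    (hG.continuous_energy.comp continuous_snd).aestronglyMeasurable).1
      (hG.integrable_energy_compProd hf)).1

theorem StoredEnergy.integrable_mean [IsMarkovKernel ν] (hf : GeneratesYoungMeasure G T f ν)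
    {E : Type*} [NormedAddCommGroup E] [NormedSpace ℝ E] [SecondCountableTopology E]
    {h : State → E} (hc : Continuous h) {C : ℝ}
    (hC : ∀ s, ‖h s‖ ≤ C * (energy G s + 1)) : Integrable (fun z => ∫ s, h s ∂(ν z)) (muT T) := by
  have h1 : Integrable (fun z : (ℝ × Torus) × State => h z.2) (muT T ⊗ₘ ν) := by
    refine (((hG.integrable_energy_compProd hf).add (integrable_const 1)).const_mul C).mono'
      (hc.comp continuous_snd).aestronglyMeasurable (Eventually.of_forall fun z => hC z.2)
  exact h1.integral_compProd

theorem StoredEnergy.integrable_mean_energy [IsMarkovKernel ν]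
    (hf : GeneratesYoungMeasure G T f ν) :
    Integrable (fun z => ∫ s, energy G s ∂(ν z)) (muT T) :=
  hG.integrable_mean hf hG.continuous_energy (C := 1) fun s => by
    rw [Real.norm_of_nonneg (hG.energy_nonneg s)]
    linarith

/-- The uniform energy bound in time excludes concentration at the final time. -/
theorem StoredEnergy.concentration_final [IsMarkovKernel ν] {γ : Measure (ℝ × Torus)}
    (hf : GeneratesYoungMeasure G T f ν) (hγ : GeneratesConcentration G T f ν γ) :
    γ ({T} ×ˢ univ) = 0 := by
  have := hγ.finite
  obtain ⟨C, hC⟩ := hG.lintegral_energy_le hf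
  have hcE := hG.continuous_energy
  have key : ∀ δ, 0 < δ → γ.real ({T} ×ˢ univ) ≤ C * δ := by
    intro δ hδ
    -- A cutoff in time which equals `1` at `T` and vanishes before `T - δ`.
    let ψ : ℝ × Torus → ℝ := fun z => max 0 (min 1 (1 - (T - z.1) / δ))
    have hψc : Continuous ψ := by fun_prop
    have hψ0 : ∀ z, 0 ≤ ψ z := fun z => le_max_left _ _
    have hψ1 : ∀ z, ψ z ≤ 1 := fun z => max_le zero_le_one (min_le_left _ _)
    have hψb : ∀ z, ‖ψ z‖ ≤ 1 := fun z => by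
      rw [Real.norm_of_nonneg (hψ0 z)]
      exact hψ1 z
    have hψT : ∀ z ∈ ({T} ×ˢ univ : Set (ℝ × Torus)), ψ z = 1 := by
      rintro z ⟨hz, -⟩
      simp [ψ, mem_singleton_iff.1 hz]
    have hψe : ∀ z : ℝ × Torus, z.1 ≤ T - δ → ψ z = 0 := by
      intro z hz
      have : 1 - (T - z.1) / δ ≤ 0 := by
        rw [sub_nonpos, le_div_iff₀ hδ]
        linarith
      exact max_eq_left ((min_le_right _ _).trans this)
    have hS : MeasurableSet ({T} ×ˢ univ : Set (ℝ × Torus)) :=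
      (measurableSet_singleton T).prod MeasurableSet.univ
    have h1 : γ.real ({T} ×ˢ univ) ≤ ∫ z, ψ z ∂γ := by
      rw [← integral_indicator_one hS]
      refine integral_mono ((integrable_const (1 : ℝ)).indicator hS)
        (Integrable.of_bound hψc.aestronglyMeasurable 1 (Eventually.of_forall hψb)) fun z => ?_
      by_cases hz : z ∈ ({T} ×ˢ univ : Set (ℝ × Torus))
      · rw [indicator_of_mem hz, hψT z hz, Pi.one_apply]
      · rw [indicator_of_notMem hz]
        exact hψ0 z
    refine h1.trans (le_of_tendsto (hγ.weak_limit ψ hψc) (Eventually.of_forall fun n => ?_))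
    set S : Set (ℝ × Torus) := Ico (T - δ) T ×ˢ univ
    have hSm : MeasurableSet S := measurableSet_Ico.prod MeasurableSet.univ
    have hm : AEMeasurable (fun z => energy G (f n z)) (muT T) :=
      hcE.measurable.comp_aemeasurable (hf.aemeasurable n)
    have hle : ∀ᵐ z ∂(muT T), ψ z * (energy G (f n z) - ∫ s, energy G s ∂(ν z))
        ≤ S.indicator (fun z => energy G (f n z)) z := by
      filter_upwards [ae_muT_mem_Ioo T] with z hz
      have e0 : 0 ≤ ∫ s, energy G s ∂(ν z) := integral_nonneg fun s => hG.energy_nonneg s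
      have e1 := hG.energy_nonneg (f n z)
      have e2 := mul_nonneg (hψ0 z) e0
      by_cases h : z ∈ S
      · rw [indicator_of_mem h]
        nlinarith [mul_le_mul_of_nonneg_right (hψ1 z) e1]
      · rw [indicator_of_notMem h, hψe z, zero_mul]
        by_contra hc
        push Not at hc
        exact h ⟨⟨hc.le, hz.2⟩, mem_univ _⟩
    have hCS := hC n _ (measurableSet_Ico : MeasurableSet (Ico (T - δ) T))
    rw [Real.volume_Ico, sub_sub_cancel] at hCS
    have hfin : (C : ℝ≥0∞) * ENNReal.ofReal δ ≠ ⊤ :=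
      ENNReal.mul_ne_top ENNReal.coe_ne_top ENNReal.ofReal_ne_top
    have hi : IntegrableOn (fun z => energy G (f n z)) S (muT T) := by
      refine ⟨hm.aestronglyMeasurable.restrict, ?_⟩
      rw [hasFiniteIntegral_iff_ofReal (Eventually.of_forall fun z => hG.energy_nonneg _)]
      exact hCS.trans_lt hfin.lt_top
    have h2 : ∫ z, S.indicator (fun z => energy G (f n z)) z ∂(muT T) ≤ C * δ := by
      rw [integral_indicator hSm,
        integral_eq_lintegral_of_nonneg_ae (Eventually.of_forall fun z => hG.energy_nonneg _)
          hm.aestronglyMeasurable.restrict]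
      refine (ENNReal.toReal_mono hfin hCS).trans_eq ?_
      rw [ENNReal.toReal_mul, ENNReal.toReal_ofReal hδ.le, ENNReal.coe_toReal]
    refine le_trans ?_ h2
    -- Without integrability the integral takes the value `0`, which is below the bound as well.
    by_cases hint : Integrable (fun z => ψ z * (energy G (f n z) - ∫ s, energy G s ∂(ν z))) (muT T)
    · exact integral_mono_ae hint ((integrable_indicator_iff hSm).2 hi) hle
    · rw [integral_undef hint]
      exact integral_nonneg fun z => indicator_nonneg (fun z _ => hG.energy_nonneg _) z
  have h0 : γ.real ({T} ×ˢ univ) ≤ 0 := by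
    have hlim : Tendsto (fun δ : ℝ => (C : ℝ) * δ) (𝓝[>] 0) (𝓝 0) := by
      have : Tendsto (fun δ : ℝ => (C : ℝ) * δ) (𝓝 0) (𝓝 (C * 0)) :=
        tendsto_id.const_mul _
      rw [mul_zero] at this
      exact this.mono_left nhdsWithin_le_nhds
    exact ge_of_tendsto hlim (eventually_nhdsWithin_of_forall fun δ hδ => key δ hδ)
  have h1 := le_antisymm h0 measureReal_nonneg
  rwa [measureReal_eq_zero_iff] at h1

end

/-! ### Bounded Lipschitz functions on space-time -/

section

variable {E E' : Type*} [NormedAddCommGroup E] [NormedSpace ℝ E] [FiniteDimensional ℝ E]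
  [NormedAddCommGroup E'] [NormedSpace ℝ E']

/-- Bounded Lipschitz functions on space-time. -/
def BddLip {E : Type*} [NormedAddCommGroup E] (f : ℝ × Torus → E) : Prop :=
  (∃ K, LipschitzWith K f) ∧ ∃ C, ∀ z, ‖f z‖ ≤ C

theorem BddLip.comp {g : E → E'} (hg : ContDiff ℝ 1 g) {f : ℝ × Torus → E} (hf : BddLip f) :
    BddLip fun z => g (f z) := by
  obtain ⟨⟨K, hK⟩, C, hC⟩ := hf
  have hmem : ∀ z, f z ∈ Metric.closedBall (0 : E) C := fun z => by simpa using hC z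
  have := FiniteDimensional.proper ℝ E
  obtain ⟨L, hL⟩ := hg.contDiffOn.exists_lipschitzOnWith (s := Metric.closedBall (0 : E) C)
    (by norm_num) (convex_closedBall _ _) (isCompact_closedBall _ _)
  obtain ⟨D, hD⟩ := (isCompact_closedBall (0 : E) C).exists_bound_of_continuousOn
    hg.continuous.continuousOn
  refine ⟨⟨L * K, LipschitzWith.of_dist_le_mul fun z z' => ?_⟩, D, fun z => hD _ (hmem z)⟩
  refine (hL.dist_le_mul _ (hmem z) _ (hmem z')).trans ?_
  rw [NNReal.coe_mul, mul_assoc]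
  exact mul_le_mul_of_nonneg_left (hK.dist_le_mul _ _) L.2

omit [NormedSpace ℝ E] [FiniteDimensional ℝ E] [NormedSpace ℝ E'] in
theorem BddLip.prodMk {f : ℝ × Torus → E} {g : ℝ × Torus → E'} (hf : BddLip f) (hg : BddLip g) :
    BddLip fun z => (f z, g z) := by
  obtain ⟨⟨K, hK⟩, C, hC⟩ := hf
  obtain ⟨⟨L, hL⟩, D, hD⟩ := hg
  exact ⟨⟨_, hK.prodMk hL⟩, max C D, fun z => max_le_max (hC z) (hD z)⟩

theorem BddLip.smul {c : ℝ × Torus → ℝ} {f : ℝ × Torus → E} (hc : BddLip c) (hf : BddLip f) :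
    BddLip fun z => c z • f z :=
  (hc.prodMk hf).comp (g := fun q : ℝ × E => q.1 • q.2) (contDiff_fst.smul contDiff_snd)

theorem BddLip.mul {b c : ℝ × Torus → ℝ} (hb : BddLip b) (hc : BddLip c) :
    BddLip fun z => b z * c z := hb.smul hc

theorem BddLip.clm_comp (L : E →L[ℝ] E') {f : ℝ × Torus → E} (hf : BddLip f) :
    BddLip fun z => L (f z) := hf.comp L.contDiff

theorem BddLip.ae_hasDirDeriv {f : ℝ × Torus → E} (hf : BddLip f) (e : Cover) (T : ℝ) :
    ∀ᵐ z ∂(muT T), HasDirDeriv e f (dirDeriv e f z) z :=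
  ae_muT (PolyconvexElasticity.ae_hasDirDeriv hf.1.choose_spec e)

theorem BddLip.integrable_smul {f : ℝ × Torus → ℝ} (hf : BddLip f) {T : ℝ} {b : ℝ × Torus → E'}
    (hb : Integrable b (muT T)) : Integrable (fun z => f z • b z) (muT T) := by
  obtain ⟨⟨K, hK⟩, C, hC⟩ := hf
  exact hb.bdd_smul C hK.continuous.aestronglyMeasurable (Eventually.of_forall hC)

omit [NormedSpace ℝ E] [FiniteDimensional ℝ E] in
theorem BddLip.integrable {f : ℝ × Torus → E} (hf : BddLip f) (T : ℝ) :
    Integrable f (muT T) := by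
  obtain ⟨⟨K, hK⟩, C, hC⟩ := hf
  exact integrable_of_bounded hK.continuous.aestronglyMeasurable hC

theorem BddLip.integrable_dirDeriv {f : ℝ × Torus → E} (hf : BddLip f) (e : Cover) (T : ℝ) :
    Integrable (dirDeriv e f) (muT T) :=
  PolyconvexElasticity.integrable_dirDeriv hf.1.choose_spec e T

theorem BddLip.integrable_dirDeriv_smul {f : ℝ × Torus → ℝ} (hf : BddLip f) (e : Cover) {T : ℝ}
    {b : ℝ × Torus → E'} (hb : Integrable b (muT T)) :
    Integrable (fun z => dirDeriv e f z • b z) (muT T) :=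
  PolyconvexElasticity.integrable_dirDeriv_smul hf.1.choose_spec e hb

theorem IsLipschitzTest.bddLip {T : ℝ} {ψ : ℝ × Torus → ℝ} (h : IsLipschitzTest T ψ) : BddLip ψ :=
  ⟨h.lipschitz, h.bounded⟩

theorem integral_by_parts_space {ψ : ℝ × Torus → ℝ} {f : ℝ × Torus → E} (hψ : BddLip ψ)
    (hf : BddLip f) (α : Fin 3) (T : ℝ) :
    ∫ z, dirDeriv (spaceDir α) ψ z • f z ∂(muT T)
      = -∫ z, ψ z • dirDeriv (spaceDir α) f z ∂(muT T) := by
  obtain ⟨⟨K, hK⟩, C, hC⟩ := hψ.smul hf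
  have h := integral_dirDeriv_space hK hC α T
  have h1 : ∀ᵐ z ∂(muT T), dirDeriv (spaceDir α) (fun z => ψ z • f z) z
      = ψ z • dirDeriv (spaceDir α) f z + dirDeriv (spaceDir α) ψ z • f z := by
    filter_upwards [hψ.ae_hasDirDeriv (spaceDir α) T, hf.ae_hasDirDeriv (spaceDir α) T]
      with z h1 h2
    exact (h1.smul h2).dirDeriv_eq
  rw [integral_congr_ae h1, integral_add (hψ.integrable_smul (hf.integrable_dirDeriv _ T))
    (hψ.integrable_dirDeriv_smul _ (hf.integrable T))] at h
  exact eq_neg_of_add_eq_zero_right h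

theorem integral_by_parts_time {T : ℝ} (hT : 0 < T) {ψ : ℝ × Torus → ℝ} {f : ℝ × Torus → E}
    (hψ : IsLipschitzTest T ψ) (hf : BddLip f) :
    ∫ z, dirDeriv timeDir ψ z • f z ∂(muT T)
      = -(∫ x, ψ (0, x) • f (0, x)) - ∫ z, ψ z • dirDeriv timeDir f z ∂(muT T) := by
  obtain ⟨⟨K, hK⟩, C, hC⟩ := hψ.bddLip.smul hf
  obtain ⟨b, hb, hlate⟩ := hψ.late
  have h := integral_dirDeriv_time hK hC hT hb fun t x ht => by rw [hlate t x ht, zero_smul]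
  have h1 : ∀ᵐ z ∂(muT T), dirDeriv timeDir (fun z => ψ z • f z) z
      = ψ z • dirDeriv timeDir f z + dirDeriv timeDir ψ z • f z := by
    filter_upwards [hψ.bddLip.ae_hasDirDeriv timeDir T, hf.ae_hasDirDeriv timeDir T]
      with z h1 h2
    exact (h1.smul h2).dirDeriv_eq
  rw [integral_congr_ae h1, integral_add (hψ.bddLip.integrable_smul (hf.integrable_dirDeriv _ T))
    (hψ.bddLip.integrable_dirDeriv_smul _ (hf.integrable T))] at h
  rw [← h]
  abel

/-- The difference of a weak solution and a Lipschitz solution of a system of conservation laws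
with the same initial values satisfies the difference of the equations weakly, without initial
term and with Lipschitz test functions. -/
theorem weak_difference {T : ℝ} (hT : 0 < T) {a a' : ℝ × Torus → E} {a₀ : Torus → E}
    {b b' : Fin 3 → ℝ × Torus → E} (ha : Integrable a (muT T)) (hb : ∀ α, Integrable (b α) (muT T))
    (ha' : BddLip a') (hb' : ∀ α, BddLip (b' α))
    (hweak : ∀ ψ, IsTestFunction T ψ → (∫ x, ψ (0, x) • a₀ x)
      + ∫ z, dirDeriv timeDir ψ z • a z ∂(muT T)
        = ∫ z, (∑ α, dirDeriv (spaceDir α) ψ z • b α z) ∂(muT T))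
    (hstrong : ∀ᵐ z ∂(muT T), dirDeriv timeDir a' z = ∑ α, dirDeriv (spaceDir α) (b' α) z)
    (hinit : ∀ᵐ x, a₀ x = a' (0, x)) {ψ : ℝ × Torus → ℝ} (hψ : IsLipschitzTest T ψ) :
    ∫ z, dirDeriv timeDir ψ z • (a z - a' z) ∂(muT T)
      = ∑ α, ∫ z, dirDeriv (spaceDir α) ψ z • (b α z - b' α z) ∂(muT T) := by
  have key := weak_identity_of_smooth (T := T) (E := E)
    (fun j : Option (Fin 3) => j.elim timeDir spaceDir)
    (b := fun j z => j.elim (a z - a' z) fun α => -(b α z - b' α z)) ?_ ?_ hψ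
  · simp only [Fintype.sum_option, Option.elim, smul_neg, integral_neg, Finset.sum_neg_distrib]
      at key
    rwa [← sub_eq_add_neg, sub_eq_zero] at key
  · rintro (_ | α)
    · exact ha.sub (ha'.integrable T)
    · exact ((hb α).sub ((hb' α).integrable T)).neg
  · intro ψ h1 h2
    have hB := h2.bddLip
    simp only [Fintype.sum_option, Option.elim, smul_neg, integral_neg, Finset.sum_neg_distrib]
    rw [← sub_eq_add_neg, sub_eq_zero]
    simp only [smul_sub]
    rw [integral_sub (hB.integrable_dirDeriv_smul _ ha)
      (hB.integrable_dirDeriv_smul _ (ha'.integrable T)), integral_by_parts_time hT h2 ha']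
    have e1 : ∀ α, ∫ z, (dirDeriv (spaceDir α) ψ z • b α z - dirDeriv (spaceDir α) ψ z • b' α z)
        ∂(muT T) = ∫ z, dirDeriv (spaceDir α) ψ z • b α z ∂(muT T)
          + ∫ z, ψ z • dirDeriv (spaceDir α) (b' α) z ∂(muT T) := fun α => by
      rw [integral_sub (hB.integrable_dirDeriv_smul _ (hb α))
        (hB.integrable_dirDeriv_smul _ ((hb' α).integrable T)),
        integral_by_parts_space hB (hb' α), sub_neg_eq_add]
    simp only [e1]
    have e2 := hweak ψ h1
    rw [integral_finsetSum _ fun α _ => hB.integrable_dirDeriv_smul _ (hb α)] at e2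
    have e3 : ∫ z, ψ z • dirDeriv timeDir a' z ∂(muT T)
        = ∑ α, ∫ z, ψ z • dirDeriv (spaceDir α) (b' α) z ∂(muT T) := by
      rw [← integral_finsetSum _ fun α _ =>
        hB.integrable_smul ((hb' α).integrable_dirDeriv (spaceDir α) T)]
      refine integral_congr_ae ?_
      filter_upwards [hstrong] with z hz
      rw [hz, Finset.smul_sum]
    have e4 : ∫ x, ψ (0, x) • a' (0, x) = ∫ x, ψ (0, x) • a₀ x := by
      refine integral_congr_ae ?_
      filter_upwards [hinit] with x hx
      rw [hx]
    rw [Finset.sum_add_distrib, ← e2, e3, e4]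
    abel

/-- Weak identities tested with scalar functions can be tested with covector fields. -/
theorem weak_identity_covector {ι : Type*} [Fintype ι] {T a : ℝ} (e : ι → Cover)
    {b : ι → ℝ × Torus → E} (hb : ∀ j, Integrable (b j) (muT T))
    (h : ∀ ψ, IsLipschitzTest T ψ → (∀ t x, t ≤ a → ψ (t, x) = 0) →
      ∑ j, ∫ z, dirDeriv (e j) ψ z • b j z ∂(muT T) = 0)
    {L : ℝ × Torus → E →L[ℝ] ℝ} (hL : BddLip L) {c : ℝ} (hc : c < T)
    (hlate : ∀ t x, c ≤ t → L (t, x) = 0) (hearly : ∀ t x, t ≤ a → L (t, x) = 0) :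
    ∑ j, ∫ z, dirDeriv (e j) L z (b j z) ∂(muT T) = 0 := by
  -- Expand the field in a basis of `E`, with one scalar test function for each coordinate.
  let B := Module.finBasis ℝ E
  let co : Fin (Module.finrank ℝ E) → E →L[ℝ] ℝ := fun k =>
    LinearMap.toContinuousLinearMap (B.coord k)
  let ψ : Fin (Module.finrank ℝ E) → ℝ × Torus → ℝ := fun k z => L z (B k)
  have hψB : ∀ k, BddLip (ψ k) := fun k =>
    BddLip.clm_comp (ContinuousLinearMap.apply ℝ ℝ (B k)) hL
  have hψ : ∀ k, IsLipschitzTest T (ψ k) := fun k =>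
    ⟨(hψB k).1, (hψB k).2, c, hc, fun t x ht => by simp [ψ, hlate t x ht]⟩
  have h1 : ∀ k, ∑ j, ∫ z, dirDeriv (e j) (ψ k) z • co k (b j z) ∂(muT T) = 0 := by
    intro k
    have := congrArg (co k) (h _ (hψ k) fun t x ht => by simp [ψ, hearly t x ht])
    rw [map_sum, map_zero] at this
    rw [← this]
    refine Finset.sum_congr rfl fun j _ => ?_
    rw [← ContinuousLinearMap.integral_comp_comm _ ((hψB k).integrable_dirDeriv_smul _ (hb j))]
    simp only [map_smul]
  have h2 : ∀ j, ∫ z, dirDeriv (e j) L z (b j z) ∂(muT T)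
      = ∑ k, ∫ z, dirDeriv (e j) (ψ k) z • co k (b j z) ∂(muT T) := by
    intro j
    rw [← integral_finsetSum _ fun k _ =>
      (hψB k).integrable_dirDeriv_smul _ ((co k).integrable_comp (hb j))]
    refine integral_congr_ae ?_
    filter_upwards [hL.ae_hasDirDeriv (e j) T] with z hz
    have h3 : ∀ k, dirDeriv (e j) (ψ k) z = dirDeriv (e j) L z (B k) := fun k =>
      (hz.clm_comp (ContinuousLinearMap.apply ℝ ℝ (B k))).dirDeriv_eq
    conv_lhs => rw [← B.sum_repr (b j z)]
    rw [map_sum]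
    refine Finset.sum_congr rfl fun k _ => ?_
    rw [h3, map_smul, smul_eq_mul, smul_eq_mul, mul_comm]
    rfl
  simp only [h2]
  rw [Finset.sum_comm]
  exact Finset.sum_eq_zero fun k _ => h1 k

end

/-- An integrable function which vanishes weakly against Lipschitz functions with compact support
in the open time interval vanishes almost everywhere. -/
theorem ae_eq_zero_of_forall_lipschitzTest {T : ℝ} {g : ℝ × Torus → ℝ} (hg : Integrable g (muT T))
    (h : ∀ ψ, IsLipschitzTest T ψ → (∃ a > 0, ∀ t x, t ≤ a → ψ (t, x) = 0) →
      ∫ z, ψ z * g z ∂(muT T) = 0) : g =ᵐ[muT T] 0 := by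
  have key : ∀ a > 0, ∀ᵐ z ∂(muT T), z.1 ∈ Icc a (T - a) → g z = 0 := by
    intro a ha
    set S : Set (ℝ × Torus) := Icc a (T - a) ×ˢ univ
    have hS : IsClosed S := isClosed_Icc.prod isClosed_univ
    have h0 : S.indicator g =ᵐ[muT T] 0 := by
      refine ae_eq_zero_of_forall_setIntegral_isClosed_eq_zero
        (hg.indicator hS.measurableSet) fun K hK => ?_
      rw [setIntegral_indicator hS.measurableSet]
      set K' := K ∩ S
      have hK' : IsClosed K' := hK.inter hS
      let δ : ℕ → ℝ := fun n => a / 2 * (1 / ((n : ℝ) + 1))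
      have hδ : ∀ n, 0 < δ n := fun n => by positivity
      have hδa : ∀ n, δ n ≤ a / 2 := fun n => by
        refine mul_le_of_le_one_right (by positivity) ?_
        rw [div_le_one (by positivity)]
        linarith [n.cast_nonneg (α := ℝ)]
      have hδ0 : Tendsto δ atTop (𝓝 0) := by
        have := (tendsto_one_div_add_atTop_nhds_zero_nat (𝕜 := ℝ)).const_mul (a / 2)
        rwa [mul_zero] at this
      let ψ : ℕ → ℝ × Torus → ℝ := fun n z => (thickenedIndicator (hδ n) K' z : ℝ)
      have hψ1 : ∀ n z, ‖ψ n z‖ ≤ 1 := fun n z => by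
        rw [Real.norm_of_nonneg (NNReal.coe_nonneg _)]
        exact_mod_cast thickenedIndicator_le_one (hδ n) K' z
      have hψ0 : ∀ n (t : ℝ) x, t ∉ Ioo (a / 2) (T - a / 2) → ψ n (t, x) = 0 := by
        intro n t x ht
        have : (t, x) ∉ Metric.thickening (δ n) K' := by
          rw [Metric.mem_thickening_iff]
          rintro ⟨z, hz, hd⟩
          have h1 : |t - z.1| < a / 2 := by
            refine lt_of_le_of_lt ?_ (hd.trans_le (hδa n))
            rw [← Real.dist_eq]
            exact le_max_left _ _
          rw [abs_lt] at h1
          have h2 : z.1 ∈ Icc a (T - a) := hz.2.1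
          exact ht ⟨by linarith [h2.1], by linarith [h2.2]⟩
        simp only [ψ]
        rw [thickenedIndicator_zero (hδ n) K' this, NNReal.coe_zero]
      have hψ : ∀ n, IsLipschitzTest T (ψ n) := fun n =>
        ⟨⟨_, LipschitzWith.of_dist_le_mul fun z z' =>
            (lipschitzWith_thickenedIndicator (hδ n) K').dist_le_mul z z'⟩,
          ⟨1, hψ1 n⟩, T - a / 2, by linarith, fun t x ht => hψ0 n t x fun h => by
            linarith [h.2]⟩
      have hz := fun n => h (ψ n) (hψ n) ⟨a / 2, by linarith, fun t x ht => hψ0 n t x fun h => by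
            linarith [h.1]⟩
      have hlim : Tendsto (fun n => ∫ z, ψ n z * g z ∂(muT T)) atTop
          (𝓝 (∫ z, K'.indicator g z ∂(muT T))) := by
        refine tendsto_integral_of_dominated_convergence (fun z => ‖g z‖) ?_ hg.norm ?_ ?_
        · intro n
          obtain ⟨K, hK⟩ := (hψ n).lipschitz
          exact hK.continuous.aestronglyMeasurable.mul hg.aestronglyMeasurable
        · intro n
          refine Eventually.of_forall fun z => ?_
          rw [norm_mul]
          exact mul_le_of_le_one_left (norm_nonneg _) (hψ1 n z)
        · refine Eventually.of_forall fun z => ?_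
          have h1 := tendsto_pi_nhds.1 (thickenedIndicator_tendsto_indicator_closure hδ hδ0 K') z
          rw [hK'.closure_eq] at h1
          have h2 := ((NNReal.continuous_coe.tendsto _).comp h1).mul_const (g z)
          have e : K'.indicator g z = ((K'.indicator (fun _ => (1 : ℝ≥0)) z : ℝ≥0) : ℝ) * g z := by
            by_cases hz : z ∈ K'
            · rw [indicator_of_mem hz, indicator_of_mem hz, NNReal.coe_one, one_mul]
            · rw [indicator_of_notMem hz, indicator_of_notMem hz, NNReal.coe_zero, zero_mul]
          rw [e]
          exact h2
      rw [← integral_indicator hK'.measurableSet]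
      exact tendsto_nhds_unique hlim (tendsto_const_nhds.congr fun n => (hz n).symm)
    filter_upwards [h0] with z hz hzS
    have : z ∈ S := ⟨hzS, mem_univ _⟩
    rwa [indicator_of_mem this] at hz
  have h1 : ∀ n : ℕ, ∀ᵐ z ∂(muT T),
      z.1 ∈ Icc (1 / ((n : ℝ) + 1)) (T - 1 / ((n : ℝ) + 1)) → g z = 0 :=
    fun n => key _ (by positivity)
  filter_upwards [ae_all_iff.2 h1, ae_muT_mem_Ioo T] with z hz hzT
  obtain ⟨n, hn⟩ := exists_nat_one_div_lt (lt_min hzT.1 (sub_pos.2 hzT.2))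
  exact hz n ⟨(hn.trans_le (min_le_left _ _)).le, by
    linarith [hn.trans_le (min_le_right z.1 (T - z.1))]⟩

/-! ### The Lipschitz solution -/

/-- A bounded Lipschitz map, defined for all times, which solves the equations on `Q_T`. The
equations are written with `dirDeriv`. -/
structure IsGlobalSolution (G : Ext → ℝ) (T : ℝ) (v : ℝ × Torus → Vec3) (F : ℝ × Torus → Mat3) :
    Prop where
  bddLip_v : BddLip v
  bddLip_F : BddLip F
  momentum : ∀ᵐ z ∂(muT T), ∀ i, dirDeriv timeDir (fun z => v z i) z
    = ∑ α, dirDeriv (spaceDir α) (fun z => stress G i α (Phi (F z))) z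
  transport : ∀ᵐ z ∂(muT T), dirDeriv timeDir (fun z => Phi (F z)) z
    = ∑ α, dirDeriv (spaceDir α) (fun z => nullFlux α (F z) (v z)) z

/-- The projection of space-time onto the closed cylinder `[0, T] × Q`. -/
def clampTime (T : ℝ) (z : ℝ × Torus) : ℝ × Torus := (max 0 (min T z.1), z.2)

theorem clampTime_mem {T : ℝ} (hT : 0 < T) (z : ℝ × Torus) : clampTime T z ∈ QTbar T :=
  ⟨⟨le_max_left _ _, max_le hT.le (min_le_left _ _)⟩, mem_univ _⟩

theorem clampTime_eq {T : ℝ} {z : ℝ × Torus} (hz : z.1 ∈ Icc 0 T) : clampTime T z = z := by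
  simp [clampTime, hz.1, hz.2]

theorem lipschitzWith_clampTime (T : ℝ) : LipschitzWith 1 (clampTime T) := by
  have h1 : LipschitzWith 1 fun z : ℝ × Torus => max 0 (min T z.1) :=
    (LipschitzWith.prod_fst.const_min T).const_max 0
  have h2 := h1.prodMk LipschitzWith.prod_snd
  rw [max_self] at h2
  exact h2

section

variable {E : Type*} [NormedAddCommGroup E] [NormedSpace ℝ E]

omit [NormedSpace ℝ E] in
theorem bddLip_clampTime {T : ℝ} (hT : 0 < T) {f : ℝ × Torus → E}
    (hf : ∃ K : ℝ≥0, LipschitzOnWith K f (QTbar T)) : BddLip fun z => f (clampTime T z) := by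
  obtain ⟨K, hK⟩ := hf
  have hc : IsCompact (QTbar T) := isCompact_Icc.prod isCompact_univ
  obtain ⟨C, hC⟩ := hc.exists_bound_of_continuousOn hK.continuousOn
  refine ⟨⟨K, LipschitzWith.of_dist_le_mul fun z z' => ?_⟩, C, fun z => hC _ (clampTime_mem hT z)⟩
  refine (hK.dist_le_mul _ (clampTime_mem hT z) _ (clampTime_mem hT z')).trans ?_
  refine mul_le_mul_of_nonneg_left ?_ K.2
  simpa using (lipschitzWith_clampTime T).dist_le_mul z z'

theorem dt_clampTime {T : ℝ} (f : ℝ × Torus → E) {z : ℝ × Torus} (hz : z.1 ∈ Ioo 0 T) :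
    dirDeriv timeDir (fun z => f (clampTime T z)) z = dt f z := by
  rw [← dt_eq_dirDeriv]
  refine Filter.EventuallyEq.deriv_eq ?_
  filter_upwards [Ioo_mem_nhds hz.1 hz.2] with s hs
  rw [clampTime_eq (z := (s, z.2)) ⟨hs.1.le, hs.2.le⟩]

theorem dx_clampTime {T : ℝ} (f : ℝ × Torus → E) {z : ℝ × Torus} (hz : z.1 ∈ Ioo 0 T)
    (α : Fin 3) : dirDeriv (spaceDir α) (fun z => f (clampTime T z)) z = dx α f z := by
  rw [← dx_eq_dirDeriv]
  unfold dx
  congr 1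
  funext s
  beta_reduce
  rw [clampTime_eq (z := (z.1, z.2 + Pi.single α _)) ⟨hz.1.le, hz.2.le⟩]

end

theorem IsLipschitzSolution.clampTime {G : Ext → ℝ} {T : ℝ} (hT : 0 < T)
    {v : ℝ × Torus → Vec3} {F : ℝ × Torus → Mat3} (h : IsLipschitzSolution G T v F) :
    IsGlobalSolution G T (fun z => v (clampTime T z)) (fun z => F (clampTime T z)) where
  bddLip_v := bddLip_clampTime hT h.lipschitz_v
  bddLip_F := bddLip_clampTime hT h.lipschitz_F
  momentum := by
    filter_upwards [h.momentum, ae_muT_mem_Ioo T] with z hz hzT i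
    rw [dt_clampTime (fun z => v z i) hzT, hz i]
    exact Finset.sum_congr rfl fun α _ =>
      (dx_clampTime (fun z => stress G i α (Phi (F z))) hzT α).symm
  transport := by
    filter_upwards [h.transport, ae_muT_mem_Ioo T] with z hz hzT
    rw [dt_clampTime (fun z => Phi (F z)) hzT, hz]
    exact Finset.sum_congr rfl fun α _ =>
      (dx_clampTime (fun z => nullFlux α (F z) (v z)) hzT α).symm

theorem contDiff_nullFlux (α : Fin 3) : ContDiff ℝ 1 fun q : Mat3 × Vec3 => nullFlux α q.1 q.2 := by
  unfold nullFlux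
  refine ContDiff.sum fun i _ => ?_
  have h : ContDiff ℝ 1 fun q : Mat3 × Vec3 => q.2 i :=
    (EuclideanSpace.proj i : Vec3 →L[ℝ] ℝ).contDiff.comp contDiff_snd
  exact h.smul (((contDiff_dPhi i α).of_le le_top).comp contDiff_fst)

section

variable {G : Ext → ℝ} {p q r T : ℝ} {v' : ℝ × Torus → Vec3} {F' : ℝ × Torus → Mat3}

theorem IsGlobalSolution.bddLip_apply (h : IsGlobalSolution G T v' F') (i : Fin 3) :
    BddLip fun z => v' z i :=
  h.bddLip_v.clm_comp (EuclideanSpace.proj i : Vec3 →L[ℝ] ℝ)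

theorem IsGlobalSolution.bddLip_F_apply (h : IsGlobalSolution G T v' F') (k : Fin 3 × Fin 3) :
    BddLip fun z => F' z k :=
  h.bddLip_F.clm_comp (EuclideanSpace.proj k : Mat3 →L[ℝ] ℝ)

theorem IsGlobalSolution.bddLip_Phi (h : IsGlobalSolution G T v' F') :
    BddLip fun z => Phi (F' z) :=
  h.bddLip_F.comp (contDiff_Phi.of_le le_top)

theorem IsGlobalSolution.bddLip_stress (h : IsGlobalSolution G T v' F')
    (hG : StoredEnergy G p q r) (i α : Fin 3) :
    BddLip fun z => stress G i α (Phi (F' z)) :=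
  h.bddLip_Phi.comp ((hG.contDiff_stress i α).of_le (by norm_num))

theorem IsGlobalSolution.bddLip_nullFlux (h : IsGlobalSolution G T v' F') (α : Fin 3) :
    BddLip fun z => nullFlux α (F' z) (v' z) :=
  (h.bddLip_F.prodMk h.bddLip_v).comp (contDiff_nullFlux α)

theorem IsGlobalSolution.bddLip_fderiv (h : IsGlobalSolution G T v' F')
    (hG : StoredEnergy G p q r) : BddLip fun z => fderiv ℝ G (Phi (F' z)) :=
  h.bddLip_Phi.comp (hG.contDiff_fderiv.of_le (by norm_num))

end

/-! ### Integrability of the mean fields -/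

section

variable {G : Ext → ℝ} {p q r : ℝ} (hG : StoredEnergy G p q r) {T : ℝ}
  {v₀ : Torus → Vec3} {F₀ : Torus → Mat3} {y v : ℝ × Torus → Vec3} {F : ℝ × Torus → Mat3}
  {Ξ : ℝ × Torus → Ext} {ν : Kernel (ℝ × Torus) State}
  (hsol : IsMeasureValuedSolution G p T v₀ F₀ y v F Ξ ν)
include hG hsol

theorem IsMeasureValuedSolution.ae_mean : ∀ᵐ z ∂(muT T), Integrable (energy G) (ν z) ∧
    ∫ s, s ∂(ν z) = (v z, Phi (F z)) := by
  obtain ⟨f, hf⟩ := hsol.generated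
  have := hsol.markov
  filter_upwards [hG.ae_integrable_energy hf, hsol.mean_v, hsol.mean_Ξ, hsol.constraint]
    with z h1 h2 h3 h4
  refine ⟨h1, ?_⟩
  have hi := hG.integrable_id h1
  rw [h2, ← h4, h3]
  exact Prod.ext (fst_integral hi) (snd_integral hi)

theorem IsMeasureValuedSolution.integrable_pair :
    Integrable (fun z => (v z, Phi (F z))) (muT T) := by
  obtain ⟨f, hf⟩ := hsol.generated
  have := hsol.markov
  obtain ⟨C, hC, h⟩ := hG.norm_sq_le_energy
  refine (hG.integrable_mean hf continuous_id (C := C + 1) fun s => ?_).congr ?_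
  · have h1 := h s
    have h2 := hG.energy_nonneg s
    have h3 : ‖s‖ ≤ ‖s‖ ^ 2 + 1 := by nlinarith [sq_nonneg (‖s‖ - 1)]
    simp only [id]
    nlinarith
  · filter_upwards [hsol.ae_mean hG] with z hz
    exact hz.2

theorem IsMeasureValuedSolution.integrable_v_apply (i : Fin 3) :
    Integrable (fun z => v z i) (muT T) :=
  (EuclideanSpace.proj i : Vec3 →L[ℝ] ℝ).integrable_comp
    (hsol.integrable_pair hG).fst

theorem IsMeasureValuedSolution.integrable_Phi : Integrable (fun z => Phi (F z)) (muT T) :=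
  (hsol.integrable_pair hG).snd

theorem IsMeasureValuedSolution.integrable_F_apply (k : Fin 3 × Fin 3) :
    Integrable (fun z => F z k) (muT T) :=
  (EuclideanSpace.proj k : Mat3 →L[ℝ] ℝ).integrable_comp
    (hsol.integrable_Phi hG).fst

theorem IsMeasureValuedSolution.integrable_mean_stress (i α : Fin 3) :
    Integrable (fun z => ∫ s, stress G i α s.2 ∂(ν z)) (muT T) := by
  obtain ⟨f, hf⟩ := hsol.generated
  have := hsol.markov
  obtain ⟨C, hC, h⟩ := hG.stress_le i α
  obtain ⟨C', hC', h'⟩ := hG.growth_le_energy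
  refine hG.integrable_mean hf ((hG.contDiff_stress i α).continuous.comp continuous_snd)
    (C := C * C') fun s => (h s.2).trans ?_
  rw [mul_assoc]
  exact mul_le_mul_of_nonneg_left (h' s) hC

theorem IsMeasureValuedSolution.integrable_nullFlux (α : Fin 3) :
    Integrable (fun z => nullFlux α (F z) (v z)) (muT T) := by
  obtain ⟨f, hf⟩ := hsol.generated
  have := hsol.markov
  obtain ⟨C, hC, h⟩ := hG.norm_sq_le_energy
  have hF : AEStronglyMeasurable F (muT T) := (hsol.integrable_Phi hG).fst.aestronglyMeasurable
  refine integrable_finsetSum _ fun i _ => ?_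
  have hA := ((hG.integrable_mean_energy hf).add (integrable_const (1 : ℝ))).const_mul
    (‖dPhiLin i α‖ * C)
  have hB := (hsol.integrable_v_apply hG i).norm.mul_const ‖((elem i α, 0, 0) : Ext)‖
  refine (hA.add hB).mono' ((hsol.integrable_v_apply hG i).aestronglyMeasurable.smul
    ((contDiff_dPhi i α).continuous.comp_aestronglyMeasurable hF)) ?_
  filter_upwards [hsol.ae_mean hG] with z ⟨hz, hm⟩
  have h1 := hG.norm_mean_sub_sq_le hz 0
  simp only [sub_zero, hm] at h1
  have h2 : ∫ s, ‖s‖ ^ 2 ∂(ν z) ≤ C * (∫ s, energy G s ∂(ν z) + 1) := by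
    have e : C * (∫ s, energy G s ∂(ν z) + 1) = ∫ s, C * (energy G s + 1) ∂(ν z) := by
      rw [integral_const_mul, integral_add hz (integrable_const _)]
      simp
    rw [e]
    refine integral_mono ?_ ((hz.add (integrable_const 1)).const_mul C) h
    simpa using hG.integrable_norm_sub_sq hz 0
  have h3 : |v z i| * ‖Phi (F z)‖ ≤ ‖(v z, Phi (F z))‖ ^ 2 := by
    rw [sq]
    refine mul_le_mul ?_ (norm_snd_le (v z, Phi (F z))) (norm_nonneg _) (norm_nonneg _)
    exact (PiLp.norm_apply_le (v z) i).trans (norm_fst_le (v z, Phi (F z)))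
  rw [norm_smul, Real.norm_eq_abs, dPhi_eq]
  have h4 : ‖((elem i α, 0, 0) : Ext) + dPhiLin i α (Phi (F z))‖
      ≤ ‖((elem i α, 0, 0) : Ext)‖ + ‖dPhiLin i α‖ * ‖Phi (F z)‖ :=
    (norm_add_le _ _).trans (add_le_add le_rfl ((dPhiLin i α).le_opNorm _))
  have h5 := mul_le_mul_of_nonneg_left h4 (abs_nonneg (v z i))
  have h6 := mul_le_mul_of_nonneg_left (h3.trans (h1.trans h2)) (norm_nonneg (dPhiLin i α))
  simp only [Pi.add_apply, Real.norm_eq_abs]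
  linarith

end

/-! ### The equations for the difference of the solutions -/

theorem dPhi_sub (i α : Fin 3) (F F' : Mat3) :
    dPhi i α F - dPhi i α F' = dPhiLin i α (Phi F - Phi F') := by
  rw [dPhi_eq, dPhi_eq, map_sub]
  abel

theorem nullFlux_fst_apply (β : Fin 3) (F : Mat3) (v : Vec3) (k γ : Fin 3) :
    (nullFlux β F v).1 (k, γ) = if γ = β then v k else 0 := by
  have h : (nullFlux β F v).1 = ∑ i, v i • elem i β := by
    simp only [nullFlux, Prod.fst_sum, Prod.smul_fst, dPhi_apply]
  rw [h]
  by_cases h1 : γ = β <;> simp [elem_apply, h1]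

/-- A distributional gradient is weakly curl-free, also against Lipschitz test functions. -/
theorem HasDistribDerivs.curl_free {T : ℝ} {y v : ℝ × Torus → Vec3} {F : ℝ × Torus → Mat3}
    (hy : HasDistribDerivs T y v F) (hF : ∀ k, Integrable (fun z => F z k) (muT T))
    (k α β : Fin 3) {ψ : ℝ × Torus → ℝ} (hψ : IsLipschitzTest T ψ) {a : ℝ} (ha : 0 < a)
    (hearly : ∀ t x, t ≤ a → ψ (t, x) = 0) :
    ∫ z, dirDeriv (spaceDir β) ψ z • F z (k, α) ∂(muT T)
      = ∫ z, dirDeriv (spaceDir α) ψ z • F z (k, β) ∂(muT T) := by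
  obtain ⟨⟨K, hK⟩, ⟨C, hC⟩, b, hb, hlate⟩ := hψ
  -- The mollified test function is still supported in the open time interval, and its derivatives
  -- are admissible test functions for the gradient of `y`.
  set ε := min (a / 2) ((T - b) / 2)
  have hε : 0 < ε := lt_min (by linarith) (by linarith)
  have hε1 : ε ≤ a / 2 := min_le_left _ _
  have hε2 : ε ≤ (T - b) / 2 := min_le_right _ _
  refine tendsto_nhds_unique (tendsto_integral_dirDeriv_moll hK hC hε (spaceDir β) (hF (k, α)))
    ((tendsto_integral_dirDeriv_moll hK hC hε (spaceDir α) (hF (k, β))).congr fun n => ?_)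
  set φ := bumpSeq hε n
  have hφ : φ.rOut ≤ ε := bumpSeq_rOut_le hε n
  have hzero : ∀ α t x, (t ≤ a ∨ b ≤ t) → dirDeriv (spaceDir α) ψ (t, x) = 0 := by
    intro α t x ht
    have : (fun s : ℝ => ψ ((t, x) + proj (s • spaceDir α))) = fun _ => 0 := funext fun s => by
      rw [proj_smul_spaceDir, Prod.mk_add_mk, add_zero]
      exact ht.elim (hearly _ _) (hlate _ _)
    rw [dirDeriv, this, deriv_const]
  have htest : ∀ α, IsInteriorTestFunction T (dirDeriv (spaceDir α) (moll φ ψ)) := by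
    intro α
    rw [dirDeriv_moll φ hK hC]
    refine ⟨(isTestFunction_moll φ (measurable_dirDeriv hK.continuous _) (norm_dirDeriv_le hK _)
      (fun t x ht => hzero α t x (Or.inr ht)) (by linarith)).1, a / 2, by linarith,
      fun t x ht => ?_⟩
    exact moll_eq_zero_of_le φ (fun t x ht => hzero α t x (Or.inl ht)) hφ t x (by linarith)
  have h1 := hy.space _ (htest β) k α
  have h2 := hy.space _ (htest α) k β
  rw [dx_eq_dirDeriv, dirDeriv_comm (contDiff_moll φ hK.continuous.measurable hC 2)] at h1
  rw [dx_eq_dirDeriv, h1, neg_inj] at h2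
  simp only [smul_eq_mul, mul_comm (dirDeriv _ _ _)]
  exact h2.symm

section

variable {G : Ext → ℝ} {p q r : ℝ} (hG : StoredEnergy G p q r) {T : ℝ} (hT : 0 < T)
  {v₀ : Torus → Vec3} {F₀ : Torus → Mat3} {y v : ℝ × Torus → Vec3} {F : ℝ × Torus → Mat3}
  {Ξ : ℝ × Torus → Ext} {ν : Kernel (ℝ × Torus) State}
  (hsol : IsMeasureValuedSolution G p T v₀ F₀ y v F Ξ ν)
  {v' : ℝ × Torus → Vec3} {F' : ℝ × Torus → Mat3} (hlip : IsGlobalSolution G T v' F')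
include hG hT hsol hlip

theorem momentum_difference (hv₀ : ∀ᵐ x : Torus, v₀ x = v' (0, x)) (i : Fin 3)
    {ψ : ℝ × Torus → ℝ} (hψ : IsLipschitzTest T ψ) :
    ∫ z, dirDeriv timeDir ψ z • (v z i - v' z i) ∂(muT T)
      = ∑ α, ∫ z, dirDeriv (spaceDir α) ψ z •
          (∫ s, stress G i α s.2 ∂(ν z) - stress G i α (Phi (F' z))) ∂(muT T) := by
  refine weak_difference hT (a₀ := fun x => v₀ x i) (hsol.integrable_v_apply hG i)
    (fun α => hsol.integrable_mean_stress hG i α) (hlip.bddLip_apply i)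
    (fun α => hlip.bddLip_stress hG i α) (fun ψ hψ => ?_) ?_ ?_ hψ
  · have := hsol.momentum ψ hψ i
    simp only [dx_eq_dirDeriv, dt_eq_dirDeriv] at this
    simpa only [smul_eq_mul, mul_comm] using this
  · filter_upwards [hlip.momentum] with z hz
    exact hz i
  · filter_upwards [hv₀] with x hx
    rw [hx]

variable (hF₀ : ∀ᵐ x : Torus, Phi (F₀ x) = Phi (F' (0, x)))
include hF₀

theorem transport_difference {ψ : ℝ × Torus → ℝ} (hψ : IsLipschitzTest T ψ) :
    ∫ z, dirDeriv timeDir ψ z • (Phi (F z) - Phi (F' z)) ∂(muT T)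
      = ∑ α, ∫ z, dirDeriv (spaceDir α) ψ z •
          (nullFlux α (F z) (v z) - nullFlux α (F' z) (v' z)) ∂(muT T) := by
  refine weak_difference hT (a₀ := fun x => Phi (F₀ x)) (hsol.integrable_Phi hG)
    (fun α => hsol.integrable_nullFlux hG α) hlip.bddLip_Phi hlip.bddLip_nullFlux
    (fun ψ hψ => ?_) hlip.transport hF₀ hψ
  have := hsol.transport ψ hψ
  simpa only [dx_eq_dirDeriv, dt_eq_dirDeriv] using this

/-- Weak Piola identity for the difference: it is propagated in time by the transport equations,
since the second derivatives of `Φ` are antisymmetric. -/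
theorem piola_difference (i : Fin 3) {χ : ℝ × Torus → ℝ} (hχ : IsLipschitzTest T χ) {a : ℝ}
    (hearly : ∀ t x, t ≤ a → χ (t, x) = 0) :
    ∑ α, ∫ z, dirDeriv (spaceDir α) χ z • dPhiLin i α (Phi (F z) - Phi (F' z)) ∂(muT T) = 0 := by
  refine divergence_free_of_transport
    (N := fun β z => nullFlux β (F z) (v z) - nullFlux β (F' z) (v' z))
    ((hsol.integrable_Phi hG).sub (hlip.bddLip_Phi.integrable T))
    (fun β => (hsol.integrable_nullFlux hG β).sub ((hlip.bddLip_nullFlux β).integrable T))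
    (fun ψ _ hψ => transport_difference hG hT hsol hlip hF₀ hψ) (dPhiLin i)
    (Eventually.of_forall fun z α β => ?_) hχ hearly
  have h : ∀ (F : Mat3) (v : Vec3),
      dPhiLin i α (nullFlux β F v) = -dPhiLin i β (nullFlux α F v) := by
    intro F v
    simp only [nullFlux, map_sum, map_smul, ← Finset.sum_neg_distrib]
    refine Finset.sum_congr rfl fun k _ => ?_
    rw [dPhiLin_dPhi_antisymm, smul_neg]
  rw [map_sub, map_sub, h, h]
  abel

theorem curl_difference (k α β : Fin 3) {χ : ℝ × Torus → ℝ} (hχ : IsLipschitzTest T χ) {a : ℝ}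
    (hearly : ∀ t x, t ≤ a → χ (t, x) = 0) :
    ∫ z, dirDeriv (spaceDir β) χ z • (F z (k, α) - F' z (k, α)) ∂(muT T)
      = ∫ z, dirDeriv (spaceDir α) χ z • (F z (k, β) - F' z (k, β)) ∂(muT T) := by
  let c : Fin 3 → Ext →L[ℝ] ℝ := fun γ =>
    (EuclideanSpace.proj (k, γ) : Mat3 →L[ℝ] ℝ).comp
      (ContinuousLinearMap.fst ℝ Mat3 (Mat3 × ℝ))
  have hc : ∀ γ X, c γ X = X.1 (k, γ) := fun γ X => rfl
  have key := divergence_free_of_transport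
    (N := fun β z => nullFlux β (F z) (v z) - nullFlux β (F' z) (v' z))
    ((hsol.integrable_Phi hG).sub (hlip.bddLip_Phi.integrable T))
    (fun β => (hsol.integrable_nullFlux hG β).sub ((hlip.bddLip_nullFlux β).integrable T))
    (fun ψ _ hψ => transport_difference hG hT hsol hlip hF₀ hψ)
    -- The coefficients for which the divergence is the component `∂_β F_{kα} - ∂_α F_{kβ}` of the
    -- curl.
    (fun γ => (if γ = β then (1 : ℝ) else 0) • c α - (if γ = α then (1 : ℝ) else 0) • c β)
    (Eventually.of_forall fun z γ δ => ?_) hχ hearly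
  · have hi : ∀ γ δ, Integrable (fun z => dirDeriv (spaceDir γ) χ z •
        c δ (Phi (F z) - Phi (F' z))) (muT T) := fun γ δ =>
      hχ.bddLip.integrable_dirDeriv_smul _ ((c δ).integrable_comp
        ((hsol.integrable_Phi hG).sub (hlip.bddLip_Phi.integrable T)))
    have h1 : ∀ γ, ∫ z, dirDeriv (spaceDir γ) χ z •
        ((if γ = β then (1 : ℝ) else 0) • c α - (if γ = α then (1 : ℝ) else 0) • c β)
          (Phi (F z) - Phi (F' z)) ∂(muT T)
        = (if γ = β then ∫ z, dirDeriv (spaceDir γ) χ z • c α (Phi (F z) - Phi (F' z)) ∂(muT T)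
            else 0)
          - (if γ = α then ∫ z, dirDeriv (spaceDir γ) χ z • c β (Phi (F z) - Phi (F' z)) ∂(muT T)
            else 0) := by
      intro γ
      have e : ∀ z, dirDeriv (spaceDir γ) χ z •
        ((if γ = β then (1 : ℝ) else 0) • c α - (if γ = α then (1 : ℝ) else 0) • c β)
          (Phi (F z) - Phi (F' z))
        = (if γ = β then (1 : ℝ) else 0) • (dirDeriv (spaceDir γ) χ z •
            c α (Phi (F z) - Phi (F' z)))
          - (if γ = α then (1 : ℝ) else 0) • (dirDeriv (spaceDir γ) χ z •
            c β (Phi (F z) - Phi (F' z))) := fun z => by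
        simp only [sub_apply, smul_apply, smul_eq_mul]
        ring
      simp only [e]
      have hs : ∀ (m : ℝ) δ, Integrable (fun z => m • (dirDeriv (spaceDir γ) χ z •
          c δ (Phi (F z) - Phi (F' z)))) (muT T) := fun m δ => (hi γ δ).smul m
      rw [integral_sub (hs _ _) (hs _ _), integral_smul, integral_smul]
      split_ifs <;> simp
    simp only [Pi.sub_apply, h1, Finset.sum_sub_distrib, Finset.sum_ite_eq', Finset.mem_univ,
      if_true] at key
    exact sub_eq_zero.1 key
  · simp only [sub_apply, smul_apply, hc, Prod.fst_sub,
      PiLp.sub_apply, nullFlux_fst_apply, smul_eq_mul]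
    by_cases h1 : γ = β <;> by_cases h2 : γ = α <;> by_cases h3 : δ = β <;> by_cases h4 : δ = α <;>
      simp_all [eq_comm]

/-- The Lipschitz solution inherits from the initial data that `F'` is a gradient. -/
theorem curl_free_lipschitz : ∀ᵐ z ∂(muT T), ∀ k α β,
    dirDeriv (spaceDir β) (fun z => F' z (k, α)) z
      = dirDeriv (spaceDir α) (fun z => F' z (k, β)) z := by
  simp only [ae_all_iff]
  intro k α β
  have hi := fun e k => (hlip.bddLip_F_apply k).integrable_dirDeriv e T
  have h0 := ae_eq_zero_of_forall_lipschitzTest ((hi (spaceDir β) (k, α)).sub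
    (hi (spaceDir α) (k, β))) fun ψ hψ ⟨a, ha, hearly⟩ => ?_
  · filter_upwards [h0] with z hz
    exact sub_eq_zero.1 hz
  · have hB := hψ.bddLip
    have hF := fun k => hsol.integrable_F_apply hG k
    have hF' := fun k => (hlip.bddLip_F_apply k).integrable T
    have e1 := hsol.derivs.curl_free hF k α β hψ ha hearly
    have e2 := curl_difference hG hT hsol hlip hF₀ k α β hψ hearly
    simp only [smul_sub] at e2
    rw [integral_sub (hB.integrable_dirDeriv_smul _ (hF _))
      (hB.integrable_dirDeriv_smul _ (hF' _)),
      integral_sub (hB.integrable_dirDeriv_smul _ (hF _))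
      (hB.integrable_dirDeriv_smul _ (hF' _)), e1,
      integral_by_parts_space hB (hlip.bddLip_F_apply _),
      integral_by_parts_space hB (hlip.bddLip_F_apply _)] at e2
    have e3 : ∀ z, ψ z * (dirDeriv (spaceDir β) (fun z => F' z (k, α))
        - dirDeriv (spaceDir α) (fun z => F' z (k, β))) z
        = ψ z • dirDeriv (spaceDir β) (fun z => F' z (k, α)) z
          - ψ z • dirDeriv (spaceDir α) (fun z => F' z (k, β)) z := fun z => by
      simp only [Pi.sub_apply, smul_eq_mul]
      ring
    simp only [e3]
    rw [integral_sub (hB.integrable_smul (hi _ _)) (hB.integrable_smul (hi _ _))]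
    linarith

/-- Piola's identity for the Lipschitz solution. -/
theorem piola_lipschitz : ∀ᵐ z ∂(muT T), ∀ i,
    ∑ α, dPhiLin i α (fderiv ℝ Phi (F' z) (dirDeriv (spaceDir α) F' z)) = 0 := by
  have hd : ∀ᵐ z ∂(muT T), ∀ α, HasDirDeriv (spaceDir α) F' (dirDeriv (spaceDir α) F' z) z :=
    ae_all_iff.2 fun α => hlip.bddLip_F.ae_hasDirDeriv (spaceDir α) T
  filter_upwards [curl_free_lipschitz hG hT hsol hlip hF₀, hd] with z hz hd i
  refine piola_algebra i _ _ fun k α β => ?_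
  have h1 : ∀ γ δ, dirDeriv (spaceDir γ) (fun z => F' z (k, δ)) z
      = dirDeriv (spaceDir γ) F' z (k, δ) := fun γ δ =>
    ((hd γ).clm_comp (EuclideanSpace.proj (k, δ) : Mat3 →L[ℝ] ℝ)).dirDeriv_eq
  rw [← h1, ← h1, hz]

end

/-! ### Weights depending on time only -/

/-- Test functions of time for the relative energy inequality. -/
structure IsTimeWeight (T : ℝ) (θ : ℝ → ℝ) : Prop where
  contDiff : ContDiff ℝ 1 θ
  early : ∃ a, ∀ t ≤ a, θ t = 0
  late : ∃ b < T, ∀ t, b ≤ t → θ t = 0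

/-- A weight which decays at the rate `C` and is positive up to time `b`. -/
theorem exists_timeWeight {T b : ℝ} (hb : b < T) (C : ℝ) :
    ∃ θ, IsTimeWeight T θ ∧ (∀ t, 0 ≤ θ t) ∧ (∀ t, 0 ≤ t → t < b → 0 < θ t) ∧
      ∀ t, 0 ≤ t → deriv θ t ≤ -C * θ t := by
  -- The smooth step is `1` near `[0, T]` and only serves to make the support bounded from below.
  let φ : ℝ → ℝ := fun t => Real.exp (-C * t) * expNegInvGlue (b - t)
  have hφ : ContDiff ℝ 1 φ :=
    (Real.contDiff_exp.comp (contDiff_const.mul contDiff_id)).mul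
      (expNegInvGlue.contDiff.comp (contDiff_const.sub contDiff_id))
  have hone : ∀ t : ℝ, -1 ≤ t → Real.smoothTransition (t + 2) = 1 := fun t ht =>
    Real.smoothTransition.one_of_one_le (by linarith)
  refine ⟨fun t => Real.smoothTransition (t + 2) * φ t, ⟨?_, ⟨-2, fun t ht => ?_⟩,
    b, hb, fun t ht => ?_⟩, fun t => ?_, fun t ht htb => ?_, fun t ht => ?_⟩
  · exact (Real.smoothTransition.contDiff.comp (contDiff_id.add contDiff_const)).mul hφ
  · rw [Real.smoothTransition.zero_of_nonpos (by linarith), zero_mul]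
  · simp only [φ]
    rw [expNegInvGlue.zero_of_nonpos (by linarith), mul_zero, mul_zero]
  · exact mul_nonneg (Real.smoothTransition.nonneg _)
      (mul_nonneg (Real.exp_pos _).le (expNegInvGlue.nonneg _))
  · simp only [φ]
    rw [hone t (by linarith), one_mul]
    exact mul_pos (Real.exp_pos _) (expNegInvGlue.pos_of_pos (by linarith))
  · have h1 : (fun t => Real.smoothTransition (t + 2) * φ t) =ᶠ[𝓝 t] φ := by
      filter_upwards [Ioi_mem_nhds (show (-1 : ℝ) < t by linarith)] with s hs
      rw [hone s (le_of_lt hs), one_mul]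
    have h0 : Real.smoothTransition (t + 2) * φ t = φ t := h1.eq_of_nhds
    rw [h1.deriv_eq]
    beta_reduce
    rw [h0]
    have h2 : HasDerivAt expNegInvGlue (deriv expNegInvGlue (b - t)) (b - t) :=
      ((expNegInvGlue.contDiff (n := 1)).differentiable one_ne_zero _).hasDerivAt
    have h3 := ((hasDerivAt_id t).const_mul (-C)).exp.mul
      (h2.comp t ((hasDerivAt_id t).const_sub b))
    have h4 : 0 ≤ deriv expNegInvGlue (b - t) := by
      exact expNegInvGlue.monotone.deriv_nonneg
    have h5 : deriv φ t = Real.exp (-C * t) * (-C * 1) * expNegInvGlue (b - t)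
        + Real.exp (-C * t) * (deriv expNegInvGlue (b - t) * -1) := h3.deriv
    rw [h5]
    have h6 := mul_nonneg (Real.exp_pos (-C * t)).le h4
    simp only [φ]
    linarith

section

variable {E : Type*} [NormedAddCommGroup E] [NormedSpace ℝ E] {T : ℝ} {θ : ℝ → ℝ}

theorem IsTimeWeight.bddLip (hθ : IsTimeWeight T θ) : BddLip fun z : ℝ × Torus => θ z.1 := by
  obtain ⟨a, ha⟩ := hθ.early
  obtain ⟨b, hb, hb'⟩ := hθ.late
  have hs : HasCompactSupport θ := by
    refine HasCompactSupport.intro (isCompact_Icc (a := a) (b := b)) fun t ht => ?_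
    by_contra h
    exact ht ⟨le_of_lt (not_le.1 fun h' => h (ha t h')), le_of_lt (not_le.1 fun h' => h (hb' t h'))⟩
  obtain ⟨K, hK⟩ := hθ.contDiff.lipschitzWith_of_hasCompactSupport hs one_ne_zero
  obtain ⟨C, hC⟩ := hs.exists_bound_of_continuous hθ.contDiff.continuous
  exact ⟨⟨K * 1, hK.comp LipschitzWith.prod_fst⟩, C, fun z => hC z.1⟩

theorem hasDirDeriv_time (hθ : IsTimeWeight T θ) (z : ℝ × Torus) :
    HasDirDeriv timeDir (fun z => θ z.1) (deriv θ z.1) z := by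
  have h := (hθ.contDiff.differentiable one_ne_zero z.1).hasDerivAt
  have h1 : HasDerivAt (fun s : ℝ => z.1 + s) 1 0 := (hasDerivAt_id 0).const_add _
  rw [← add_zero z.1] at h
  have h2 := h.comp (0 : ℝ) h1
  rw [mul_one, add_zero] at h2
  simp only [HasDirDeriv, proj_smul_timeDir, Prod.fst_add]
  exact h2

theorem hasDirDeriv_space (θ : ℝ → ℝ) (α : Fin 3) (z : ℝ × Torus) :
    HasDirDeriv (spaceDir α) (fun z => θ z.1) 0 z := by
  simpa [HasDirDeriv, proj_smul_spaceDir] using hasDerivAt_const (0 : ℝ) (θ z.1)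

theorem IsTimeWeight.integrable_mul (hθ : IsTimeWeight T θ) {b : ℝ × Torus → ℝ}
    (hb : Integrable b (muT T)) : Integrable (fun z => θ z.1 * b z) (muT T) :=
  hθ.bddLip.integrable_smul hb

theorem IsTimeWeight.integrable_deriv_mul (hθ : IsTimeWeight T θ) {b : ℝ × Torus → ℝ}
    (hb : Integrable b (muT T)) : Integrable (fun z => deriv θ z.1 * b z) (muT T) := by
  simpa only [(hasDirDeriv_time hθ _).dirDeriv_eq, smul_eq_mul] using
    hθ.bddLip.integrable_dirDeriv_smul timeDir hb

variable [FiniteDimensional ℝ E]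

theorem IsTimeWeight.ae_dirDeriv_time (hθ : IsTimeWeight T θ) {f : ℝ × Torus → E}
    (hf : BddLip f) : ∀ᵐ z ∂(muT T), dirDeriv timeDir (fun z => θ z.1 • f z) z
      = θ z.1 • dirDeriv timeDir f z + deriv θ z.1 • f z := by
  filter_upwards [hf.ae_hasDirDeriv timeDir T] with z hz
  exact ((hasDirDeriv_time hθ z).smul hz).dirDeriv_eq

theorem ae_dirDeriv_space (T : ℝ) (θ : ℝ → ℝ) {f : ℝ × Torus → E} (hf : BddLip f) (α : Fin 3) :
    ∀ᵐ z ∂(muT T), dirDeriv (spaceDir α) (fun z => θ z.1 • f z) z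
      = θ z.1 • dirDeriv (spaceDir α) f z := by
  filter_upwards [hf.ae_hasDirDeriv (spaceDir α) T] with z hz
  simpa using ((hasDirDeriv_space θ α z).smul hz).dirDeriv_eq

theorem BddLip.integrable_dirDeriv_apply {L : ℝ × Torus → E →L[ℝ] ℝ} (hL : BddLip L) (e : Cover)
    {b : ℝ × Torus → E} (hb : Integrable b (muT T)) :
    Integrable (fun z => dirDeriv e L z (b z)) (muT T) := by
  obtain ⟨K, hK⟩ := hL.1
  refine (hb.norm.const_mul (K * ‖e‖)).mono' ?_ (Eventually.of_forall fun z => ?_)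
  · exact (ContinuousLinearMap.id ℝ (E →L[ℝ] ℝ)).aestronglyMeasurable_comp₂
      (hL.integrable_dirDeriv e T).aestronglyMeasurable hb.aestronglyMeasurable
  · exact ((dirDeriv e L z).le_opNorm _).trans
      (mul_le_mul_of_nonneg_right (norm_dirDeriv_le hK e z) (norm_nonneg _))

omit [FiniteDimensional ℝ E] in
theorem BddLip.integrable_apply {L : ℝ × Torus → E →L[ℝ] ℝ} (hL : BddLip L)
    {b : ℝ × Torus → E} (hb : Integrable b (muT T)) :
    Integrable (fun z => L z (b z)) (muT T) := by
  obtain ⟨C, hC⟩ := hL.2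
  refine (hb.norm.const_mul C).mono' ?_ (Eventually.of_forall fun z => ?_)
  · exact (ContinuousLinearMap.id ℝ (E →L[ℝ] ℝ)).aestronglyMeasurable_comp₂
      (hL.integrable T).aestronglyMeasurable hb.aestronglyMeasurable
  · exact ((L z).le_opNorm _).trans (mul_le_mul_of_nonneg_right (hC z) (norm_nonneg _))

end

/-! ### The relative energy identity -/

section

variable {G : Ext → ℝ} {p q r : ℝ} (hG : StoredEnergy G p q r) {T : ℝ} (hT : 0 < T)
  {v₀ : Torus → Vec3} {F₀ : Torus → Mat3} {y v : ℝ × Torus → Vec3} {F : ℝ × Torus → Mat3}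
  {Ξ : ℝ × Torus → Ext} {ν : Kernel (ℝ × Torus) State}
  (hsol : IsMeasureValuedSolution G p T v₀ F₀ y v F Ξ ν)
  {v' : ℝ × Torus → Vec3} {F' : ℝ × Torus → Mat3} (hlip : IsGlobalSolution G T v' F')
  {θ : ℝ → ℝ} (hθ : IsTimeWeight T θ)
include hG hT hsol hlip hθ

theorem weighted_momentum (hv₀ : ∀ᵐ x : Torus, v₀ x = v' (0, x)) (i : Fin 3) :
    ∫ z, deriv θ z.1 * (v' z i * (v z i - v' z i)) ∂(muT T)
      = ∫ z, θ z.1 * (∑ α, dirDeriv (spaceDir α) (fun z => v' z i) z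
            * (∫ s, stress G i α s.2 ∂(ν z) - stress G i α (Phi (F' z)))
          - dirDeriv timeDir (fun z => v' z i) z * (v z i - v' z i)) ∂(muT T) := by
  have hv' := hlip.bddLip_apply i
  have hd : Integrable (fun z => v z i - v' z i) (muT T) :=
    (hsol.integrable_v_apply hG i).sub (hv'.integrable T)
  have h1 : Integrable (fun z => dirDeriv timeDir (fun z => v' z i) z * (v z i - v' z i))
      (muT T) := hv'.integrable_dirDeriv_smul timeDir hd
  have h2 : Integrable (fun z => v' z i * (v z i - v' z i)) (muT T) := hv'.integrable_smul hd
  have h3 : ∀ α, Integrable (fun z => dirDeriv (spaceDir α) (fun z => v' z i) z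
      * (∫ s, stress G i α s.2 ∂(ν z) - stress G i α (Phi (F' z)))) (muT T) := fun α =>
    hv'.integrable_dirDeriv_smul (spaceDir α) ((hsol.integrable_mean_stress hG i α).sub
      ((hlip.bddLip_stress hG i α).integrable T))
  obtain ⟨b, hb, hlate⟩ := hθ.late
  have hψB : BddLip fun z => θ z.1 • v' z i := hθ.bddLip.smul hv'
  have hψ : IsLipschitzTest T fun z => θ z.1 • v' z i :=
    ⟨hψB.1, hψB.2, b, hb, fun t x ht => by simp [hlate t ht]⟩
  have key := momentum_difference hG hT hsol hlip hv₀ i hψ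
  have e1 : ∫ z, dirDeriv timeDir (fun z => θ z.1 • v' z i) z • (v z i - v' z i) ∂(muT T)
      = ∫ z, θ z.1 * (dirDeriv timeDir (fun z => v' z i) z * (v z i - v' z i)) ∂(muT T)
        + ∫ z, deriv θ z.1 * (v' z i * (v z i - v' z i)) ∂(muT T) := by
    rw [← integral_add (hθ.integrable_mul h1)
      (hθ.integrable_deriv_mul h2)]
    refine integral_congr_ae ?_
    filter_upwards [hθ.ae_dirDeriv_time hv'] with z hz
    rw [hz]
    simp only [smul_eq_mul]
    ring
  have e2 : ∑ α, ∫ z, dirDeriv (spaceDir α) (fun z => θ z.1 • v' z i) z •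
        (∫ s, stress G i α s.2 ∂(ν z) - stress G i α (Phi (F' z))) ∂(muT T)
      = ∫ z, θ z.1 * (∑ α, dirDeriv (spaceDir α) (fun z => v' z i) z
            * (∫ s, stress G i α s.2 ∂(ν z) - stress G i α (Phi (F' z)))) ∂(muT T) := by
    simp only [Finset.mul_sum]
    rw [integral_finsetSum _ fun α _ =>
      hθ.integrable_mul (h3 α)]
    refine Finset.sum_congr rfl fun α _ => integral_congr_ae ?_
    filter_upwards [ae_dirDeriv_space T θ hv' α] with z hz
    rw [hz]
    simp only [smul_eq_mul]
    ring
  rw [e1, e2] at key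
  simp only [mul_sub (θ _)]
  rw [integral_sub (hθ.integrable_mul (integrable_finsetSum _ fun α _ => h3 α))
    (hθ.integrable_mul h1), ← key]
  ring

variable (hF₀ : ∀ᵐ x : Torus, Phi (F₀ x) = Phi (F' (0, x)))
include hF₀

theorem weighted_transport :
    ∫ z, deriv θ z.1 * fderiv ℝ G (Phi (F' z)) (Phi (F z) - Phi (F' z)) ∂(muT T)
      = ∫ z, θ z.1 * (∑ α, dirDeriv (spaceDir α) (fun z => fderiv ℝ G (Phi (F' z))) z
            (nullFlux α (F z) (v z) - nullFlux α (F' z) (v' z))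
          - dirDeriv timeDir (fun z => fderiv ℝ G (Phi (F' z))) z
            (Phi (F z) - Phi (F' z))) ∂(muT T) := by
  have hL := hlip.bddLip_fderiv hG
  have hd : Integrable (fun z => Phi (F z) - Phi (F' z)) (muT T) :=
    (hsol.integrable_Phi hG).sub (hlip.bddLip_Phi.integrable T)
  have hn : ∀ α, Integrable (fun z => nullFlux α (F z) (v z) - nullFlux α (F' z) (v' z)) (muT T) :=
    fun α => (hsol.integrable_nullFlux hG α).sub ((hlip.bddLip_nullFlux α).integrable T)
  obtain ⟨b, hb, hlate⟩ := hθ.late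
  obtain ⟨a, hearly⟩ := hθ.early
  have key := weak_identity_covector (T := T) (a := a) (E := Ext)
    (fun j : Option (Fin 3) => j.elim timeDir spaceDir)
    (b := fun j z => j.elim (Phi (F z) - Phi (F' z))
      fun α => -(nullFlux α (F z) (v z) - nullFlux α (F' z) (v' z))) ?_ ?_
    (hθ.bddLip.smul hL) hb (fun t x ht => by simp [hlate t ht])
    (fun t x ht => by simp [hearly t ht])
  rotate_left
  · rintro (_ | α)
    · exact hd
    · exact (hn α).neg
  · intro ψ hψ _
    have := transport_difference hG hT hsol hlip hF₀ hψ
    simp only [Fintype.sum_option, Option.elim, smul_neg, integral_neg, Finset.sum_neg_distrib]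
    rw [← sub_eq_add_neg, sub_eq_zero]
    exact this
  simp only [Fintype.sum_option, Option.elim, map_neg, integral_neg, Finset.sum_neg_distrib] at key
  rw [← sub_eq_add_neg, sub_eq_zero] at key
  have e1 : ∫ z, dirDeriv timeDir (fun z => θ z.1 • fderiv ℝ G (Phi (F' z))) z
        (Phi (F z) - Phi (F' z)) ∂(muT T)
      = ∫ z, θ z.1 * dirDeriv timeDir (fun z => fderiv ℝ G (Phi (F' z))) z
            (Phi (F z) - Phi (F' z)) ∂(muT T)
        + ∫ z, deriv θ z.1 * fderiv ℝ G (Phi (F' z)) (Phi (F z) - Phi (F' z)) ∂(muT T) := by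
    rw [← integral_add (hθ.integrable_mul (hL.integrable_dirDeriv_apply timeDir hd))
      (hθ.integrable_deriv_mul (hL.integrable_apply hd))]
    refine integral_congr_ae ?_
    filter_upwards [hθ.ae_dirDeriv_time hL] with z hz
    rw [hz]
    rfl
  have e2 : ∑ α, ∫ z, dirDeriv (spaceDir α) (fun z => θ z.1 • fderiv ℝ G (Phi (F' z))) z
        (nullFlux α (F z) (v z) - nullFlux α (F' z) (v' z)) ∂(muT T)
      = ∫ z, θ z.1 * (∑ α, dirDeriv (spaceDir α) (fun z => fderiv ℝ G (Phi (F' z))) z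
            (nullFlux α (F z) (v z) - nullFlux α (F' z) (v' z))) ∂(muT T) := by
    simp only [Finset.mul_sum]
    rw [integral_finsetSum _ fun α _ =>
      hθ.integrable_mul (hL.integrable_dirDeriv_apply (spaceDir α) (hn α))]
    refine Finset.sum_congr rfl fun α _ => integral_congr_ae ?_
    filter_upwards [ae_dirDeriv_space T θ hL α] with z hz
    rw [hz]
    rfl
  rw [e1, e2] at key
  simp only [mul_sub (θ _)]
  rw [integral_sub (hθ.integrable_mul (integrable_finsetSum _ fun α _ =>
    hL.integrable_dirDeriv_apply (spaceDir α) (hn α)))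
    (hθ.integrable_mul (hL.integrable_dirDeriv_apply timeDir hd)), ← key]
  ring

theorem weighted_piola (i : Fin 3) :
    ∫ z, θ z.1 * (∑ α, dirDeriv (spaceDir α) (fun z => v' z i • fderiv ℝ G (Phi (F' z))) z
      (dPhiLin i α (Phi (F z) - Phi (F' z)))) ∂(muT T) = 0 := by
  have hL := (hlip.bddLip_apply i).smul (hlip.bddLip_fderiv hG)
  have hd : ∀ α, Integrable (fun z => dPhiLin i α (Phi (F z) - Phi (F' z))) (muT T) :=
    fun α => (dPhiLin i α).integrable_comp
      ((hsol.integrable_Phi hG).sub (hlip.bddLip_Phi.integrable T))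
  obtain ⟨b, hb, hlate⟩ := hθ.late
  obtain ⟨a, hearly⟩ := hθ.early
  have key := weak_identity_covector (T := T) (a := a) (E := Ext) spaceDir hd
    (fun χ hχ hearly => piola_difference hG hT hsol hlip hF₀ i hχ hearly)
    (hθ.bddLip.smul hL) hb (fun t x ht => by simp [hlate t ht])
    (fun t x ht => by simp [hearly t ht])
  rw [← key]
  simp only [Finset.mul_sum]
  rw [integral_finsetSum _ fun α _ =>
    hθ.integrable_mul (hL.integrable_dirDeriv_apply (spaceDir α) (hd α))]
  refine Finset.sum_congr rfl fun α _ => integral_congr_ae ?_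
  filter_upwards [ae_dirDeriv_space T θ hL α] with z hz
  rw [hz]
  rfl

end

/-! ### The remainder in the relative energy identity -/

section

variable {G : Ext → ℝ} {p q r : ℝ} (hG : StoredEnergy G p q r)
include hG

/-- With the equations of the Lipschitz solution, all terms of first order cancel. Here `V i α`,
`X α`, `a` and `X₀` stand for `∂_α v'_i`, `∂_α Φ(F')`, `∂_t v'` and `∂_t Φ(F')`. -/
theorem StoredEnergy.remainder_identity (F F' : Mat3) (v v' : Vec3) (g V : Fin 3 → Fin 3 → ℝ)
    (X : Fin 3 → Ext) (a : Fin 3 → ℝ) (X₀ : Ext)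
    (ha : ∀ i, a i = ∑ α, fderiv ℝ (fderiv ℝ G) (Phi F') (X α) (dPhi i α F'))
    (hX₀ : X₀ = ∑ α, ∑ i, V i α • dPhi i α F') :
    (∑ i, (∑ α, V i α * (g i α - stress G i α (Phi F')) - a i * (v i - v' i)))
      + (∑ α, fderiv ℝ (fderiv ℝ G) (Phi F') (X α) (nullFlux α F v - nullFlux α F' v')
        - fderiv ℝ (fderiv ℝ G) (Phi F') X₀ (Phi F - Phi F'))
      - ∑ i, ∑ α, (v' i • fderiv ℝ (fderiv ℝ G) (Phi F') (X α) + V i α • fderiv ℝ G (Phi F'))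
          (dPhiLin i α (Phi F - Phi F'))
    = ∑ i, ∑ α, (V i α * (g i α - stress G i α (Phi F')
          - fderiv ℝ (stress G i α) (Phi F') (Phi F - Phi F'))
        + V i α * -fderiv ℝ G (Phi F')
          (dPhiLin i α (Phi F - Phi F' - fderiv ℝ Phi F' (F - F')))
        + (v i - v' i) * fderiv ℝ (fderiv ℝ G) (Phi F') (X α)
          (dPhiLin i α (Phi F - Phi F'))) := by
  set Y := Phi F - Phi F' with hY
  set B := fderiv ℝ (fderiv ℝ G) (Phi F') with hB
  have hY1 : Y.1 = F - F' := rfl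
  have e1 : ∑ α, B (X α) (nullFlux α F v - nullFlux α F' v')
      = ∑ i, ∑ α, (v i * B (X α) (dPhiLin i α Y) + (v i - v' i) * B (X α) (dPhi i α F')) := by
    rw [Finset.sum_comm]
    refine Finset.sum_congr rfl fun α _ => ?_
    have : nullFlux α F v - nullFlux α F' v'
        = ∑ i, (v i • dPhiLin i α Y + (v i - v' i) • dPhi i α F') := by
      simp only [nullFlux, ← Finset.sum_sub_distrib]
      refine Finset.sum_congr rfl fun i _ => ?_
      rw [← dPhi_sub, smul_sub, sub_smul]
      abel
    rw [this]
    simp only [map_sum, map_add, map_smul, smul_eq_mul]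
  have e2 : B X₀ Y = ∑ i, ∑ α, V i α * B Y (dPhi i α F') := by
    rw [hB, hG.fderiv_symm, ← hB, hX₀, Finset.sum_comm]
    simp only [map_sum, map_smul, smul_eq_mul]
  rw [e1, e2]
  simp only [ha, Finset.sum_mul, ← Finset.sum_sub_distrib, ← Finset.sum_add_distrib]
  refine Finset.sum_congr rfl fun i _ => Finset.sum_congr rfl fun α _ => ?_
  have e3 : ∀ D, fderiv ℝ G (Phi F') (dPhiLin i α (Y - D))
      = fderiv ℝ G (Phi F') (dPhiLin i α Y) - fderiv ℝ G (Phi F') (dPhiLin i α D) := fun D => by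
    rw [map_sub, map_sub]
  rw [hG.fderiv_stress, ← hB, hY1, e3]
  simp only [add_apply, smul_apply, smul_eq_mul]
  ring

variable {T : ℝ} {v' : ℝ × Torus → Vec3} {F' : ℝ × Torus → Mat3} (hlip : IsGlobalSolution G T v' F')
include hlip

theorem IsGlobalSolution.ae_dirDeriv_fderiv (e : Cover) : ∀ᵐ z ∂(muT T),
    dirDeriv e (fun z => fderiv ℝ G (Phi (F' z))) z
      = fderiv ℝ (fderiv ℝ G) (Phi (F' z)) (dirDeriv e (fun z => Phi (F' z)) z) := by
  filter_upwards [hlip.bddLip_Phi.ae_hasDirDeriv e T] with z hz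
  have h := ((hG.contDiff_fderiv.differentiable two_ne_zero) (Phi (F' z))).hasFDerivAt
  exact (HasDirDeriv.comp h hz).dirDeriv_eq

omit hG in
theorem IsGlobalSolution.ae_dirDeriv_Phi (e : Cover) : ∀ᵐ z ∂(muT T),
    dirDeriv e (fun z => Phi (F' z)) z = fderiv ℝ Phi (F' z) (dirDeriv e F' z) := by
  filter_upwards [hlip.bddLip_F.ae_hasDirDeriv e T] with z hz
  exact (HasDirDeriv.comp (differentiable_Phi (F' z)).hasFDerivAt hz).dirDeriv_eq

/-- The momentum equation in non-conservative form, by Piola's identity. -/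
theorem IsGlobalSolution.ae_momentum
    (hpiola : ∀ᵐ z ∂(muT T), ∀ i,
      ∑ α, dPhiLin i α (fderiv ℝ Phi (F' z) (dirDeriv (spaceDir α) F' z)) = 0) :
    ∀ᵐ z ∂(muT T), ∀ i, dirDeriv timeDir (fun z => v' z i) z
      = ∑ α, fderiv ℝ (fderiv ℝ G) (Phi (F' z)) (dirDeriv (spaceDir α) (fun z => Phi (F' z)) z)
          (dPhi i α (F' z)) := by
  filter_upwards [hlip.momentum, hpiola,
    ae_all_iff.2 fun α => hlip.ae_dirDeriv_Phi (spaceDir α),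
    ae_all_iff.2 fun α => hlip.bddLip_Phi.ae_hasDirDeriv (spaceDir α) T] with z hm hp hd hX i
  have h : ∀ α, dirDeriv (spaceDir α) (fun z => stress G i α (Phi (F' z))) z
      = fderiv ℝ (fderiv ℝ G) (Phi (F' z)) (dirDeriv (spaceDir α) (fun z => Phi (F' z)) z)
          (dPhi i α (F' z))
        + fderiv ℝ G (Phi (F' z))
          (dPhiLin i α (fderiv ℝ Phi (F' z) (dirDeriv (spaceDir α) F' z))) := fun α => by
    have h1 := (((hG.contDiff_stress i α).differentiable two_ne_zero) (Phi (F' z))).hasFDerivAt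
    rw [(HasDirDeriv.comp h1 (hX α)).dirDeriv_eq, hG.fderiv_stress, hd α, fderiv_Phi_fst]
  rw [hm i]
  simp only [h]
  rw [Finset.sum_add_distrib, ← map_sum, hp i, map_zero, add_zero]

omit hG in
/-- The transport equations in non-conservative form, by Piola's identity. -/
theorem IsGlobalSolution.ae_transport
    (hpiola : ∀ᵐ z ∂(muT T), ∀ i,
      ∑ α, dPhiLin i α (fderiv ℝ Phi (F' z) (dirDeriv (spaceDir α) F' z)) = 0) :
    ∀ᵐ z ∂(muT T), dirDeriv timeDir (fun z => Phi (F' z)) z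
      = ∑ α, ∑ i, dirDeriv (spaceDir α) (fun z => v' z i) z • dPhi i α (F' z) := by
  filter_upwards [hlip.transport, hpiola,
    ae_all_iff.2 fun α => hlip.bddLip_F.ae_hasDirDeriv (spaceDir α) T,
    ae_all_iff.2 fun i => ae_all_iff.2 fun α => (hlip.bddLip_apply i).ae_hasDirDeriv (spaceDir α) T]
    with z hm hp hF hv
  have h : ∀ α, dirDeriv (spaceDir α) (fun z => nullFlux α (F' z) (v' z)) z
      = ∑ i, v' z i • dPhiLin i α (fderiv ℝ Phi (F' z) (dirDeriv (spaceDir α) F' z))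
        + ∑ i, dirDeriv (spaceDir α) (fun z => v' z i) z • dPhi i α (F' z) := fun α => by
    rw [← Finset.sum_add_distrib]
    refine HasDirDeriv.dirDeriv_eq ?_
    exact HasDerivAt.fun_sum fun i _ =>
      (hv i α).smul (HasDirDeriv.comp (hasFDerivAt_dPhi i α (F' z)) (hF α))
  rw [hm]
  simp only [h]
  rw [Finset.sum_add_distrib, Finset.sum_comm]
  simp only [← Finset.smul_sum, hp, smul_zero, Finset.sum_const_zero, zero_add]

/-- The Lipschitz solution conserves energy. -/
theorem IsGlobalSolution.energy_conservation (hT : 0 < T)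
    (hpiola : ∀ᵐ z ∂(muT T), ∀ i,
      ∑ α, dPhiLin i α (fderiv ℝ Phi (F' z) (dirDeriv (spaceDir α) F' z)) = 0)
    {θ : ℝ → ℝ} (hθ : IsTimeWeight T θ) :
    ∫ z, deriv θ z.1 * energy G (v' z, Phi (F' z)) ∂(muT T)
      = -∫ x, θ 0 * energy G (v' (0, x), Phi (F' (0, x))) := by
  have hE : ContDiff ℝ 1 (energy G) :=
    ((contDiff_fst.norm_sq ℝ).div_const 2).add ((hG.smooth.of_le (by norm_num)).comp contDiff_snd)
  have hB : BddLip fun z => energy G (v' z, Phi (F' z)) :=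
    (hlip.bddLip_v.prodMk hlip.bddLip_Phi).comp hE
  obtain ⟨b, hb, hlate⟩ := hθ.late
  have hψ : IsLipschitzTest T fun z : ℝ × Torus => θ z.1 :=
    ⟨hθ.bddLip.1, hθ.bddLip.2, b, hb, fun t x ht => hlate t ht⟩
  have key := integral_by_parts_time hT hψ hB
  simp only [(hasDirDeriv_time hθ _).dirDeriv_eq, smul_eq_mul] at key
  rw [key, sub_eq_self]
  have hf : ∀ i α, BddLip fun z => v' z i * stress G i α (Phi (F' z)) := fun i α =>
    (hlip.bddLip_apply i).mul (hlip.bddLip_stress hG i α)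
  have h0 : ∀ i α, ∫ z, θ z.1 * dirDeriv (spaceDir α)
      (fun z => v' z i * stress G i α (Phi (F' z))) z ∂(muT T) = 0 := fun i α => by
    have := integral_by_parts_space hθ.bddLip (hf i α) α T
    simp only [(hasDirDeriv_space θ α _).dirDeriv_eq, smul_eq_mul, zero_mul, integral_zero] at this
    linarith
  have h1 : ∀ᵐ z ∂(muT T), θ z.1 * dirDeriv timeDir (fun z => energy G (v' z, Phi (F' z))) z
      = ∑ i, ∑ α, θ z.1 * dirDeriv (spaceDir α)
          (fun z => v' z i * stress G i α (Phi (F' z))) z := by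
    filter_upwards [hlip.momentum, hlip.ae_transport hpiola,
      hlip.bddLip_v.ae_hasDirDeriv timeDir T, hlip.bddLip_Phi.ae_hasDirDeriv timeDir T,
      ae_all_iff.2 fun i => ae_all_iff.2 fun α =>
        (hlip.bddLip_apply i).ae_hasDirDeriv (spaceDir α) T,
      ae_all_iff.2 fun i => ae_all_iff.2 fun α =>
        (hlip.bddLip_stress hG i α).ae_hasDirDeriv (spaceDir α) T] with z hm ht hv hP hvα hsα
    have h2 : HasDirDeriv timeDir (fun z => energy G (v' z, Phi (F' z)))
        (inner ℝ (v' z) (dirDeriv timeDir v' z)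
          + fderiv ℝ G (Phi (F' z)) (dirDeriv timeDir (fun z => Phi (F' z)) z)) z := by
      have h3 := (HasDerivAt.norm_sq hv).div_const 2
      have h4 := HasDirDeriv.comp (hG.differentiable (Phi (F' z))).hasFDerivAt hP
      simp only [zero_smul, proj_zero, add_zero] at h3
      rw [mul_div_cancel_left₀ _ two_ne_zero] at h3
      exact HasDerivAt.add h3 h4
    have h5 : ∀ i, dirDeriv timeDir v' z i = dirDeriv timeDir (fun z => v' z i) z := fun i =>
      (hv.clm_comp (EuclideanSpace.proj i : Vec3 →L[ℝ] ℝ)).dirDeriv_eq.symm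
    rw [h2.dirDeriv_eq, ht, PiLp.inner_apply]
    simp only [((hvα _ _).mul (hsα _ _)).dirDeriv_eq, h5, hm, map_sum, map_smul, smul_eq_mul,
      ← Finset.mul_sum]
    congr 1
    simp only [Finset.sum_add_distrib]
    congr 1
    · refine Finset.sum_congr rfl fun i _ => ?_
      rw [← Finset.mul_sum]
      exact mul_comm _ _
    · rw [Finset.sum_comm]
      rfl
  have hi : ∀ i α, Integrable (fun z => θ z.1 * dirDeriv (spaceDir α)
      (fun z => v' z i * stress G i α (Phi (F' z))) z) (muT T) := fun i α =>
    hθ.integrable_mul ((hf i α).integrable_dirDeriv (spaceDir α) T)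
  rw [integral_congr_ae h1,
    integral_finsetSum _ fun i _ => integrable_finsetSum _ fun α _ => hi i α]
  refine Finset.sum_eq_zero fun i _ => ?_
  rw [integral_finsetSum _ fun α _ => hi i α]
  exact Finset.sum_eq_zero fun α _ => h0 i α

end

/-! ### The relative energy inequality -/

/-- The averaged relative energy of a Young measure with respect to a state `(v', Φ(F'))`. -/
def meanRelEnergy (G : Ext → ℝ) (ν : Kernel (ℝ × Torus) State) (v' : ℝ × Torus → Vec3)
    (F' : ℝ × Torus → Mat3) (z : ℝ × Torus) : ℝ :=
  ∫ s, relEnergy G (v' z, Phi (F' z)) s ∂(ν z)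

section

variable {G : Ext → ℝ} {p q r : ℝ} (hG : StoredEnergy G p q r) {T : ℝ}
  {v₀ : Torus → Vec3} {F₀ : Torus → Mat3} {y v : ℝ × Torus → Vec3} {F : ℝ × Torus → Mat3}
  {Ξ : ℝ × Torus → Ext} {ν : Kernel (ℝ × Torus) State}
  (hsol : IsMeasureValuedSolution G p T v₀ F₀ y v F Ξ ν)
  {v' : ℝ × Torus → Vec3} {F' : ℝ × Torus → Mat3} (hlip : IsGlobalSolution G T v' F')
include hG

theorem meanRelEnergy_nonneg (z : ℝ × Torus) : 0 ≤ meanRelEnergy G ν v' F' z := by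
  obtain ⟨κ, hκ, h⟩ := hG.relEnergy_quadratic
  exact integral_nonneg fun s =>
    (mul_nonneg hκ.le (sq_nonneg ‖s - (v' z, Phi (F' z))‖)).trans (h _ s)

include hsol

theorem ae_meanRelEnergy_eq : ∀ᵐ z ∂(muT T), meanRelEnergy G ν v' F' z
    = ∫ s, energy G s ∂(ν z) - energy G (v' z, Phi (F' z))
      - (∑ i, v' z i * (v z i - v' z i)
        + fderiv ℝ G (Phi (F' z)) (Phi (F z) - Phi (F' z))) := by
  have := hsol.markov
  filter_upwards [hsol.ae_mean hG] with z ⟨hz, hm⟩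
  have hi := hG.integrable_id hz
  have h1 : ∫ s, s.1 ∂(ν z) = v z := by rw [← fst_integral hi, hm]
  have h2 : ∫ s, s.2 ∂(ν z) = Phi (F z) := by rw [← snd_integral hi, hm]
  rw [meanRelEnergy, hG.integral_relEnergy hz, h1, h2, PiLp.inner_apply]
  have h3 : ∀ i, inner ℝ (v' z i) ((v z - v' z) i) = v' z i * (v z i - v' z i) := fun i =>
    mul_comm _ _
  simp only [h3]
  ring

include hlip

theorem integrable_cross :
    Integrable (fun z => ∑ i, v' z i * (v z i - v' z i)
        + fderiv ℝ G (Phi (F' z)) (Phi (F z) - Phi (F' z))) (muT T) := by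
  refine (integrable_finsetSum _ fun i _ => ?_).add ?_
  · exact (hlip.bddLip_apply i).integrable_smul
      ((hsol.integrable_v_apply hG i).sub ((hlip.bddLip_apply i).integrable T))
  · exact (hlip.bddLip_fderiv hG).integrable_apply
      ((hsol.integrable_Phi hG).sub (hlip.bddLip_Phi.integrable T))

omit hsol in
theorem integrable_energy_lipschitz :
    Integrable (fun z => energy G (v' z, Phi (F' z))) (muT T) := by
  have hE : ContDiff ℝ 1 (energy G) :=
    ((contDiff_fst.norm_sq ℝ).div_const 2).add ((hG.smooth.of_le (by norm_num)).comp contDiff_snd)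
  exact ((hlip.bddLip_v.prodMk hlip.bddLip_Phi).comp hE).integrable T

theorem integrable_meanRelEnergy : Integrable (meanRelEnergy G ν v' F') (muT T) := by
  obtain ⟨f, hf⟩ := hsol.generated
  have := hsol.markov
  refine (((hG.integrable_mean_energy hf).sub (integrable_energy_lipschitz hG hlip)).sub
    (integrable_cross hG hsol hlip)).congr ?_
  filter_upwards [ae_meanRelEnergy_eq hG hsol (v' := v') (F' := F')] with z hz
  exact hz.symm

/-- Each term of the remainder is quadratic in the difference of the solutions: the first is
the averaged Taylor remainder of the stress, the second is controlled as the nonlinear parts of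
`Φ` are quadratic up to terms annihilated by `dPhiLin`, the third is a product of differences. -/
theorem remainder_term_le (i α : Fin 3) : ∃ C, ∀ᵐ z ∂(muT T),
    |dirDeriv (spaceDir α) (fun z => v' z i) z * (∫ s, stress G i α s.2 ∂(ν z)
          - stress G i α (Phi (F' z))
          - fderiv ℝ (stress G i α) (Phi (F' z)) (Phi (F z) - Phi (F' z)))
        + dirDeriv (spaceDir α) (fun z => v' z i) z * -fderiv ℝ G (Phi (F' z))
          (dPhiLin i α (Phi (F z) - Phi (F' z) - fderiv ℝ Phi (F' z) (F z - F' z)))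
        + (v z i - v' z i) * dirDeriv (spaceDir α) (fun z => fderiv ℝ G (Phi (F' z))) z
          (dPhiLin i α (Phi (F z) - Phi (F' z)))| ≤ C * meanRelEnergy G ν v' F' z := by
  have := hsol.markov
  obtain ⟨⟨K₁, hK₁⟩, -⟩ := hlip.bddLip_apply i
  obtain ⟨⟨K₂, hK₂⟩, D, hD⟩ := hlip.bddLip_fderiv hG
  obtain ⟨-, M, hM⟩ := hlip.bddLip_Phi
  obtain ⟨C₁, hC₁⟩ := hG.stress_mean_le i α M
  obtain ⟨C₂, hC₂, hmean⟩ := hG.norm_mean_sub_sq_le_relEnergy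
  set V := K₁ * ‖spaceDir α‖
  set B := K₂ * ‖spaceDir α‖
  refine ⟨V * C₁ + V * (D * (2 * C₂)) + B * ‖dPhiLin i α‖ * C₂, ?_⟩
  filter_upwards [hsol.ae_mean hG] with z ⟨hz, hm⟩
  have hi := hG.integrable_id hz
  have hm2 : ∫ s, s.2 ∂(ν z) = Phi (F z) := by rw [← snd_integral hi, hm]
  have h1 := hC₁ (ν z) hz (v' z, Phi (F' z)) (hM z)
  have h2 := hmean (ν z) hz (v' z, Phi (F' z))
  rw [hm] at h2
  rw [hm2] at h1
  change _ ≤ C₁ * meanRelEnergy G ν v' F' z at h1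
  change _ ≤ C₂ * meanRelEnergy G ν v' F' z at h2
  set N := ‖((v z, Phi (F z)) : State) - (v' z, Phi (F' z))‖
  have hN : 0 ≤ N := norm_nonneg _
  have hV := norm_dirDeriv_le hK₁ (spaceDir α) z
  have hB := norm_dirDeriv_le hK₂ (spaceDir α) z
  have hV0 : 0 ≤ V := (norm_nonneg _).trans hV
  have hB0 : 0 ≤ B := (norm_nonneg _).trans hB
  have hD0 : 0 ≤ D := (norm_nonneg _).trans (hD z)
  have hY : ‖Phi (F z) - Phi (F' z)‖ ≤ N :=
    norm_snd_le (((v z, Phi (F z)) : State) - (v' z, Phi (F' z)))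
  have hF : ‖F z - F' z‖ ≤ N := (norm_fst_le (Phi (F z) - Phi (F' z))).trans hY
  have hv : |v z i - v' z i| ≤ N := (PiLp.norm_apply_le (v z - v' z) i).trans
    (norm_fst_le (((v z, Phi (F z)) : State) - (v' z, Phi (F' z))))
  have t1 := mul_le_mul hV h1 (abs_nonneg _) hV0
  have t2 := mul_le_mul hV ((ContinuousLinearMap.le_opNorm _ _).trans (mul_le_mul (hD z)
    ((norm_dPhiLin_remainder_le i α (F' z) (F z)).trans (mul_le_mul_of_nonneg_left
      ((pow_le_pow_left₀ (norm_nonneg _) hF 2).trans h2) zero_le_two))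
    (norm_nonneg _) hD0)) (norm_nonneg _) hV0
  have t3 := mul_le_mul hv ((ContinuousLinearMap.le_opNorm _ _).trans (mul_le_mul hB
    (((dPhiLin i α).le_opNorm _).trans (mul_le_mul_of_nonneg_left hY (norm_nonneg _)))
    (norm_nonneg _) hB0)) (norm_nonneg _) hN
  have t4 := mul_le_mul_of_nonneg_left h2 (mul_nonneg hB0 (norm_nonneg (dPhiLin i α)))
  rw [Real.norm_eq_abs] at t1 t2
  rw [← abs_mul] at t1
  rw [Real.norm_eq_abs, ← abs_mul] at t2
  rw [Real.norm_eq_abs, ← abs_mul] at t3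
  refine (abs_add_three _ _ _).trans ?_
  rw [mul_neg, abs_neg]
  linarith

variable (hT : 0 < T) (hv₀ : ∀ᵐ x : Torus, v₀ x = v' (0, x))
  (hF₀ : ∀ᵐ x : Torus, Phi (F₀ x) = Phi (F' (0, x)))
include hT hv₀ hF₀

/-- The evolution of the part of the relative energy which is linear in the difference of the
solutions. -/
theorem exists_remainder : ∃ R, Integrable R (muT T) ∧
    (∃ C, ∀ᵐ z ∂(muT T), |R z| ≤ C * meanRelEnergy G ν v' F' z) ∧
    ∀ θ, IsTimeWeight T θ →
      ∫ z, deriv θ z.1 * (∑ i, v' z i * (v z i - v' z i)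
        + fderiv ℝ G (Phi (F' z)) (Phi (F z) - Phi (F' z))) ∂(muT T)
      = ∫ z, θ z.1 * R z ∂(muT T) := by
  have hpiola := piola_lipschitz hG hT hsol hlip hF₀
  have hv' := hlip.bddLip_apply
  have hL := hlip.bddLip_fderiv hG
  have hd : ∀ i, Integrable (fun z => v z i - v' z i) (muT T) := fun i =>
    (hsol.integrable_v_apply hG i).sub ((hv' i).integrable T)
  have hY : Integrable (fun z => Phi (F z) - Phi (F' z)) (muT T) :=
    (hsol.integrable_Phi hG).sub (hlip.bddLip_Phi.integrable T)
  -- The contributions of the momentum equation, the transport equations and Piola's identity.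
  let R₁ : Fin 3 → ℝ × Torus → ℝ := fun i z =>
    ∑ α, dirDeriv (spaceDir α) (fun z => v' z i) z
            * (∫ s, stress G i α s.2 ∂(ν z) - stress G i α (Phi (F' z)))
          - dirDeriv timeDir (fun z => v' z i) z * (v z i - v' z i)
  let R₂ : ℝ × Torus → ℝ := fun z =>
    ∑ α, dirDeriv (spaceDir α) (fun z => fderiv ℝ G (Phi (F' z))) z
            (nullFlux α (F z) (v z) - nullFlux α (F' z) (v' z))
          - dirDeriv timeDir (fun z => fderiv ℝ G (Phi (F' z))) z (Phi (F z) - Phi (F' z))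
  let R₃ : Fin 3 → ℝ × Torus → ℝ := fun i z =>
    ∑ α, dirDeriv (spaceDir α) (fun z => v' z i • fderiv ℝ G (Phi (F' z))) z
      (dPhiLin i α (Phi (F z) - Phi (F' z)))
  have hR₁ : ∀ i, Integrable (R₁ i) (muT T) := fun i => by
    refine (integrable_finsetSum _ fun α _ => ?_).sub
      ((hv' i).integrable_dirDeriv_smul timeDir (hd i))
    exact (hv' i).integrable_dirDeriv_smul (spaceDir α)
      ((hsol.integrable_mean_stress hG i α).sub ((hlip.bddLip_stress hG i α).integrable T))
  have hR₂ : Integrable R₂ (muT T) := by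
    refine (integrable_finsetSum _ fun α _ => ?_).sub (hL.integrable_dirDeriv_apply timeDir hY)
    exact hL.integrable_dirDeriv_apply (spaceDir α)
      ((hsol.integrable_nullFlux hG α).sub ((hlip.bddLip_nullFlux α).integrable T))
  have hR₃ : ∀ i, Integrable (R₃ i) (muT T) := fun i =>
    integrable_finsetSum _ fun α _ => ((hv' i).smul hL).integrable_dirDeriv_apply (spaceDir α)
      ((dPhiLin i α).integrable_comp hY)
  have hRsum : Integrable (fun z => ∑ i, R₁ i z + R₂ z) (muT T) :=
    (integrable_finsetSum _ fun i _ => hR₁ i).add hR₂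
  refine ⟨fun z => ∑ i, R₁ i z + R₂ z - ∑ i, R₃ i z,
    hRsum.sub (integrable_finsetSum _ fun i _ => hR₃ i), ?_, fun θ hθ => ?_⟩
  · choose C hC using fun i α => remainder_term_le hG hsol hlip i α
    refine ⟨∑ i, ∑ α, C i α, ?_⟩
    filter_upwards [ae_all_iff.2 fun i => ae_all_iff.2 fun α => hC i α,
      hlip.ae_momentum hG hpiola, hlip.ae_transport hpiola,
      hlip.ae_dirDeriv_fderiv hG timeDir,
      ae_all_iff.2 fun α => hlip.ae_dirDeriv_fderiv hG (spaceDir α),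
      ae_all_iff.2 fun i => ae_all_iff.2 fun α => (hv' i).ae_hasDirDeriv (spaceDir α) T,
      ae_all_iff.2 fun α => hL.ae_hasDirDeriv (spaceDir α) T] with z h1 h2 h3 h4 h5 h6 h7
    have e : ∀ i α, dirDeriv (spaceDir α) (fun z => v' z i • fderiv ℝ G (Phi (F' z))) z
        = v' z i • dirDeriv (spaceDir α) (fun z => fderiv ℝ G (Phi (F' z))) z
          + dirDeriv (spaceDir α) (fun z => v' z i) z • fderiv ℝ G (Phi (F' z)) := fun i α =>
      ((h6 i α).smul (h7 α)).dirDeriv_eq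
    simp only [R₁, R₂, R₃, e]
    simp only [h4, h5] at h1 ⊢
    rw [hG.remainder_identity (F z) (F' z) (v z) (v' z)
      (fun i α => ∫ s, stress G i α s.2 ∂(ν z))
      (fun i α => dirDeriv (spaceDir α) (fun z => v' z i) z)
      (fun α => dirDeriv (spaceDir α) (fun z => Phi (F' z)) z)
      (fun i => dirDeriv timeDir (fun z => v' z i) z) _ h2 h3, Finset.sum_mul]
    refine (Finset.abs_sum_le_sum_abs _ _).trans (Finset.sum_le_sum fun i _ => ?_)
    rw [Finset.sum_mul]
    exact (Finset.abs_sum_le_sum_abs _ _).trans (Finset.sum_le_sum fun α _ => h1 i α)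
  · have e1 : ∀ i, ∫ z, deriv θ z.1 * (v' z i * (v z i - v' z i)) ∂(muT T)
        = ∫ z, θ z.1 * R₁ i z ∂(muT T) := weighted_momentum hG hT hsol hlip hθ hv₀
    have e2 : ∫ z, deriv θ z.1 * fderiv ℝ G (Phi (F' z)) (Phi (F z) - Phi (F' z)) ∂(muT T)
        = ∫ z, θ z.1 * R₂ z ∂(muT T) := weighted_transport hG hT hsol hlip hθ hF₀
    have e3 : ∀ i, ∫ z, θ z.1 * R₃ i z ∂(muT T) = 0 :=
      weighted_piola hG hT hsol hlip hθ hF₀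
    have hA : ∀ i, Integrable (fun z => deriv θ z.1 * (v' z i * (v z i - v' z i))) (muT T) :=
      fun i => hθ.integrable_deriv_mul ((hv' i).integrable_smul (hd i))
    have hB : Integrable (fun z => deriv θ z.1
        * fderiv ℝ G (Phi (F' z)) (Phi (F z) - Phi (F' z))) (muT T) :=
      hθ.integrable_deriv_mul (hL.integrable_apply hY)
    have hC₁ := fun i => hθ.integrable_mul (hR₁ i)
    have hC₂ := hθ.integrable_mul hR₂
    have hC₃ := fun i => hθ.integrable_mul (hR₃ i)
    clear_value R₁ R₂ R₃
    simp only [mul_add (deriv θ _), mul_sub (θ _), mul_add (θ _), Finset.mul_sum]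
    rw [integral_add (integrable_finsetSum _ fun i _ => hA i) hB,
      integral_finsetSum _ fun i _ => hA i, e2,
      integral_sub (f := fun z => ∑ i, θ z.1 * R₁ i z + θ z.1 * R₂ z)
        ((integrable_finsetSum _ fun i _ => hC₁ i).add hC₂)
        (integrable_finsetSum _ fun i _ => hC₃ i),
      integral_add (integrable_finsetSum _ fun i _ => hC₁ i) hC₂,
      integral_finsetSum _ fun i _ => hC₁ i, integral_finsetSum _ fun i _ => hC₃ i]
    simp only [e1, e3, Finset.sum_const_zero, sub_zero]

end

/-! ### Gronwall's argument -/

section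

variable {G : Ext → ℝ} {p q r : ℝ} (hG : StoredEnergy G p q r) {T : ℝ} (hT : 0 < T)
  {v₀ : Torus → Vec3} {F₀ : Torus → Mat3} {y v : ℝ × Torus → Vec3} {F : ℝ × Torus → Mat3}
  {Ξ : ℝ × Torus → Ext} {ν : Kernel (ℝ × Torus) State} {γ : Measure (ℝ × Torus)}
  (hsol : IsDissipativeSolution G p T v₀ F₀ y v F Ξ ν γ)
  {v' : ℝ × Torus → Vec3} {F' : ℝ × Torus → Mat3} (hlip : IsGlobalSolution G T v' F')
  (hv₀ : ∀ᵐ x : Torus, v₀ x = v' (0, x))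
  (hF₀ : ∀ᵐ x : Torus, Phi (F₀ x) = Phi (F' (0, x)))
include hG hT hsol hlip hv₀ hF₀

/-- The relative energy and the concentration measure together satisfy a differential inequality:
the dissipation inequality, minus the conservation of energy of the Lipschitz solution, minus the
evolution of the linear part. -/
theorem relative_energy_inequality : ∃ C, 0 ≤ C ∧ ∀ θ, IsTimeWeight T θ → (∀ t, 0 ≤ θ t) →
    0 ≤ ∫ z, (deriv θ z.1 + C * θ z.1) * meanRelEnergy G ν v' F' z ∂(muT T)
      + ∫ z, deriv θ z.1 ∂(γ.restrict (QT T)) := by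
  have hmv := hsol.toIsMeasureValuedSolution
  have := hsol.markov
  obtain ⟨f, hf⟩ := hsol.generated
  obtain ⟨R, hR, ⟨C, hC⟩, key⟩ := exists_remainder hG hmv hlip hT hv₀ hF₀
  refine ⟨max C 0, le_max_right _ _, fun θ hθ hpos => ?_⟩
  have hh := integrable_meanRelEnergy hG hmv hlip
  have hcross := integrable_cross hG hmv hlip
  have hE' := integrable_energy_lipschitz hG hlip
  have hE := hG.integrable_mean_energy hf
  have h1 := hsol.dissipation θ hθ.contDiff hθ.late fun t _ => hpos t
  have h2 := hlip.energy_conservation hG hT (piola_lipschitz hG hT hmv hlip hF₀) hθ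
  -- The initial energies agree, so that the initial terms of the two energy balances cancel.
  have h3 : ∫ x, θ 0 * energy G (v₀ x, Phi (F₀ x))
      = ∫ x, θ 0 * energy G (v' (0, x), Phi (F' (0, x))) := by
    refine integral_congr_ae ?_
    filter_upwards [hv₀, hF₀] with x hx hx'
    rw [hx, hx']
  have h4 : ∫ z, deriv θ z.1 * meanRelEnergy G ν v' F' z ∂(muT T)
      = ∫ z, deriv θ z.1 * (∫ s, energy G s ∂(ν z)) ∂(muT T)
        - ∫ z, deriv θ z.1 * energy G (v' z, Phi (F' z)) ∂(muT T)
        - ∫ z, θ z.1 * R z ∂(muT T) := by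
    rw [← key θ hθ, ← integral_sub (hθ.integrable_deriv_mul hE) (hθ.integrable_deriv_mul hE'),
      ← integral_sub (f := fun z => deriv θ z.1 * (∫ s, energy G s ∂(ν z))
          - deriv θ z.1 * energy G (v' z, Phi (F' z)))
        ((hθ.integrable_deriv_mul hE).sub (hθ.integrable_deriv_mul hE'))
        (hθ.integrable_deriv_mul hcross)]
    refine integral_congr_ae ?_
    filter_upwards [ae_meanRelEnergy_eq hG hmv (v' := v') (F' := F')] with z hz
    rw [hz]
    ring
  have h5 : -∫ z, θ z.1 * R z ∂(muT T)
      ≥ -∫ z, θ z.1 * (max C 0 * meanRelEnergy G ν v' F' z) ∂(muT T) := by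
    refine neg_le_neg (integral_mono_ae (hθ.integrable_mul hR)
      (hθ.integrable_mul (hh.const_mul _)) ?_)
    filter_upwards [hC] with z hz
    refine mul_le_mul_of_nonneg_left ((le_abs_self _).trans (hz.trans ?_)) (hpos _)
    exact mul_le_mul_of_nonneg_right (le_max_left _ _) (meanRelEnergy_nonneg hG z)
  have h6 : ∫ z, (deriv θ z.1 + max C 0 * θ z.1) * meanRelEnergy G ν v' F' z ∂(muT T)
      = ∫ z, deriv θ z.1 * meanRelEnergy G ν v' F' z ∂(muT T)
        + ∫ z, θ z.1 * (max C 0 * meanRelEnergy G ν v' F' z) ∂(muT T) := by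
    rw [← integral_add (hθ.integrable_deriv_mul hh) (hθ.integrable_mul (hh.const_mul _))]
    congr 1
    funext z
    ring
  have h7 := h1
  rw [h3] at h7
  linarith

/-- Gronwall's argument: the weight decays at a rate larger than the constant in the relative
energy inequality. -/
theorem eq_zero_before {b : ℝ} (hb : b < T) :
    (∀ᵐ z ∂(muT T), z.1 < b → meanRelEnergy G ν v' F' z = 0) ∧ γ (Ico 0 b ×ˢ univ) = 0 := by
  have hmv := hsol.toIsMeasureValuedSolution
  obtain ⟨C, hC, hineq⟩ := relative_energy_inequality hG hT hsol hlip hv₀ hF₀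
  obtain ⟨θ, hθ, hθ0, hθpos, hθd⟩ := exists_timeWeight hb (C + 1)
  obtain ⟨f, -, hγ⟩ := hsol.concentration
  have := hγ.finite
  have hh := integrable_meanRelEnergy hG hmv hlip
  have hθh := hθ.integrable_mul hh
  have hQ : MeasurableSet (QT T) := measurableSet_Ico.prod MeasurableSet.univ
  obtain ⟨⟨K, hK⟩, M, hM⟩ := hθ.bddLip
  have hθγ : Integrable (fun z : ℝ × Torus => θ z.1) (γ.restrict (QT T)) :=
    Integrable.of_bound hK.continuous.aestronglyMeasurable M (Eventually.of_forall hM)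
  have hdγ : Integrable (fun z : ℝ × Torus => deriv θ z.1) (γ.restrict (QT T)) := by
    refine Integrable.of_bound ((hθ.contDiff.continuous_deriv le_rfl).comp
      continuous_fst).aestronglyMeasurable (K * ‖timeDir‖) (Eventually.of_forall fun z => ?_)
    rw [← (hasDirDeriv_time hθ z).dirDeriv_eq]
    exact norm_dirDeriv_le hK timeDir z
  have h1 : ∫ z, (deriv θ z.1 + C * θ z.1) * meanRelEnergy G ν v' F' z ∂(muT T)
      ≤ -∫ z, θ z.1 * meanRelEnergy G ν v' F' z ∂(muT T) := by
    rw [← integral_neg]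
    have hi : Integrable (fun z => (deriv θ z.1 + C * θ z.1) * meanRelEnergy G ν v' F' z)
        (muT T) := by
      refine ((hθ.integrable_deriv_mul hh).add (hθh.const_mul C)).congr
        (Eventually.of_forall fun z => ?_)
      simp only [Pi.add_apply]
      ring
    refine integral_mono_ae hi hθh.neg ?_
    filter_upwards [ae_muT_mem_Ioo T] with z hz
    have h2 := mul_le_mul_of_nonneg_right (hθd z.1 hz.1.le)
      (meanRelEnergy_nonneg (v' := v') (F' := F') (ν := ν) hG z)
    linarith
  have h2 : ∫ z, deriv θ z.1 ∂(γ.restrict (QT T)) ≤ -∫ z, θ z.1 ∂(γ.restrict (QT T)) := by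
    rw [← integral_neg]
    refine integral_mono_ae hdγ hθγ.neg ?_
    filter_upwards [ae_restrict_mem hQ] with z hz
    have h2 := hθd z.1 hz.1.1
    have h3 := mul_nonneg hC (hθ0 z.1)
    linarith
  have h3 := hineq θ hθ hθ0
  have h4 : 0 ≤ᵐ[muT T] fun z => θ z.1 * meanRelEnergy G ν v' F' z :=
    Eventually.of_forall fun z => mul_nonneg (hθ0 _) (meanRelEnergy_nonneg hG z)
  have h5 : 0 ≤ᵐ[γ.restrict (QT T)] fun z => θ z.1 := Eventually.of_forall fun z => hθ0 _
  have h6 := integral_nonneg_of_ae h4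
  have h7 := integral_nonneg_of_ae h5
  constructor
  · filter_upwards [(integral_eq_zero_iff_of_nonneg_ae h4 hθh).1 (by linarith),
      ae_muT_mem_Ioo T] with z hz hzT hzb
    exact (mul_eq_zero.1 hz).resolve_left (hθpos _ hzT.1.le hzb).ne'
  · have h8 := (integral_eq_zero_iff_of_nonneg_ae h5 hθγ).1 (by linarith)
    have h9 : ∀ᵐ z ∂(γ.restrict (QT T)), z ∉ Ico 0 b ×ˢ (univ : Set Torus) := by
      filter_upwards [h8] with z hz hzb
      exact (hθpos _ hzb.1.1 hzb.1.2).ne' hz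
    rw [ae_restrict_iff' hQ] at h9
    refine measure_mono_null (fun z hz => ?_) (ae_iff.1 h9)
    exact fun h => h ⟨⟨hz.1.1, hz.1.2.trans hb⟩, hz.2⟩ hz

theorem ae_meanRelEnergy_eq_zero : ∀ᵐ z ∂(muT T), meanRelEnergy G ν v' F' z = 0 := by
  have h := ae_all_iff.2 fun n : ℕ => (eq_zero_before hG hT hsol hlip hv₀ hF₀
    (b := T - 1 / ((n : ℝ) + 1)) (by linarith [Nat.one_div_pos_of_nat (α := ℝ) (n := n)])).1
  filter_upwards [h, ae_muT_mem_Ioo T] with z hz hzT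
  obtain ⟨n, hn⟩ := exists_nat_one_div_lt (sub_pos.2 hzT.2)
  exact hz n (by linarith)

/-- The concentration measure does not charge `[0, T) × Q` by Gronwall's argument, and it does not
charge the final time as the energy is bounded uniformly in time. -/
theorem concentration_eq_zero : γ = 0 := by
  have := hsol.markov
  obtain ⟨f, hf, hγ⟩ := hsol.concentration
  have h1 := hG.concentration_final hf hγ
  have h2 : ∀ n : ℕ, γ (Ico 0 (T - 1 / ((n : ℝ) + 1)) ×ˢ univ) = 0 := fun n =>
    (eq_zero_before hG hT hsol hlip hv₀ hF₀
      (by linarith [Nat.one_div_pos_of_nat (α := ℝ) (n := n)])).2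
  rw [← Measure.measure_univ_eq_zero]
  refine measure_mono_null (t := (QTbar T)ᶜ ∪ ({T} ×ˢ univ ∪
    ⋃ n : ℕ, Ico 0 (T - 1 / ((n : ℝ) + 1)) ×ˢ univ)) (fun z _ => ?_)
    (measure_union_null hγ.carrier (measure_union_null h1 (measure_iUnion_null h2)))
  by_cases hz : z ∈ QTbar T
  · right
    rcases eq_or_lt_of_le hz.1.2 with h | h
    · exact Or.inl ⟨h, mem_univ _⟩
    · obtain ⟨n, hn⟩ := exists_nat_one_div_lt (sub_pos.2 h)
      exact Or.inr (mem_iUnion.2 ⟨n, ⟨hz.1.1, by linarith⟩, mem_univ _⟩)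
  · exact Or.inl hz

end

end

end PolyconvexElasticity

open PolyconvexElasticity in
theorem theorem3p3
    (G : Ext → ℝ) (p q r : ℝ) (hG : StoredEnergy G p q r)
    (T : ℝ) (hT : 0 < T)
    (v₀ : Torus → Vec3) (F₀ : Torus → Mat3)
    (y v : ℝ × Torus → Vec3) (F : ℝ × Torus → Mat3) (Ξ : ℝ × Torus → Ext)
    (ν : ProbabilityTheory.Kernel (ℝ × Torus) State) (γ : MeasureTheory.Measure (ℝ × Torus))
    (hsol : IsDissipativeSolution G p T v₀ F₀ y v F Ξ ν γ)
    (v' : ℝ × Torus → Vec3) (F' : ℝ × Torus → Mat3)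
    (hlip : IsLipschitzSolution G T v' F')
    (hv₀ : ∀ᵐ x : Torus, v₀ x = v' (0, x))
    (hF₀ : ∀ᵐ x : Torus, Phi (F₀ x) = Phi (F' (0, x))) :
    γ = 0 ∧
      (∀ᵐ z ∂(muT T), v z = v' z ∧ Ξ z = Phi (F' z)) ∧
      (∀ᵐ z ∂(muT T), ν z = MeasureTheory.Measure.dirac (v' z, Phi (F' z))) := by
  -- Only the values on `[0, T] × Q` are constrained: replace the rest by the values at the nearest
  -- time in `[0, T]`.
  have hglob := hlip.clampTime hT
  have h0 : ∀ x, clampTime T (0, x) = (0, x) := fun x => clampTime_eq ⟨le_rfl, hT.le⟩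
  have hv₁ : ∀ᵐ x : Torus, v₀ x = v' (clampTime T (0, x)) := by simpa only [h0] using hv₀
  have hF₁ : ∀ᵐ x : Torus, Phi (F₀ x) = Phi (F' (clampTime T (0, x))) := by
    simpa only [h0] using hF₀
  have := hsol.markov
  have hdirac : ∀ᵐ z ∂(muT T), ν z = MeasureTheory.Measure.dirac (v' z, Phi (F' z)) := by
    filter_upwards [ae_meanRelEnergy_eq_zero hG hT hsol hglob hv₁ hF₁, ae_muT_mem_Ioo T,
      hsol.ae_mean hG] with z hz hzT hm
    have h := hG.eq_dirac hm.1 hz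
    beta_reduce at h
    rwa [clampTime_eq ⟨hzT.1.le, hzT.2.le⟩] at h
  refine ⟨concentration_eq_zero hG hT hsol hglob hv₁ hF₁, ?_, hdirac⟩
  filter_upwards [hdirac, hsol.ae_mean hG, hsol.constraint] with z hz hm hc
  have h := hm.2
  rw [hz, MeasureTheory.integral_dirac] at h
  exact ⟨(congrArg Prod.fst h).symm, hc.trans (congrArg Prod.snd h).symm⟩
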